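/- **Theorem (Pontrjagin ring of topological quantum observables on Maxwell fluxes).** Let $\Sigma$ be a compact Hausdorff topological manifold without boundary (for instance a closed orientable surface, not necessarily connected), let $K$ be a discrete group, and let $\epsilon_1,\epsilon_2 : K \to \{\pm 1\}$ be homomorphisms. Let $K$ act on $\mathrm{U}(1)^2$ by $k\cdot(z,w) = (z^{\epsilon_1(k)}, w^{\epsilon_2(k)})$, and form the topological group $G = \mathrm{U}(1)^2\rtimes K$ and its classifying space $BG$, with base point $\ast$. Let $H^0(\Sigma;K) = \pi_0\,\mathrm{Map}(\Sigma,K)$ be the group of locally constant functions $\Sigma\to K$. It acts on $H^1(\Sigma;\mathbb{Z})^2$ by multiplying the two factors with the locally constant signs $\epsilon_1\circ k$ and $\epsilon_2\circ k$; form $\Gamma = H^1(\Sigma;\mathbb{Z})^2\rtimes H^0(\Sigma;K)$. Consider the moduli space of topological fields vanishing at spatial infinity $$\mathcal{M} \;=\; \mathrm{Map}^{\ast/}\Big(\mathbb{R}^{0,1}_{\sqcup\{\infty\}}\wedge\big(\mathbb{R}^1\times\Sigma\big)_{\cup\{\infty\}},\; BG\Big),$$ where $X_{\sqcup\{\infty\}}$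 is $X$ with a disjoint base point, $X_{\cup\{\infty\}}$ is the one-point compactification, and $\mathrm{Map}^{\ast/}$ is the space of pointed maps. Let $r : \mathcal{M}\to \Omega\,\mathrm{Map}(\Sigma,BG)$, with loops based at the constant map to $\ast$, be the map which restricts a field to time $0$ and regards it as a loop along the $\mathbb{R}^1$-direction. The homology $H_0(\Omega\,\mathrm{Map}(\Sigma,BG);\mathbb{C})$ is a Hopf algebra: its product is the pushforward along concatenation of loops, its coproduct the pushforward along the diagonal, its antipode the pushforward along reversal of loops. It also carries the star-involution $(-)^\dagger$ given by reversal of loops followed by complex conjugation. Then $r$ induces an isomorphism $H_0(\mathcal{M};\mathbb{C}) \simeq H_0(\Omega\,\mathrm{Map}(\Sigma,BG);\mathbb{C})$, and there is an isomorphism of Hopf algebras $$H_0\big(\Omega\,\mathrm{Map}(\Sigma,BG);\mathbb{C}\big)\;\simeq\;\mathbb{C}\big[H^1(\Sigma;\mathbb{Z})^2\rtimes H^0(\Sigma;K)\big]$$ which also respects the star-involutions, where the one on the group algebra is $\sum_g c_g\, g\mapsto\sum_g \overline{c_g}\,g^{-1}$. Hence, with the Hopf algebra structure which $H_0(\mathcal{M};\mathbb{C})$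 receives through $r$, $$H_0(\mathcal{M};\mathbb{C})\;\simeq\;\mathbb{C}\big[H^1(\Sigma;\mathbb{Z})^2\rtimes H^0(\Sigma;K)\big]$$ as Hopf algebras. -/

import Mathlib

universe u v w

noncomputable section

namespace FluxModuli

/-! ### Singular homology in degree zero -/

section Homology
open CategoryTheory AlgebraicTopology Limits
open scoped TensorProduct Simplicial


/-- Singular homology `H₀(X; ℂ)`. -/
def H0 (X : Type w) [TopologicalSpace X] : Type w :=
  ((singularHomologyFunctor (ModuleCat.{w} ℂ) 0).obj (ModuleCat.of ℂ (ULift.{w} ℂ))).obj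
    (TopCat.of X)

namespace H0
variable {X Y Z : Type w} [TopologicalSpace X] [TopologicalSpace Y] [TopologicalSpace Z]

instance : AddCommGroup (H0 X) := by unfold H0; infer_instance
instance : Module ℂ (H0 X) := by unfold H0; infer_instance

/-- Pushforward in homology. -/
def map (f : C(X, Y)) : H0 X →ₗ[ℂ] H0 Y :=
  (((singularHomologyFunctor (ModuleCat.{w} ℂ) 0).obj (ModuleCat.of ℂ (ULift.{w} ℂ))).map
    (TopCat.ofHom f)).hom

/-- The map `ℂ ⟶ H₀(X; ℂ)` which sends `1` to the class of the singular `0`-cycle `x`. -/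
def cls (x : X) : ModuleCat.of ℂ (ULift.{w} ℂ) ⟶
    ((singularHomologyFunctor (ModuleCat.{w} ℂ) 0).obj (ModuleCat.of ℂ (ULift.{w} ℂ))).obj
      (TopCat.of X) :=
  ((TopCat.toSSet.obj (TopCat.of X)).chainComplex (ModuleCat.of ℂ (ULift.{w} ℂ))).liftCycles
      (SSet.ιChainComplex _ (TopCat.toSSetObj₀Equiv.symm x)) 0 (by simp) (by simp) ≫
    ((TopCat.toSSet.obj (TopCat.of X)).chainComplex (ModuleCat.of ℂ (ULift.{w} ℂ))).homologyπ 0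

/-- The homology class of a point. -/
def pt (x : X) : H0 X := (cls x).hom (ULift.up 1)

theorem cls_comp_map (f : C(X, Y)) (x : X) :
    cls x ≫ ((singularHomologyFunctor (ModuleCat.{w} ℂ) 0).obj
      (ModuleCat.of ℂ (ULift.{w} ℂ))).map (TopCat.ofHom f) = cls (f x) := by
  have key : (((TopCat.toSSet.obj (TopCat.of X)).chainComplex
        (ModuleCat.of ℂ (ULift.{w} ℂ))).liftCycles
      (SSet.ιChainComplex _ (TopCat.toSSetObj₀Equiv.symm x)) 0 (by simp) (by simp) ≫
    ((TopCat.toSSet.obj (TopCat.of X)).chainComplex (ModuleCat.of ℂ (ULift.{w} ℂ))).homologyπ 0) ≫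
      SSet.homologyMap (TopCat.toSSet.map (TopCat.ofHom f)) (ModuleCat.of ℂ (ULift.{w} ℂ)) 0 =
      cls (f x) := by
    simp only [SSet.homologyMap, Category.assoc, HomologicalComplex.homologyπ_naturality,
      HomologicalComplex.liftCycles_comp_cyclesMap_assoc, cls]
    congr 2
    rw [SSet.ι_chainComplexMap_f]
    congr 1
  exact key

theorem map_pt (f : C(X, Y)) (x : X) : map f (pt x) = pt (f x) :=
  congrArg (fun g => g.hom (ULift.up 1)) (cls_comp_map f x)

open Classical in
/-- Singular homology in degree zero is a direct sum over the path components. -/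
def equivCoprod (X : Type w) [TopologicalSpace X] :
    H0 X ≃ₗ[ℂ] (DirectSum (ZerothHomotopy X) fun _ => ULift.{w} ℂ) :=
  (TopCat.singularHomology₀Iso (TopCat.of X) (ModuleCat.of ℂ (ULift.{w} ℂ)) ≪≫
    ModuleCat.coprodIsoDirectSum
      (fun _ : ZerothHomotopy X => ModuleCat.of ℂ (ULift.{w} ℂ))).toLinearEquiv

open Classical in
/-- Singular homology in degree zero is free on the path components. -/
def equiv (X : Type w) [TopologicalSpace X] : H0 X ≃ₗ[ℂ] (ZerothHomotopy X →₀ ℂ) :=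
  (equivCoprod X).trans <|
    (finsuppLEquivDirectSum ℂ (ULift.{w} ℂ) (ZerothHomotopy X)).symm.trans <|
    Finsupp.mapRange.linearEquiv ULift.moduleEquiv


theorem cls_comp_iso (x : X) :
    cls x ≫ (TopCat.singularHomology₀Iso (TopCat.of X) (ModuleCat.of ℂ (ULift.{w} ℂ))).hom =
      Sigma.ι (fun _ : ZerothHomotopy X => ModuleCat.of ℂ (ULift.{w} ℂ)) (ZerothHomotopy.mk x) := by
  have h := SSet.liftCycles_ιChainComplex_homologyπ_homology₀Iso_hom
    (TopCat.toSSet.obj (TopCat.of X)) (ModuleCat.of ℂ (ULift.{w} ℂ))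
    (TopCat.toSSetObj₀Equiv.symm x)
  have h2 : Sigma.ι (fun _ : (TopCat.toSSet.obj (TopCat.of X)).π₀ => ModuleCat.of ℂ (ULift.{w} ℂ))
        (SSet.π₀.mk (TopCat.toSSetObj₀Equiv.symm x)) ≫
      ((sigmaConst.obj (ModuleCat.of ℂ (ULift.{w} ℂ))).mapIso
        (TopCat.zerothHomotopyEquiv (X := TopCat.of X)).toIso.symm).hom =
      Sigma.ι (fun _ : ZerothHomotopy X => ModuleCat.of ℂ (ULift.{w} ℂ)) (ZerothHomotopy.mk x) := by
    simp [sigmaConst, Sigma.map']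
    rfl
  rw [← h2, ← h]
  simp only [Category.assoc]
  rfl

theorem equiv_pt (x : X) : equiv X (pt x) = Finsupp.single (ZerothHomotopy.mk x) 1 := by
  classical
  have h1 : equivCoprod X (pt x) =
      DirectSum.lof ℂ (ZerothHomotopy X) (fun _ => ULift.{w} ℂ) (ZerothHomotopy.mk x)
        (ULift.up 1) := by
    have h := cls_comp_iso x
    have h2 := ModuleCat.ι_coprodIsoDirectSum_hom
          (fun _ : ZerothHomotopy X => ModuleCat.of ℂ (ULift.{w} ℂ)) (ZerothHomotopy.mk x)
    rw [← h, Category.assoc] at h2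
    exact congrArg (fun g => g.hom (ULift.up 1)) h2
  simp only [equiv, LinearEquiv.trans_apply, h1]
  rw [← finsuppLEquivDirectSum_single]
  simp


theorem pt_eq_of_joined {x y : X} (h : Joined x y) : pt x = pt y := by
  apply (equiv X).injective
  rw [equiv_pt, equiv_pt, ZerothHomotopy.sound h.somePath]

theorem span_pt : Submodule.span ℂ (Set.range (pt (X := X))) = ⊤ := by
  rw [eq_top_iff]
  intro a _
  obtain ⟨c, rfl⟩ := (equiv X).symm.surjective a
  induction c using Finsupp.induction_linear with
  | zero => simp
  | add f g hf hg => rw [map_add]; exact Submodule.add_mem _ (hf trivial) (hg trivial)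
  | single p z =>
    obtain ⟨x, rfl⟩ := ZerothHomotopy.mk_surjective p
    have : (equiv X).symm (Finsupp.single (ZerothHomotopy.mk x) z) = z • pt x := by
      rw [LinearEquiv.symm_apply_eq, map_smul, equiv_pt]; simp
    rw [this]
    exact Submodule.smul_mem _ _ (Submodule.subset_span ⟨x, rfl⟩)

theorem induction [hX : Nonempty X] {p : H0 X → Prop} (h_pt : ∀ x, p (pt x))
    (h_add : ∀ a b, p a → p b → p (a + b)) (h_smul : ∀ (z : ℂ) a, p a → p (z • a)) (a : H0 X) :
    p a := by
  have ha : a ∈ Submodule.span ℂ (Set.range (pt (X := X))) := by rw [span_pt]; trivial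
  induction ha using Submodule.span_induction with
  | mem a h => obtain ⟨x, rfl⟩ := h; exact h_pt x
  | zero =>
    obtain ⟨x⟩ := hX
    simpa using h_smul 0 _ (h_pt x)
  | add a b _ _ ha hb => exact h_add a b ha hb
  | smul z a _ ha => exact h_smul z a ha

theorem hom_ext {M : Type*} [AddCommMonoid M] [Module ℂ M] {f g : H0 X →ₗ[ℂ] M}
    (h : ∀ x, f (pt x) = g (pt x)) : f = g :=
  LinearMap.ext_on span_pt (by rintro _ ⟨x, rfl⟩; exact h x)

/-- Path components of a product. -/
def zerothHomotopyProd (X Y : Type w) [TopologicalSpace X] [TopologicalSpace Y] :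
    ZerothHomotopy X × ZerothHomotopy Y ≃ ZerothHomotopy (X × Y) where
  toFun p := Quotient.map₂ (sa := pathSetoid X) (sb := pathSetoid Y) (sc := pathSetoid (X × Y))
    (fun x y => (x, y))
    (fun _ _ h _ _ h' => ⟨h.somePath.prod h'.somePath⟩) p.1 p.2
  invFun := ZerothHomotopy.lift (fun q => (ZerothHomotopy.mk q.1, ZerothHomotopy.mk q.2))
    (fun _ _ γ => Prod.ext (ZerothHomotopy.sound (γ.map continuous_fst))
      (ZerothHomotopy.sound (γ.map continuous_snd)))
  left_inv := by rintro ⟨⟨x⟩, ⟨y⟩⟩; rfl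
  right_inv := by rintro ⟨x, y⟩; rfl

/-- The homology cross product, `[x] ⊗ [y] ↦ [(x, y)]`, in degree zero an isomorphism. -/
def cross (X Y : Type w) [TopologicalSpace X] [TopologicalSpace Y] :
    H0 X ⊗[ℂ] H0 Y ≃ₗ[ℂ] H0 (X × Y) :=
  (TensorProduct.congr (equiv X) (equiv Y)).trans <|
    (finsuppTensorFinsupp' ℂ (ZerothHomotopy X) (ZerothHomotopy Y)).trans <|
    (Finsupp.domLCongr (zerothHomotopyProd X Y)).trans (equiv (X × Y)).symm

theorem cross_pt (x : X) (y : Y) : cross X Y (pt x ⊗ₜ pt y) = pt (x, y) := by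
  simp only [cross, LinearEquiv.trans_apply, TensorProduct.congr_tmul, equiv_pt,
    finsuppTensorFinsupp'_single_tmul_single, Finsupp.domLCongr_single, LinearEquiv.symm_apply_eq]
  simp
  rfl

theorem cross_symm_pt (x : X) (y : Y) : (cross X Y).symm (pt (x, y)) = pt x ⊗ₜ pt y := by
  rw [LinearEquiv.symm_apply_eq, cross_pt]

/-- The augmentation, the map to the homology of a point. -/
def aug (X : Type w) [TopologicalSpace X] : H0 X →ₗ[ℂ] ℂ :=
  Finsupp.lsum ℂ (fun _ => LinearMap.id) ∘ₗ (equiv X).toLinearMap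

theorem aug_pt (x : X) : aug X (pt x) = 1 := by
  simp [aug, equiv_pt]

/-- Complex conjugation of the coefficients. -/
def conj (X : Type w) [TopologicalSpace X] : H0 X →ₛₗ[starRingEnd ℂ] H0 X where
  toFun a := (equiv X).symm (Finsupp.mapRange (starRingEnd ℂ) (map_zero _) (equiv X a))
  map_add' a b := by
    rw [map_add, Finsupp.mapRange_add (map_add _), map_add]
  map_smul' z a := by
    rw [map_smul, ← map_smul (equiv X).symm]
    congr 1
    ext p
    simp

theorem conj_pt (x : X) : conj X (pt x) = pt x := by
  simp [conj, LinearEquiv.symm_apply_eq, equiv_pt]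

end H0

/-- The degree-zero homology of the loop space `Ω X` based at `x`, which carries the
Pontrjagin product. -/
def Pontrjagin {X : Type w} [TopologicalSpace X] (x : X) : Type w := H0 (Path x x)

namespace Pontrjagin
variable {X : Type w} [TopologicalSpace X] {x : X}

instance : AddCommGroup (Pontrjagin x) := inferInstanceAs (AddCommGroup (H0 (Path x x)))
instance : Module ℂ (Pontrjagin x) := inferInstanceAs (Module ℂ (H0 (Path x x)))

/-- Concatenation of loops. -/
def conc (x : X) : C(Path x x × Path x x, Path x x) :=
  ⟨fun p => p.1.trans p.2, by fun_prop⟩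

/-- Reversal of loops. -/
def rev (x : X) : C(Path x x, Path x x) := ⟨fun p => p.symm, Path.continuous_symm⟩

/-- The diagonal. -/
def diag (x : X) : C(Path x x, Path x x × Path x x) := ⟨fun p => (p, p), by fun_prop⟩

/-- The Pontrjagin product: cross product followed by pushforward along concatenation. -/
def mulMap (x : X) : Pontrjagin x ⊗[ℂ] Pontrjagin x →ₗ[ℂ] Pontrjagin x :=
  H0.map (conc x) ∘ₗ (H0.cross (Path x x) (Path x x)).toLinearMap

/-- The class of a loop. -/
def loop (γ : Path x x) : Pontrjagin x := H0.pt γ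

theorem mulMap_loop (γ δ : Path x x) : mulMap x (loop γ ⊗ₜ loop δ) = loop (γ.trans δ) := by
  have : mulMap x (loop γ ⊗ₜ loop δ) = H0.map (conc x) (H0.cross _ _ (H0.pt γ ⊗ₜ H0.pt δ)) := rfl
  rw [this, H0.cross_pt, H0.map_pt]
  rfl

theorem loop_eq {γ δ : Path x x} (h : γ.Homotopic δ) : loop γ = loop δ :=
  H0.pt_eq_of_joined ⟨
    { toFun := h.some.eval
      continuous_toFun := Path.continuous_uncurry_iff.1 h.some.continuous
      source' := h.some.eval_zero
      target' := h.some.eval_one }⟩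

theorem induction {p : Pontrjagin x → Prop} (h_loop : ∀ γ, p (loop γ))
    (h_add : ∀ a b, p a → p b → p (a + b))
    (h_smul : ∀ (z : ℂ) a, p a → p (z • a)) (a : Pontrjagin x) : p a :=
  haveI : Nonempty (Path x x) := ⟨Path.refl x⟩
  H0.induction (X := Path x x) h_loop h_add h_smul a

instance : Mul (Pontrjagin x) := ⟨fun a b => mulMap x (a ⊗ₜ b)⟩
instance : One (Pontrjagin x) := ⟨loop (Path.refl x)⟩

theorem mul_def (a b : Pontrjagin x) : a * b = mulMap x (a ⊗ₜ b) := rfl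
theorem one_def : (1 : Pontrjagin x) = loop (Path.refl x) := rfl

theorem loop_mul (γ δ : Path x x) : loop γ * loop δ = loop (γ.trans δ) := mulMap_loop γ δ

protected theorem mul_add (a b c : Pontrjagin x) : a * (b + c) = a * b + a * c := by
  simp only [mul_def, TensorProduct.tmul_add, map_add]

protected theorem add_mul (a b c : Pontrjagin x) : (a + b) * c = a * c + b * c := by
  simp only [mul_def, TensorProduct.add_tmul, map_add]

protected theorem smul_mul (z : ℂ) (a b : Pontrjagin x) : (z • a) * b = z • (a * b) := by
  rw [mul_def, mul_def, ← TensorProduct.smul_tmul', map_smul]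

protected theorem mul_smul (z : ℂ) (a b : Pontrjagin x) : a * (z • b) = z • (a * b) := by
  simp only [mul_def, TensorProduct.tmul_smul, map_smul]

instance : Ring (Pontrjagin x) :=
  { (inferInstance : AddCommGroup (Pontrjagin x)), (inferInstance : Mul (Pontrjagin x)),
    (inferInstance : One (Pontrjagin x)) with
    left_distrib := Pontrjagin.mul_add
    right_distrib := Pontrjagin.add_mul
    zero_mul := fun a => by simp [mul_def]
    mul_zero := fun a => by simp [mul_def]
    mul_assoc := fun a b c => by
      induction a using Pontrjagin.induction with
      | h_add a a' h h' => simp only [Pontrjagin.add_mul, h, h']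
      | h_smul z a h => simp only [Pontrjagin.smul_mul, h]
      | h_loop γ =>
      induction b using Pontrjagin.induction with
      | h_add a a' h h' => simp only [Pontrjagin.add_mul, Pontrjagin.mul_add, h, h']
      | h_smul z a h => simp only [Pontrjagin.smul_mul, Pontrjagin.mul_smul, h]
      | h_loop δ =>
      induction c using Pontrjagin.induction with
      | h_add a a' h h' => simp only [Pontrjagin.mul_add, h, h']
      | h_smul z a h => simp only [Pontrjagin.mul_smul, h]
      | h_loop ε =>
      simp only [loop_mul]
      exact loop_eq ⟨Path.Homotopy.transAssoc γ δ ε⟩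
    one_mul := fun a => by
      induction a using Pontrjagin.induction with
      | h_add a a' h h' => simp only [Pontrjagin.mul_add, h, h']
      | h_smul z a h => simp only [Pontrjagin.mul_smul, h]
      | h_loop γ => rw [one_def, loop_mul]; exact loop_eq ⟨Path.Homotopy.reflTrans γ⟩
    mul_one := fun a => by
      induction a using Pontrjagin.induction with
      | h_add a a' h h' => simp only [Pontrjagin.add_mul, h, h']
      | h_smul z a h => simp only [Pontrjagin.smul_mul, h]
      | h_loop γ => rw [one_def, loop_mul]; exact loop_eq ⟨Path.Homotopy.transRefl γ⟩ }

instance : Algebra ℂ (Pontrjagin x) :=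
  Algebra.ofModule Pontrjagin.smul_mul Pontrjagin.mul_smul

theorem hom_ext {M : Type*} [AddCommMonoid M] [Module ℂ M] {f g : Pontrjagin x →ₗ[ℂ] M}
    (h : ∀ γ, f (loop γ) = g (loop γ)) : f = g :=
  H0.hom_ext (X := Path x x) h

/-- The comultiplication is the pushforward along the diagonal, the counit is the augmentation. -/
instance : CoalgebraStruct ℂ (Pontrjagin x) where
  comul := (H0.cross (Path x x) (Path x x)).symm.toLinearMap ∘ₗ H0.map (diag x)
  counit := H0.aug (Path x x)

theorem comul_loop (γ : Path x x) :
    CoalgebraStruct.comul (R := ℂ) (loop γ) = loop γ ⊗ₜ[ℂ] loop γ := by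
  have : CoalgebraStruct.comul (R := ℂ) (loop γ) =
    (H0.cross (Path x x) (Path x x)).symm (H0.map (diag x) (H0.pt γ)) := rfl
  rw [this, H0.map_pt]
  exact H0.cross_symm_pt γ γ

theorem counit_loop (γ : Path x x) : CoalgebraStruct.counit (R := ℂ) (loop γ) = 1 :=
  H0.aug_pt γ

instance : Coalgebra ℂ (Pontrjagin x) where
  coassoc := hom_ext fun γ => by simp [comul_loop]
  rTensor_counit_comp_comul := hom_ext fun γ => by simp [comul_loop, counit_loop]
  lTensor_counit_comp_comul := hom_ext fun γ => by simp [comul_loop, counit_loop]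

instance : Bialgebra ℂ (Pontrjagin x) :=
  Bialgebra.mk' ℂ (Pontrjagin x)
    (counit_one := counit_loop _)
    (counit_mul := fun {a b} => by
      induction a using Pontrjagin.induction with
      | h_add a a' h h' => simp only [_root_.add_mul, map_add, h, h']
      | h_smul z a h => simp only [map_smul, h, _root_.smul_mul_assoc]
      | h_loop γ =>
      induction b using Pontrjagin.induction with
      | h_add a a' h h' => simp only [_root_.mul_add, map_add, h, h']
      | h_smul z a h => simp only [map_smul, h, _root_.mul_smul_comm]
      | h_loop δ => simp only [loop_mul, counit_loop, one_mul])
    (comul_one := by rw [one_def, comul_loop]; rfl)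
    (comul_mul := fun {a b} => by
      induction a using Pontrjagin.induction with
      | h_add a a' h h' => simp only [_root_.add_mul, map_add, h, h']
      | h_smul z a h => simp only [map_smul, h, _root_.smul_mul_assoc]
      | h_loop γ =>
      induction b using Pontrjagin.induction with
      | h_add a a' h h' => simp only [_root_.mul_add, map_add, h, h']
      | h_smul z a h => simp only [map_smul, h, _root_.mul_smul_comm]
      | h_loop δ => simp only [loop_mul, comul_loop, Algebra.TensorProduct.tmul_mul_tmul])

/-- The antipode is the pushforward along the reversal of loops. -/
instance : HopfAlgebraStruct ℂ (Pontrjagin x) where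
  antipode := H0.map (rev x)

theorem antipode_loop (γ : Path x x) :
    HopfAlgebraStruct.antipode ℂ (loop γ) = loop γ.symm :=
  H0.map_pt (rev x) γ

instance : HopfAlgebra ℂ (Pontrjagin x) where
  mul_antipode_rTensor_comul := hom_ext fun γ => by
    simp only [LinearMap.comp_apply, comul_loop, LinearMap.rTensor_tmul, antipode_loop,
      LinearMap.mul'_apply, loop_mul, counit_loop, Algebra.linearMap_apply, map_one]
    exact loop_eq ⟨(Path.Homotopy.reflSymmTrans γ).symm⟩
  mul_antipode_lTensor_comul := hom_ext fun γ => by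
    simp only [LinearMap.comp_apply, comul_loop, LinearMap.lTensor_tmul, antipode_loop,
      LinearMap.mul'_apply, loop_mul, counit_loop, Algebra.linearMap_apply, map_one]
    exact loop_eq ⟨(Path.Homotopy.reflTransSymm γ).symm⟩

/-- The star-involution: reversal of loops followed by complex conjugation. -/
def dagger (x : X) : Pontrjagin x →ₛₗ[starRingEnd ℂ] Pontrjagin x :=
  (H0.conj (Path x x)).comp (H0.map (rev x))

end Pontrjagin

end Homology

section Topology
open scoped unitInterval


/-! ### Pointed spaces -/

/-- The space of pointed maps `(X, x₀) → (Y, y₀)`, with the compact-open topology. -/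
def PointedMap (X : Type u) (Y : Type v) [TopologicalSpace X] [TopologicalSpace Y] (x₀ : X)
    (y₀ : Y) : Type (max u v) := {f : C(X, Y) // f x₀ = y₀}

instance {X : Type u} {Y : Type v} [TopologicalSpace X] [TopologicalSpace Y] (x₀ : X) (y₀ : Y) :
    TopologicalSpace (PointedMap X Y x₀ y₀) :=
  inferInstanceAs (TopologicalSpace {f : C(X, Y) // f x₀ = y₀})

/-- The equivalence relation on `X × Y` which collapses `X × {y₀} ∪ {x₀} × Y` to a point. -/
def smashSetoid {X : Type u} {Y : Type v} (x₀ : X) (y₀ : Y) : Setoid (X × Y) where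
  r p q := p = q ∨ (p.1 = x₀ ∨ p.2 = y₀) ∧ (q.1 = x₀ ∨ q.2 = y₀)
  iseqv :=
    { refl := fun _ => Or.inl rfl
      symm := by rintro p q (rfl | ⟨h, h'⟩); exacts [Or.inl rfl, Or.inr ⟨h', h⟩]
      trans := by
        rintro p q r (rfl | ⟨h, h'⟩) (rfl | ⟨k, k'⟩)
        exacts [Or.inl rfl, Or.inr ⟨k, k'⟩, Or.inr ⟨h, h'⟩, Or.inr ⟨h, k'⟩] }

/-- The smash product of the pointed spaces `(X, x₀)` and `(Y, y₀)`. -/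
def Smash {X : Type u} {Y : Type v} (x₀ : X) (y₀ : Y) : Type (max u v) :=
  Quotient (smashSetoid x₀ y₀)

namespace Smash
variable {X : Type u} {Y : Type v} [TopologicalSpace X] [TopologicalSpace Y] (x₀ : X) (y₀ : Y)

instance : TopologicalSpace (Smash x₀ y₀) :=
  inferInstanceAs (TopologicalSpace (Quotient (smashSetoid x₀ y₀)))

/-- The quotient map `X × Y → X ∧ Y`. -/
def mk : C(X × Y, Smash x₀ y₀) := ⟨Quotient.mk (smashSetoid x₀ y₀), continuous_quotient_mk'⟩

/-- The point at infinity of `X ∧ Y`. -/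
def base : Smash x₀ y₀ := mk x₀ y₀ (x₀, y₀)

theorem mk_right (x : X) : mk x₀ y₀ (x, y₀) = base x₀ y₀ :=
  Quotient.sound (s := smashSetoid x₀ y₀) (Or.inr ⟨Or.inr rfl, Or.inl rfl⟩)

end Smash

/-! ### The moduli space of topological fields -/

/-- `ℝ^{0,1}_{⊔∞} ∧ (ℝ¹ × S)_{∪∞}`: the smash product of the time axis with a disjoint base point
adjoined and the one-point compactification of `ℝ × S`. -/
abbrev Spacetime (S : Type u) [TopologicalSpace S] : Type u :=
  Smash (X := ℝ ⊕ Unit) (Y := OnePoint (ℝ × S)) (Sum.inr ()) OnePoint.infty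

/-- The moduli space of topological fields with classifying space `(B, b)` on `ℝ^{1,1} × S`
which vanish at spatial infinity. -/
abbrev TopFields (S : Type u) [TopologicalSpace S] {B : Type v} [TopologicalSpace B] (b : B) :
    Type (max u v) :=
  PointedMap (Spacetime S) B (Smash.base _ _) b

open Classical in
/-- The map `[0,1] × S → (ℝ × S)_{∪∞}` which identifies the open interval with `ℝ` by
the increasing homeomorphism `u ↦ (1 - u)⁻¹ - u⁻¹` and sends both ends to infinity. -/
def cylinderFun (S : Type u) (p : I × S) : OnePoint (ℝ × S) :=
  if p.1 = 0 ∨ p.1 = 1 then OnePoint.infty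
  else (((1 - (p.1 : ℝ))⁻¹ - (p.1 : ℝ)⁻¹, p.2) : ℝ × S)

theorem continuous_cylinderFun (S : Type u) [TopologicalSpace S] : Continuous (cylinderFun S) := by
  rw [continuous_iff_continuousAt]
  rintro ⟨u, s⟩
  have huc : Continuous fun p : I × S => ((p.1 : I) : ℝ) := by fun_prop
  by_cases hu : u = 0 ∨ u = 1
  · have h0 : cylinderFun S (u, s) = OnePoint.infty := by simp [cylinderFun, hu]
    rw [ContinuousAt, h0, OnePoint.hasBasis_nhds_infty.tendsto_right_iff]
    rintro C ⟨-, hC⟩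
    obtain ⟨M, hM⟩ := (hC.image continuous_fst).isBounded.exists_norm_le
    have key : ∀ᶠ p : I × S in nhds (u, s), ¬ (p.1 = 0 ∨ p.1 = 1) →
        |M| < |(1 - (p.1 : ℝ))⁻¹ - (p.1 : ℝ)⁻¹| := by
      have hpos : (0 : ℝ) < 1 / (|M| + 3) := by positivity
      rcases hu with rfl | rfl
      · filter_upwards [huc.continuousAt.eventually_lt continuousAt_const
          (show (((0, s) : I × S).1 : ℝ) < 1 / (|M| + 3) by simpa using hpos)] with p hp hne
        have hp0 : 0 < (p.1 : ℝ) := lt_of_le_of_ne p.1.2.1 fun h => hne (Or.inl (Subtype.ext h.symm))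
        have h1 : |M| + 3 < (p.1 : ℝ)⁻¹ := by
          rw [lt_inv_comm₀ (by positivity) hp0]; simpa using hp
        have h3 : 1 / (|M| + 3) ≤ 1 / 2 :=
          one_div_le_one_div_of_le (by norm_num) (by linarith [abs_nonneg M])
        have h2 : (1 - (p.1 : ℝ))⁻¹ ≤ 2 := by
          rw [inv_le_comm₀ (by linarith) (by norm_num)]; linarith
        rw [lt_abs]; right; linarith
      · filter_upwards [(continuous_const.sub huc).continuousAt.eventually_lt continuousAt_const
          (show (1 : ℝ) - (((1, s) : I × S).1 : ℝ) < 1 / (|M| + 3) by simpa using hpos)] with p hp hne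
        replace hp : 1 - (p.1 : ℝ) < 1 / (|M| + 3) := hp
        have hp0 : 0 < 1 - (p.1 : ℝ) :=
          sub_pos.2 (lt_of_le_of_ne p.1.2.2 fun h => hne (Or.inr (Subtype.ext h)))
        have h1 : |M| + 3 < (1 - (p.1 : ℝ))⁻¹ := by
          rw [lt_inv_comm₀ (by positivity) hp0]; simpa using hp
        have h3 : 1 / (|M| + 3) ≤ 1 / 2 :=
          one_div_le_one_div_of_le (by norm_num) (by linarith [abs_nonneg M])
        have h2 : (p.1 : ℝ)⁻¹ ≤ 2 := by
          rw [inv_le_comm₀ (by linarith) (by norm_num)]; linarith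
        rw [lt_abs]; left; linarith
    filter_upwards [key] with p hp
    by_cases hpe : p.1 = 0 ∨ p.1 = 1
    · right; simp [cylinderFun, hpe]
    · left
      refine ⟨((1 - (p.1 : ℝ))⁻¹ - (p.1 : ℝ)⁻¹, p.2), fun hmem => ?_, by simp [cylinderFun, hpe]⟩
      have h1 := hM _ ⟨_, hmem, rfl⟩
      have h2 := hp hpe
      rw [Real.norm_eq_abs] at h1
      linarith [le_abs_self M]
  · have hne : ∀ᶠ p : I × S in nhds (u, s), ¬ (p.1 = 0 ∨ p.1 = 1) := by
      have : IsOpen {p : I × S | ¬ (p.1 = 0 ∨ p.1 = 1)} := by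
        simp only [not_or]
        exact (isOpen_ne_fun continuous_fst continuous_const).inter
          (isOpen_ne_fun continuous_fst continuous_const)
      exact this.mem_nhds hu
    have heq : (fun p : I × S =>
        ((((1 - (p.1 : ℝ))⁻¹ - (p.1 : ℝ)⁻¹, p.2) : ℝ × S) : OnePoint (ℝ × S))) =ᶠ[nhds (u, s)]
          cylinderFun S := by
      filter_upwards [hne] with p hp
      simp [cylinderFun, hp]
    refine ContinuousAt.congr ?_ heq
    refine OnePoint.continuous_coe.continuousAt.comp ?_
    have hu0 : (u : ℝ) ≠ 0 := fun h => hu (Or.inl (Subtype.ext h))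
    have hu1 : 1 - (u : ℝ) ≠ 0 := fun h => hu (Or.inr (Subtype.ext (sub_eq_zero.1 h).symm))
    exact (((continuous_const.sub huc).continuousAt.inv₀ hu1).sub
      (huc.continuousAt.inv₀ hu0)).prodMk continuousAt_snd

/-- The collapse map `[0,1] × S → ℝ^{0,1}_{⊔∞} ∧ (ℝ¹ × S)_{∪∞}` at time `0`. -/
def cylinder (S : Type u) [TopologicalSpace S] : C(I × S, Spacetime S) :=
  (Smash.mk _ _).comp ⟨fun p => (Sum.inl 0, cylinderFun S p),
    continuous_const.prodMk (continuous_cylinderFun S)⟩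

theorem cylinder_zero {S : Type u} [TopologicalSpace S] (s : S) :
    cylinder S (0, s) = Smash.base _ _ := by
  have : cylinder S (0, s) = Smash.mk _ _ (Sum.inl 0, OnePoint.infty) := by
    simp [cylinder, cylinderFun]
  rw [this, Smash.mk_right]

theorem cylinder_one {S : Type u} [TopologicalSpace S] (s : S) :
    cylinder S (1, s) = Smash.base _ _ := by
  have : cylinder S (1, s) = Smash.mk _ _ (Sum.inl 0, OnePoint.infty) := by
    simp [cylinder, cylinderFun]
  rw [this, Smash.mk_right]

/-- The comparison map from the moduli space of topological fields to the loop space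
`Ω Map(S, B)`: restriction to time `0`, regarded as a loop along the `ℝ¹`-direction. -/
def toLoops (S : Type u) [TopologicalSpace S] [CompactSpace S] [T2Space S] {B : Type v} [TopologicalSpace B] (b : B) :
    C(TopFields S b, Path (ContinuousMap.const S b) (ContinuousMap.const S b)) where
  toFun f :=
    { toContinuousMap := (f.1.comp (cylinder S)).curry
      source' := by ext s; simp [cylinder_zero, f.2]
      target' := by ext s; simp [cylinder_one, f.2] }
  continuous_toFun := by
    refine continuous_induced_rng.2 ?_
    exact ContinuousMap.continuous_curry.comp
      ((ContinuousMap.continuous_precomp (cylinder S)).comp continuous_subtype_val)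

/-! ### Classifying spaces -/

/-- The infinite join `E G = G * G * ⋯`: formal convex combinations `∑ tᵢ gᵢ` with finitely many
non-zero coefficients, where `gᵢ` is irrelevant (and normalized to `1`) when `tᵢ = 0`. -/
@[ext]
structure InfiniteJoin (G : Type v) [Group G] where
  /-- the barycentric coordinates -/
  t : ℕ →₀ ℝ
  /-- the entries -/
  g : ℕ → G
  nonneg : ∀ i, 0 ≤ t i
  sum_eq_one : (t.sum fun _ r => r) = 1
  normalized : ∀ i, t i = 0 → g i = 1

namespace InfiniteJoin
variable {G : Type v} [Group G]

/-- Milnor's topology on `E G`: the coarsest topology such that all coordinates `tᵢ` and all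
entries `gᵢ : tᵢ⁻¹(0,1] → G` are continuous. -/
instance [TopologicalSpace G] : TopologicalSpace (InfiniteJoin G) :=
  TopologicalSpace.generateFrom
    ({W | ∃ (i : ℕ) (U : Set ℝ), IsOpen U ∧ W = {e | e.t i ∈ U}} ∪
      {W | ∃ (i : ℕ) (V : Set G), IsOpen V ∧ W = {e | 0 < e.t i ∧ e.g i ∈ V}})

/-- Two points of `E G` are in the same orbit of the free right action of `G`. -/
def orbitSetoid (G : Type v) [Group G] : Setoid (InfiniteJoin G) where
  r e e' := e.t = e'.t ∧ ∃ h : G, ∀ i, e.t i ≠ 0 → e'.g i = e.g i * h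
  iseqv :=
    { refl := fun e => ⟨rfl, 1, fun i _ => by simp⟩
      symm := by
        rintro e e' ⟨ht, h, H⟩
        exact ⟨ht.symm, h⁻¹, fun i hi => by rw [H i (ht ▸ hi)]; simp⟩
      trans := by
        rintro e e' e'' ⟨ht, h, H⟩ ⟨ht', h', H'⟩
        exact ⟨ht.trans ht', h * h', fun i hi => by rw [H' i (ht ▸ hi), H i hi, mul_assoc]⟩ }

/-- The point `1 · 1_G` in the zeroth summand of the join. -/
def base (G : Type v) [Group G] : InfiniteJoin G where
  t := Finsupp.single 0 1
  g _ := 1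
  nonneg i := by
    rw [Finsupp.single_apply]; split_ifs <;> norm_num
  sum_eq_one := by simp
  normalized _ _ := rfl

end InfiniteJoin

/-- The classifying space `B G = E G / G` of a topological group (Milnor's construction). -/
def ClassifyingSpace (G : Type v) [Group G] : Type v := Quotient (InfiniteJoin.orbitSetoid G)

namespace ClassifyingSpace
variable (G : Type v) [Group G]

instance [TopologicalSpace G] : TopologicalSpace (ClassifyingSpace G) :=
  inferInstanceAs (TopologicalSpace (Quotient (InfiniteJoin.orbitSetoid G)))

/-- The point at infinity of `B G`. -/
def base : ClassifyingSpace G := Quotient.mk _ (InfiniteJoin.base G)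

end ClassifyingSpace

/-! ### The flux-quantization law -/

/-- The action of the group of signs on a commutative group by inversion. -/
def signAut (A : Type*) [CommGroup A] : ℤˣ →* MulAut A where
  toFun e :=
    { toFun := fun a => a ^ (e : ℤ)
      invFun := fun a => a ^ (e : ℤ)
      left_inv := fun a => by simp [← zpow_mul]
      right_inv := fun a => by simp [← zpow_mul]
      map_mul' := fun a b => mul_zpow a b _ }
  map_one' := by ext a; simp
  map_mul' e e' := by ext a; simp [← zpow_mul, mul_comm]

variable {K : Type v} [Group K]

/-- The action of `K` on `U(1)²` through a pair of homomorphisms `K → {±1} = Aut(U(1))`. -/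
def circleAction (ε₁ ε₂ : K →* ℤˣ) : K →* MulAut (Circle × Circle) where
  toFun k := MulEquiv.prodCongr (signAut Circle (ε₁ k)) (signAut Circle (ε₂ k))
  map_one' := by
    rw [map_one, map_one, map_one, map_one]; rfl
  map_mul' k k' := by
    rw [map_mul, map_mul, map_mul, map_mul]; rfl

/-- The group `U(1)² ⋊ K`. -/
abbrev FluxGroup (ε₁ ε₂ : K →* ℤˣ) : Type v := (Circle × Circle) ⋊[circleAction ε₁ ε₂] K

/-- The product topology on `U(1)² ⋊ K`. -/
instance (ε₁ ε₂ : K →* ℤˣ) [TopologicalSpace K] : TopologicalSpace (FluxGroup ε₁ ε₂) :=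
  TopologicalSpace.induced (fun x => (x.left, x.right)) inferInstance

theorem continuous_circleAction (ε₁ ε₂ : K →* ℤˣ) [TopologicalSpace K] [DiscreteTopology K] :
    Continuous fun p : K × (Circle × Circle) => circleAction ε₁ ε₂ p.1 p.2 := by
  rw [continuous_prod_of_discrete_left]
  intro k
  have h1 : Continuous fun a : Circle × Circle => a.1 ^ (ε₁ k : ℤ) := continuous_fst.zpow _
  have h2 : Continuous fun a : Circle × Circle => a.2 ^ (ε₂ k : ℤ) := continuous_snd.zpow _
  exact h1.prodMk h2

instance (ε₁ ε₂ : K →* ℤˣ) [TopologicalSpace K] [DiscreteTopology K] :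
    IsTopologicalGroup (FluxGroup ε₁ ε₂) := by
  have hd : Continuous fun x : FluxGroup ε₁ ε₂ => (x.left, x.right) := continuous_induced_dom
  have hl : Continuous fun x : FluxGroup ε₁ ε₂ => x.left := continuous_fst.comp hd
  have hr : Continuous fun x : FluxGroup ε₁ ε₂ => x.right := continuous_snd.comp hd
  have hφ := continuous_circleAction ε₁ ε₂
  have hfst : Continuous (Prod.fst : FluxGroup ε₁ ε₂ × FluxGroup ε₁ ε₂ → FluxGroup ε₁ ε₂) :=
    continuous_fst
  have hsnd : Continuous (Prod.snd : FluxGroup ε₁ ε₂ × FluxGroup ε₁ ε₂ → FluxGroup ε₁ ε₂) :=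
    continuous_snd
  have hmul : Continuous fun p : FluxGroup ε₁ ε₂ × FluxGroup ε₁ ε₂ =>
      (p.1.left * circleAction ε₁ ε₂ p.1.right p.2.left, p.1.right * p.2.right) :=
    ((hl.comp hfst).mul (hφ.comp ((hr.comp hfst).prodMk (hl.comp hsnd)))).prodMk
      ((hr.comp hfst).mul (hr.comp hsnd))
  have hinv : Continuous fun p : FluxGroup ε₁ ε₂ =>
      (circleAction ε₁ ε₂ p.right⁻¹ p.left⁻¹, p.right⁻¹) :=
    (hφ.comp (hr.inv.prodMk hl.inv)).prodMk hr.inv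
  exact { continuous_mul := continuous_induced_rng.2 hmul
          continuous_inv := continuous_induced_rng.2 hinv }

/-! ### Singular cohomology -/

/-- Singular `n`-simplices. -/
abbrev Simplex (n : ℕ) (S : Type u) [TopologicalSpace S] := C(stdSimplex ℝ (Fin (n + 1)), S)

/-- Singular `n`-cochains with integer coefficients. -/
abbrev Cochain (n : ℕ) (S : Type u) [TopologicalSpace S] := Simplex n S → ℤ

section Cohomology
variable {S : Type u} [TopologicalSpace S]

/-- The `i`-th face of a singular simplex. -/
def face {n : ℕ} (i : Fin (n + 2)) (s : Simplex (n + 1) S) : Simplex n S :=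
  s.comp ⟨stdSimplex.map i.succAbove, stdSimplex.continuous_map _⟩

/-- The coboundary operator. -/
def coboundary (n : ℕ) (S : Type u) [TopologicalSpace S] : Cochain n S →+ Cochain (n + 1) S where
  toFun c s := ∑ i : Fin (n + 2), (-1) ^ (i : ℕ) * c (face i s)
  map_zero' := by ext; simp
  map_add' c c' := by ext; simp [mul_add, Finset.sum_add_distrib]

/-- Cocycles. -/
def cocycles (n : ℕ) (S : Type u) [TopologicalSpace S] : AddSubgroup (Cochain n S) :=
  (coboundary n S).ker

/-- Coboundaries. -/
def coboundaries : (n : ℕ) → (S : Type u) → [TopologicalSpace S] → AddSubgroup (Cochain n S)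
  | 0, _, _ => ⊥
  | n + 1, S, _ => (coboundary n S).range

/-- Singular cohomology `Hⁿ(S; ℤ)`. -/
def Cohomology (n : ℕ) (S : Type u) [TopologicalSpace S] : Type u :=
  cocycles n S ⧸ (coboundaries n S).addSubgroupOf (cocycles n S)

instance (n : ℕ) : AddCommGroup (Cohomology n S) :=
  inferInstanceAs (AddCommGroup (cocycles n S ⧸ (coboundaries n S).addSubgroupOf (cocycles n S)))

/-- Multiplication of cochains by a locally constant sign
(the cup product with the corresponding `0`-cocycle). -/
def twist (n : ℕ) (e : LocallyConstant S ℤˣ) : Cochain n S →+ Cochain n S where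
  toFun c s := (e (s (stdSimplex.vertex 0)) : ℤ) * c s
  map_zero' := by ext; simp
  map_add' c c' := by ext; simp [mul_add]

theorem apply_simplex {n : ℕ} (e : LocallyConstant S ℤˣ) (s : Simplex n S)
    (p q : stdSimplex ℝ (Fin (n + 1))) : e (s p) = e (s q) :=
  (e.isLocallyConstant.comp_continuous s.continuous).apply_eq_of_preconnectedSpace p q

theorem coboundary_twist (n : ℕ) (e : LocallyConstant S ℤˣ) (c : Cochain n S) :
    coboundary n S (twist n e c) = twist (n + 1) e (coboundary n S c) := by
  ext s
  simp only [coboundary, twist, AddMonoidHom.coe_mk, ZeroHom.coe_mk, Finset.mul_sum, face,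
    ContinuousMap.comp_apply]
  refine Finset.sum_congr rfl fun i _ => ?_
  rw [apply_simplex e s _ (stdSimplex.vertex 0)]
  ring

theorem twist_twist (n : ℕ) (e e' : LocallyConstant S ℤˣ) (c : Cochain n S) :
    twist n e (twist n e' c) = twist n (e * e') c := by
  ext s
  simp [twist, mul_assoc]

theorem twist_one (n : ℕ) (c : Cochain n S) : twist n 1 c = c := by
  ext s
  simp [twist]

theorem twist_mem_cocycles {n : ℕ} (e : LocallyConstant S ℤˣ) {c : Cochain n S}
    (hc : c ∈ cocycles n S) : twist n e c ∈ cocycles n S := by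
  rw [cocycles, AddMonoidHom.mem_ker] at *
  rw [coboundary_twist, hc, map_zero]

theorem twist_mem_coboundaries {n : ℕ} (e : LocallyConstant S ℤˣ) {c : Cochain n S}
    (hc : c ∈ coboundaries n S) : twist n e c ∈ coboundaries n S := by
  cases n with
  | zero =>
    have : c = 0 := hc
    rw [this, map_zero]
    exact zero_mem _
  | succ n =>
    obtain ⟨b, rfl⟩ := hc
    exact ⟨twist n e b, coboundary_twist n e b⟩

/-- The action of a locally constant sign on cocycles. -/
def twistCocycle (n : ℕ) (e : LocallyConstant S ℤˣ) : cocycles n S →+ cocycles n S :=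
  ((twist n e).comp (cocycles n S).subtype).codRestrict _ fun c => twist_mem_cocycles e c.2

/-- The action of a locally constant sign on cohomology. -/
def twistCohomology (n : ℕ) (e : LocallyConstant S ℤˣ) : Cohomology n S →+ Cohomology n S :=
  QuotientAddGroup.map _ _ (twistCocycle n e) fun _ hc => twist_mem_coboundaries e hc

theorem twistCohomology_mul (n : ℕ) (e e' : LocallyConstant S ℤˣ) (a : Cohomology n S) :
    twistCohomology n (e * e') a = twistCohomology n e (twistCohomology n e' a) := by
  induction a using QuotientAddGroup.induction_on with
  | H c => exact congrArg _ (Subtype.ext (twist_twist n e e' c.1).symm)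

theorem twistCohomology_one (n : ℕ) (a : Cohomology n S) : twistCohomology n 1 a = a := by
  induction a using QuotientAddGroup.induction_on with
  | H c => exact congrArg _ (Subtype.ext (twist_one n c.1))

/-- The action of a locally constant sign on cohomology, as an automorphism. -/
def twistEquiv (n : ℕ) (e : LocallyConstant S ℤˣ) : Cohomology n S ≃+ Cohomology n S :=
  { twistCohomology n e with
    invFun := twistCohomology n e⁻¹
    left_inv := fun a => by
      change twistCohomology n e⁻¹ (twistCohomology n e a) = a
      rw [← twistCohomology_mul, inv_mul_cancel, twistCohomology_one]
    right_inv := fun a => by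
      change twistCohomology n e (twistCohomology n e⁻¹ a) = a
      rw [← twistCohomology_mul, mul_inv_cancel, twistCohomology_one] }

end Cohomology

/-! ### Degree-zero cohomology with coefficients in a topological group -/

/-- `H⁰(S; G) = π₀ Map(S, G)`. -/
def CohomologyZero (S : Type u) (G : Type v) [TopologicalSpace S] [TopologicalSpace G] :
    Type (max u v) := ZerothHomotopy C(S, G)

section CohomologyZero
variable {S : Type u} [TopologicalSpace S] {G : Type v} [TopologicalSpace G]

theorem eq_of_path [DiscreteTopology G] {f g : C(S, G)} (γ : Path f g) : f = g := by
  ext s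
  have hc : Continuous fun t : I => γ t s := by fun_prop
  have := ((IsLocallyConstant.iff_continuous _).2 hc).apply_eq_of_preconnectedSpace 0 1
  simpa using this

variable [LocallyCompactSpace S] [Group G] [IsTopologicalGroup G]

/-- The group structure induced by pointwise multiplication. -/
instance : Group (CohomologyZero S G) where
  mul := Quotient.map₂ (sa := pathSetoid C(S, G)) (sb := pathSetoid C(S, G))
    (sc := pathSetoid C(S, G)) (· * ·) fun _ _ h _ _ h' => Joined.mul h h'
  one := ZerothHomotopy.mk 1
  inv := Quotient.map (sa := pathSetoid C(S, G)) (sb := pathSetoid C(S, G))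
    (·⁻¹) fun _ _ h =>
      ⟨h.somePath.map (ContinuousMap.continuous_postcomp ⟨fun g : G => g⁻¹, continuous_inv⟩)⟩
  mul_assoc := by rintro ⟨a⟩ ⟨b⟩ ⟨c⟩; exact congrArg ZerothHomotopy.mk (mul_assoc a b c)
  one_mul := by rintro ⟨a⟩; exact congrArg ZerothHomotopy.mk (one_mul a)
  mul_one := by rintro ⟨a⟩; exact congrArg ZerothHomotopy.mk (mul_one a)
  inv_mul_cancel := by rintro ⟨a⟩; exact congrArg ZerothHomotopy.mk (inv_mul_cancel a)

variable [DiscreteTopology G]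

/-- The locally constant sign function associated with a class in `H⁰(S; G)` by a
homomorphism `G → {±1}`, for discrete `G`. -/
def signOf (ε : G →* ℤˣ) : CohomologyZero S G →* LocallyConstant S ℤˣ where
  toFun := ZerothHomotopy.lift
    (fun f => ⟨ε ∘ f, ((IsLocallyConstant.iff_continuous _).2 f.continuous).comp ε⟩)
    fun _ _ γ => by rw [eq_of_path γ]
  map_one' := by
    ext s
    exact congrArg Units.val (map_one ε)
  map_mul' := by
    rintro ⟨a⟩ ⟨b⟩
    ext s
    exact congrArg Units.val (map_mul ε (a s) (b s))

end CohomologyZero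

/-- The action of `H⁰(S; K)` on `H¹(S; ℤ)²` through a pair of homomorphisms `K → {±1} = Aut(ℤ)`. -/
def cohomologyAction (S : Type u) [TopologicalSpace S] [LocallyCompactSpace S]
    [TopologicalSpace K] [DiscreteTopology K] (ε₁ ε₂ : K →* ℤˣ) :
    CohomologyZero S K →* MulAut (Multiplicative (Cohomology 1 S × Cohomology 1 S)) where
  toFun k := AddEquiv.toMultiplicative
    (AddEquiv.prodCongr (twistEquiv 1 (signOf ε₁ k)) (twistEquiv 1 (signOf ε₂ k)))
  map_one' := by
    refine MulEquiv.ext fun a => ?_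
    rw [map_one, map_one]
    exact congrArg Multiplicative.ofAdd
      (Prod.ext (twistCohomology_one 1 a.toAdd.1) (twistCohomology_one 1 a.toAdd.2))
  map_mul' k k' := by
    refine MulEquiv.ext fun a => ?_
    rw [map_mul, map_mul]
    exact congrArg Multiplicative.ofAdd
      (Prod.ext (twistCohomology_mul 1 _ _ a.toAdd.1) (twistCohomology_mul 1 _ _ a.toAdd.2))

/-- The group `H¹(S; ℤ)² ⋊ H⁰(S; K)`. -/
abbrev FluxSectors (S : Type u) [TopologicalSpace S] [LocallyCompactSpace S]
    [TopologicalSpace K] [DiscreteTopology K] (ε₁ ε₂ : K →* ℤˣ) : Type (max u v) :=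
  Multiplicative (Cohomology 1 S × Cohomology 1 S) ⋊[cohomologyAction S ε₁ ε₂] CohomologyZero S K

/-- The star-involution of the complex group algebra, `∑ z_g g ↦ ∑ conj(z_g) g⁻¹`. -/
def groupAlgebraDagger {Γ : Type w} [Group Γ] (a : MonoidAlgebra ℂ Γ) : MonoidAlgebra ℂ Γ :=
  a.coeff.sum fun g z => MonoidAlgebra.single g⁻¹ (starRingEnd ℂ z)

end Topology

end FluxModuli

end

noncomputable section

namespace FluxModuli
open scoped unitInterval

/-! Degree-zero homology is free on path components, so the theorem reduces to three computations of
`π₀`, after which every algebraic identity is checked on classes of loops, which span.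

Fields versus loops. Rescaling the time axis by `r ∈ [0,1]` deforms any field to the stationary
field given by its time-zero slice. Since `S` is compact Hausdorff, `[0,1] × S` with its ends
collapsed is the one-point compactification of `ℝ × S`, so such slices are loops in `Map(S, BG)`.
Hence `toLoops` is bijective on `π₀` (`toLoops_surjective`, `joined_of_joined_toLoops`).

Loops versus maps to `G`. A loop in `Map(S, BG)` is a homotopy `[0,1] × S → BG`. It lifts to
Milnor's `EG` from the constant base point (`LocalTransport.exists_lift`) and ends in the fibre over
the base point, at `base · g` for some `g : S → G`. Up to homotopy this holonomy `g` depends only on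
the class of the loop. It determines that class because `EG`, hence `Map(S, EG)`, is contractible,
and every `g` occurs. Concatenation reverses the order of holonomies, so taking inverses yields a
group isomorphism `π₀ Ω Map(S, BG) ≅ π₀ Map(S, G)` (`exists_loop_equiv`).

Maps to `U(1)² ⋊ K`. The discrete component does not change along a homotopy, and each circle
component is classified by its winding class in `H¹(S; ℤ)`. The class vanishes exactly when the
function has a continuous logarithm, that is, when it is null-homotopic (`windingClass_eq_iff`).
Every class occurs: on a manifold a cocycle has local integral primitives `βₐ`, and for a partition
of unity `ρ` the function `exp(-2πi ∑ ρₐ βₐ)` is continuous with the given winding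
(`exists_isWinding_of_locallyExact`). Multiplication in the semidirect product twists winding
classes by the locally constant signs (`sector_mul`).

Loop classes are group-like, multiply by concatenation, and have reversal as antipode. The
Pontrjagin algebra is therefore the group algebra of `π₀` of the loop space (`exists_bialgEquiv`).
-/

/-! ### Homotopy lifting -/

/-- Local parallel transport for a map `p : E → B`: over each chart, a point of `E` can be
moved continuously to the fibre over any other point of the chart. -/
structure LocalTransport {E B : Type*} [TopologicalSpace E] [TopologicalSpace B] (p : E → B)
    (ι : Type*) where
  /-- the charts -/
  chart : ι → Set B
  isOpen_chart : ∀ i, IsOpen (chart i)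
  exists_mem_chart : ∀ b, ∃ i, b ∈ chart i
  /-- the transport inside a chart -/
  transport : ι → E → B → E
  continuousOn_transport : ∀ i, ContinuousOn (fun q : E × B => transport i q.1 q.2)
    {q | p q.1 ∈ chart i ∧ q.2 ∈ chart i}
  proj_transport : ∀ i e b, p e ∈ chart i → b ∈ chart i → p (transport i e b) = b
  transport_self : ∀ i e, p e ∈ chart i → transport i e (p e) = e

/-- There is a lift of the homotopy `F`, stopped at time `τ`, with prescribed start. -/
def LiftsUpTo {X E B : Type*} [TopologicalSpace X] [TopologicalSpace E] (p : E → B)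
    (F : ℝ × X → B) (f₀ : X → E) (τ : X → ℝ) : Prop :=
  ∃ G : ℝ × X → E, Continuous G ∧ (∀ t x, p (G (t, x)) = F (min t (τ x), x)) ∧
    ∀ x, G (0, x) = f₀ x

namespace LocalTransport
variable {X E B ι : Type*} [TopologicalSpace X] [TopologicalSpace E] [TopologicalSpace B]
  {p : E → B} {F : ℝ × X → B} {f₀ : X → E}

open Classical in
-- Over `U` the new stretch of the homotopy stays in a single chart, so the lift continues by
-- transporting its value at time `τ`. Outside `A` there is no new stretch. The two prescriptions
-- agree on `U \ A` because transport to the same fibre is the identity.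
theorem liftsUpTo_step (L : LocalTransport p ι) (hF : Continuous F) {τ τ' : X → ℝ}
    (hτ : Continuous τ) (hτ' : Continuous τ') (h0 : ∀ x, 0 ≤ τ x) (hle : ∀ x, τ x ≤ τ' x)
    {U A : Set X} (hU : IsOpen U) (hA : IsClosed A) (hAU : A ⊆ U) (heq : ∀ x ∉ A, τ' x = τ x)
    (i : ι) (hi : ∀ x ∈ U, ∀ t, τ x ≤ t → t ≤ τ' x → F (t, x) ∈ L.chart i)
    (h : LiftsUpTo p F f₀ τ) : LiftsUpTo p F f₀ τ' := by
  obtain ⟨G, hG, hpG, hG0⟩ := h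
  -- Time clamped to `[τ, τ']`, so that the target of the transport lies in the chart for every real
  -- `t`.
  let c : ℝ × X → ℝ := fun q => max (τ q.2) (min q.1 (τ' q.2))
  have hc : Continuous c := by fun_prop
  have hpG' : ∀ x, p (G (τ x, x)) = F (τ x, x) := fun x => by rw [hpG, min_self]
  have hi1 : ∀ x ∈ U, p (G (τ x, x)) ∈ L.chart i := fun x hx => by
    rw [hpG']; exact hi x hx _ le_rfl (hle x)
  have hi2 : ∀ t, ∀ x ∈ U, F (c (t, x), x) ∈ L.chart i := fun t x hx =>
    hi x hx _ (le_max_left _ _) (max_le (hle x) (min_le_right _ _))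
  let g : ℝ × X → E := fun q =>
    if q.2 ∈ U then L.transport i (G (τ q.2, q.2)) (F (c q, q.2)) else G (τ q.2, q.2)
  have hGτ : Continuous fun q : ℝ × X => G (τ q.2, q.2) := by fun_prop
  have hg1 : ∀ t, ∀ x ∉ A, g (t, x) = G (τ x, x) := by
    intro t x hx
    have hcx : c (t, x) = τ x := by
      simp only [c, heq x hx]; exact max_eq_left (min_le_right _ _)
    simp only [g]
    split_ifs with hxU
    · rw [hcx, ← hpG', L.transport_self _ _ (hi1 x hxU)]
    · rfl
  have hg : Continuous g := by
    rw [continuous_iff_continuousAt]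
    rintro ⟨t, x⟩
    by_cases hx : x ∈ A
    · have hopen : IsOpen {q : ℝ × X | q.2 ∈ U} := hU.preimage continuous_snd
      have hcont : ContinuousOn
          (fun q : ℝ × X => L.transport i (G (τ q.2, q.2)) (F (c q, q.2))) {q | q.2 ∈ U} :=
        (L.continuousOn_transport i).comp
          (hGτ.prodMk (hF.comp (hc.prodMk continuous_snd))).continuousOn
          fun q hq => ⟨hi1 _ hq, hi2 q.1 q.2 hq⟩
      refine (hcont.continuousAt (hopen.mem_nhds (hAU hx))).congr ?_
      filter_upwards [hopen.mem_nhds (show (t, x).2 ∈ U from hAU hx)] with q hq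
      simp only [g]
      rw [if_pos hq]
    · refine hGτ.continuousAt.congr ?_
      filter_upwards [(hA.isOpen_compl.preimage (continuous_snd (X := ℝ))).mem_nhds
        (show (t, x).2 ∈ Aᶜ from hx)] with q hq
      exact (hg1 q.1 q.2 hq).symm
  refine ⟨fun q => if q.1 ≤ τ q.2 then G q else g q, ?_, ?_, ?_⟩
  · refine Continuous.if_le hG hg (by fun_prop) (by fun_prop) ?_
    rintro ⟨t, x⟩ (rfl : t = τ x)
    have hcx : c (τ x, x) = τ x := by
      simp only [c]; rw [min_eq_left (hle x), max_self]
    simp only [g]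
    split_ifs with hxU
    · rw [hcx, ← hpG', L.transport_self _ _ (hi1 x hxU)]
    · rfl
  · intro t x
    dsimp only
    split_ifs with ht
    · rw [hpG, min_eq_left ht, min_eq_left (ht.trans (hle x))]
    · by_cases hxU : x ∈ U
      · simp only [g]
        rw [if_pos hxU, L.proj_transport _ _ _ (hi1 x hxU) (hi2 t x hxU)]
        simp only [c]
        rw [max_eq_right (le_min (le_of_not_ge ht) (hle x))]
      · have hxA : x ∉ A := fun h => hxU (hAU h)
        rw [hg1 t x hxA, hpG', heq x hxA, min_eq_right (le_of_not_ge ht)]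
  · intro x
    dsimp only
    rw [if_pos (h0 x), hG0]

/-- Lifts extend over short time intervals. -/
theorem exists_liftsUpTo_extend [CompactSpace X] [T2Space X] (L : LocalTransport p ι)
    (hF : Continuous F) (t₀ : ℝ) : ∃ ε > 0, ∀ s s' : ℝ, 0 ≤ s → t₀ - ε < s → s ≤ s' →
      s' < t₀ + ε → LiftsUpTo p F f₀ (fun _ => s) → LiftsUpTo p F f₀ (fun _ => s') := by
  classical
  have hloc : ∀ x : X, ∃ U : Set X, IsOpen U ∧ x ∈ U ∧ ∃ ε > 0, ∃ i, ∀ y ∈ U, ∀ t,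
      t₀ - ε < t → t < t₀ + ε → F (t, y) ∈ L.chart i := by
    intro x
    obtain ⟨i, hi⟩ := L.exists_mem_chart (F (t₀, x))
    have hn := ((L.isOpen_chart i).preimage hF).mem_nhds (show (t₀, x) ∈ _ from hi)
    rw [nhds_prod_eq, Filter.mem_prod_iff] at hn
    obtain ⟨W, hW, U, hU, hWU⟩ := hn
    obtain ⟨ε, hε, hεW⟩ := Metric.mem_nhds_iff.1 hW
    obtain ⟨U', hU'U, hU'o, hxU'⟩ := mem_nhds_iff.1 hU
    refine ⟨U', hU'o, hxU', ε, hε, i, fun y hy t h1 h2 => hWU ⟨hεW ?_, hU'U hy⟩⟩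
    rw [Metric.mem_ball, Real.dist_eq, abs_lt]
    constructor <;> linarith
  choose U hUo hxU ε hε i hi using hloc
  obtain ⟨s, hs⟩ := isCompact_univ.elim_finite_subcover U hUo
    fun x _ => Set.mem_iUnion.2 ⟨x, hxU x⟩
  obtain ⟨ρ, hρ⟩ := PartitionOfUnity.exists_isSubordinate_of_locallyFinite isClosed_univ
    (fun a : s => U a) (fun a => hUo a) (locallyFinite_of_finite _)
    (fun x hx => by simpa using hs hx)
  -- The least radius of the finite subcover. The subcover is empty only for empty `X`, and then any
  -- radius serves.
  obtain ⟨δ, hδ, hδε⟩ : ∃ δ > 0, ∀ a ∈ s, δ ≤ ε a := by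
    rcases s.eq_empty_or_nonempty with rfl | hne
    · exact ⟨1, one_pos, by simp⟩
    · obtain ⟨a, ha, hmin⟩ := s.exists_min_image ε hne
      exact ⟨ε a, hε a, hmin⟩
  refine ⟨δ, hδ, fun u u' h0 h1 h2 h3 hlift => ?_⟩
  have hsum : ∀ x, ∑ a, ρ a x = 1 := fun x => by
    rw [← finsum_eq_sum_of_fintype]; exact ρ.sum_eq_one (Set.mem_univ x)
  -- The stopping time is raised from `u` to `u'` by one partition function at a time. Each
  -- increment is supported in a single `U a`, where one chart suffices.
  have key : ∀ S : Finset s, LiftsUpTo p F f₀ fun x => u + (u' - u) * ∑ a ∈ S, ρ a x := by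
    intro S
    induction S using Finset.induction_on with
    | empty => simpa using hlift
    | insert a S ha ih =>
      have hnn : ∀ x, 0 ≤ ∑ b ∈ S, ρ b x := fun x => Finset.sum_nonneg fun b _ => ρ.nonneg b x
      have hle1 : ∀ x, ∑ b ∈ insert a S, ρ b x ≤ 1 := fun x => by
        rw [← hsum x]
        exact Finset.sum_le_sum_of_subset_of_nonneg (Finset.subset_univ _)
          fun b _ _ => ρ.nonneg b x
      refine L.liftsUpTo_step hF (by fun_prop) (by fun_prop) (fun x => ?_) (fun x => ?_)
        (hUo a) (isClosed_tsupport (ρ a)) (hρ a) (fun x hx => ?_) (i a)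
        (fun x hx t ht ht' => hi a x hx t ?_ ?_) ih
      · have := mul_nonneg (sub_nonneg.2 h2) (hnn x); linarith
      · rw [Finset.sum_insert ha, mul_add]
        have := mul_nonneg (sub_nonneg.2 h2) (ρ.nonneg a x); linarith
      · rw [Finset.sum_insert ha, image_eq_zero_of_notMem_tsupport hx, zero_add]
      · have := mul_nonneg (sub_nonneg.2 h2) (hnn x)
        have := hδε a a.2
        linarith
      · have := mul_le_mul_of_nonneg_left (hle1 x) (sub_nonneg.2 h2)
        have := hδε a a.2
        linarith
  have := key Finset.univ
  simp only [hsum, mul_one, add_sub_cancel] at this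
  exact this

/-- The homotopy lifting property with respect to compact Hausdorff spaces. -/
theorem exists_lift [CompactSpace X] [T2Space X] (L : LocalTransport p ι) (F : C(I × X, B))
    (f₀ : C(X, E)) (h0 : ∀ x, p (f₀ x) = F (0, x)) :
    ∃ G : C(I × X, E), (∀ q, p (G q) = F q) ∧ ∀ x, G (0, x) = f₀ x := by
  -- Extending the homotopy constantly in time allows arbitrary real stopping times.
  let F' : ℝ × X → B := fun q => F (Set.projIcc 0 1 zero_le_one q.1, q.2)
  have hF' : Continuous F' :=
    F.continuous.comp ((continuous_projIcc.comp continuous_fst).prodMk continuous_snd)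
  choose ε hε hext using fun t₀ => L.exists_liftsUpTo_extend (f₀ := f₀) hF' t₀
  obtain ⟨t, ht0, hmono, ⟨m, hm⟩, hsub⟩ :=
    exists_monotone_Icc_subset_open_cover_unitInterval
      (c := fun t₀ : I => Subtype.val ⁻¹' Metric.ball (t₀ : ℝ) (ε t₀))
      (fun t₀ => Metric.isOpen_ball.preimage continuous_subtype_val)
      (fun t₀ _ => Set.mem_iUnion.2 ⟨t₀, Metric.mem_ball_self (hε t₀)⟩)
  have key : ∀ n, LiftsUpTo p F' f₀ fun _ => (t n : ℝ) := by
    intro n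
    induction n with
    | zero =>
      refine ⟨fun q => f₀ q.2, by fun_prop, fun s x => ?_, fun x => rfl⟩
      have : Set.projIcc (0 : ℝ) 1 zero_le_one (min s ((t 0 : I) : ℝ)) = 0 := by
        rw [ht0]; exact Set.projIcc_of_le_left _ (min_le_right _ _)
      simp only [F', this, h0]
    | succ n ih =>
      obtain ⟨t₀, ht₀⟩ := hsub n
      have hle := hmono n.le_succ
      have h1 := ht₀ (Set.left_mem_Icc.2 hle)
      have h2 := ht₀ (Set.right_mem_Icc.2 hle)
      rw [Set.mem_preimage, Metric.mem_ball, Real.dist_eq, abs_lt] at h1 h2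
      exact hext t₀ _ _ (t n).2.1 (by linarith) hle (by linarith) ih
  obtain ⟨G, hG, hpG, hG0⟩ := key m
  refine ⟨⟨fun q => G (q.1, q.2), by fun_prop⟩, fun q => ?_, fun x => ?_⟩
  · simp only [ContinuousMap.coe_mk]
    rw [hpG]
    simp only [F', hm m le_rfl]
    rw [Set.Icc.coe_one, min_eq_left q.1.2.2, Set.projIcc_val]
  · exact hG0 x

end LocalTransport

/-! ### The universal bundle -/

namespace InfiniteJoin
variable {G : Type*} [Group G]

section Topology
variable [TopologicalSpace G] {X : Type*} [TopologicalSpace X]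

theorem continuous_t (i : ℕ) : Continuous fun e : InfiniteJoin G => e.t i :=
  ⟨fun U hU => TopologicalSpace.isOpen_generateFrom_of_mem (Or.inl ⟨i, U, hU, rfl⟩)⟩

theorem isOpen_pos (i : ℕ) : IsOpen {e : InfiniteJoin G | 0 < e.t i} :=
  isOpen_lt continuous_const (continuous_t i)

theorem continuousOn_g (i : ℕ) :
    ContinuousOn (fun e : InfiniteJoin G => e.g i) {e | 0 < e.t i} := by
  rw [continuousOn_open_iff (isOpen_pos i)]
  exact fun V hV => TopologicalSpace.isOpen_generateFrom_of_mem (Or.inr ⟨i, V, hV, rfl⟩)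

/-- The two families of conditions are exactly preimages of the generating open sets. Entries need
only be controlled where their coefficient is positive. -/
theorem continuous_of_coord {f : X → InfiniteJoin G} (ht : ∀ i, Continuous fun x => (f x).t i)
    (hg : ∀ i, ContinuousOn (fun x => (f x).g i) {x | 0 < (f x).t i}) : Continuous f := by
  refine continuous_generateFrom_iff.2 ?_
  rintro W (⟨i, U, hU, rfl⟩ | ⟨i, V, hV, rfl⟩)
  · exact hU.preimage (ht i)
  · exact (hg i).isOpen_inter_preimage (isOpen_lt continuous_const (ht i)) hV

end Topology

theorem t_pos {e : InfiniteJoin G} {i : ℕ} : 0 < e.t i ↔ e.t i ≠ 0 :=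
  (e.nonneg i).lt_iff_ne'

theorem exists_pos (e : InfiniteJoin G) : ∃ i, 0 < e.t i := by
  by_contra! h
  have h0 : e.t = 0 := Finsupp.ext fun i => le_antisymm (h i) (e.nonneg i)
  have := e.sum_eq_one
  rw [h0] at this
  simp at this

open Classical in
/-- The point of the join with given coordinates, normalized. -/
def ofCoord (t : ℕ →₀ ℝ) (g : ℕ → G) (h : ∀ i, 0 ≤ t i) (h1 : (t.sum fun _ r => r) = 1) :
    InfiniteJoin G where
  t := t
  g i := if t i = 0 then 1 else g i
  nonneg := h
  sum_eq_one := h1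
  normalized _ hi := if_pos hi

theorem ofCoord_g {t : ℕ →₀ ℝ} {g : ℕ → G} {h : ∀ i, 0 ≤ t i} {h1 : (t.sum fun _ r => r) = 1}
    {i : ℕ} (hi : t i ≠ 0) : (ofCoord t g h h1).g i = g i := if_neg hi

theorem ext_of_ne_zero {e e' : InfiniteJoin G} (ht : e.t = e'.t)
    (hg : ∀ i, e.t i ≠ 0 → e.g i = e'.g i) : e = e' := by
  refine InfiniteJoin.ext ht (funext fun i => ?_)
  by_cases hi : e.t i = 0
  · rw [e.normalized i hi, e'.normalized i (ht ▸ hi)]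
  · exact hg i hi

/-- The right action. -/
def act (e : InfiniteJoin G) (h : G) : InfiniteJoin G :=
  ofCoord e.t (fun i => e.g i * h) e.nonneg e.sum_eq_one

@[simp] theorem act_t (e : InfiniteJoin G) (h : G) : (e.act h).t = e.t := rfl

theorem act_g (e : InfiniteJoin G) (h : G) {i : ℕ} (hi : e.t i ≠ 0) :
    (e.act h).g i = e.g i * h := ofCoord_g hi

theorem act_one (e : InfiniteJoin G) : e.act 1 = e :=
  ext_of_ne_zero rfl fun i hi => by rw [act_g e 1 hi, mul_one]

theorem act_act (e : InfiniteJoin G) (h h' : G) : (e.act h).act h' = e.act (h * h') :=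
  ext_of_ne_zero rfl fun i hi => by
    have hi' : e.t i ≠ 0 := hi
    rw [act_g (e.act h) h' hi, act_g e h hi', act_g e (h * h') hi', mul_assoc]

theorem act_injective (e : InfiniteJoin G) {h h' : G} (H : e.act h = e.act h') : h = h' := by
  obtain ⟨i, hi⟩ := e.exists_pos
  have := congrArg (fun e : InfiniteJoin G => e.g i) H
  simpa [act_g e _ hi.ne'] using this

theorem rel_iff {e e' : InfiniteJoin G} : orbitSetoid G e e' ↔ ∃ h, e' = e.act h := by
  constructor
  · rintro ⟨ht, h, H⟩
    exact ⟨h, ext_of_ne_zero ht.symm fun i hi => by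
      rw [← ht] at hi
      rw [H i hi, act_g e h hi]⟩
  · rintro ⟨h, rfl⟩
    exact ⟨rfl, h, fun i hi => act_g e h hi⟩

theorem continuous_act [TopologicalSpace G] [IsTopologicalGroup G] :
    Continuous fun q : InfiniteJoin G × G => q.1.act q.2 := by
  refine continuous_of_coord (fun i => ?_) fun i => ?_
  · have h := (continuous_t (G := G) i).comp (continuous_fst (Y := G))
    exact h
  · have h1 : ContinuousOn (fun q : InfiniteJoin G × G => q.1.g i * q.2)
        {q | 0 < (q.1.act q.2).t i} :=
      ((continuousOn_g i).comp continuousOn_fst fun q hq => hq).mul continuousOn_snd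
    exact h1.congr fun q hq => act_g _ _ (ne_of_gt hq)

end InfiniteJoin

namespace ClassifyingSpace
variable {G : Type*} [Group G]

/-- The projection of the universal bundle. -/
def proj (e : InfiniteJoin G) : ClassifyingSpace G := Quotient.mk (InfiniteJoin.orbitSetoid G) e

theorem proj_act (e : InfiniteJoin G) (h : G) : proj (e.act h) = proj e :=
  (Quotient.sound (s := InfiniteJoin.orbitSetoid G) (InfiniteJoin.rel_iff.2 ⟨h, rfl⟩)).symm

theorem proj_eq_iff {e e' : InfiniteJoin G} : proj e = proj e' ↔ ∃ h, e' = e.act h :=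
  (Quotient.eq (r := InfiniteJoin.orbitSetoid G)).trans InfiniteJoin.rel_iff

theorem proj_surjective : Function.Surjective (proj (G := G)) := Quotient.mk_surjective

/-- The barycentric coordinates. -/
def coord (i : ℕ) : ClassifyingSpace G → ℝ :=
  Quotient.lift (fun e : InfiniteJoin G => e.t i) fun _ _ h => congrArg (fun t : ℕ →₀ ℝ => t i) h.1

/-- The local section with `i`-th entry `1`. -/
def sec (i : ℕ) (b : ClassifyingSpace G) : InfiniteJoin G :=
  (Quotient.out b).act ((Quotient.out b).g i)⁻¹

theorem proj_sec (i : ℕ) (b : ClassifyingSpace G) : proj (sec i b) = b := by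
  rw [sec, proj_act]; exact Quotient.out_eq b

/-- Right translation of the representative by `h` is undone by the inverse of its `i`-th entry, so
the chosen representative does not matter. -/
theorem sec_proj {i : ℕ} {e : InfiniteJoin G} (he : e.t i ≠ 0) :
    sec i (proj e) = e.act (e.g i)⁻¹ := by
  obtain ⟨h, hh⟩ := proj_eq_iff.1 (show proj (Quotient.out (proj e)) = proj e from
    Quotient.out_eq (proj e))
  have key : ∀ e' : InfiniteJoin G, e = e'.act h → e'.act (e'.g i)⁻¹ = e.act (e.g i)⁻¹ := by
    rintro e' rfl
    rw [InfiniteJoin.act_g e' h he, InfiniteJoin.act_act, mul_inv_rev, mul_inv_cancel_left]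
  exact key _ hh

section Topology
variable [TopologicalSpace G]

theorem isQuotientMap_proj : Topology.IsQuotientMap (proj (G := G)) := isQuotientMap_quot_mk

theorem continuous_proj : Continuous (proj (G := G)) := isQuotientMap_proj.continuous

theorem continuous_coord (i : ℕ) : Continuous (coord (G := G) i) :=
  (InfiniteJoin.continuous_t i).quotient_lift _

variable [IsTopologicalGroup G]

/-- Continuity is tested after pulling back along the quotient map, where the section becomes `e ↦ e
· (e.g i)⁻¹`. -/
theorem continuousOn_sec (i : ℕ) :
    ContinuousOn (sec (G := G) i) {b | 0 < coord i b} := by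
  rw [isQuotientMap_proj.continuousOn_isOpen_iff (isOpen_lt continuous_const (continuous_coord i))]
  have : ContinuousOn (fun e : InfiniteJoin G => e.act (e.g i)⁻¹) {e | 0 < e.t i} :=
    InfiniteJoin.continuous_act.comp_continuousOn
      (continuousOn_id.prodMk (InfiniteJoin.continuousOn_g i).inv)
  exact this.congr fun e he => sec_proj (ne_of_gt he)

/-- Parallel transport in the universal bundle, which keeps the `i`-th entry constant. -/
def localTransport (G : Type*) [Group G] [TopologicalSpace G] [IsTopologicalGroup G] :
    LocalTransport (proj (G := G)) ℕ where
  chart i := {b | 0 < coord i b}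
  isOpen_chart i := isOpen_lt continuous_const (continuous_coord i)
  exists_mem_chart b := by
    obtain ⟨e, rfl⟩ := proj_surjective b
    exact e.exists_pos
  transport i e b := (sec i b).act (e.g i)
  continuousOn_transport i :=
    InfiniteJoin.continuous_act.comp_continuousOn
      (((continuousOn_sec i).comp continuousOn_snd fun q hq => hq.2).prodMk
        ((InfiniteJoin.continuousOn_g i).comp continuousOn_fst fun q hq => hq.1))
  proj_transport i e b _ _ := by rw [proj_act, proj_sec]
  transport_self i e he := by
    rw [sec_proj (ne_of_gt he), InfiniteJoin.act_act, inv_mul_cancel, InfiniteJoin.act_one]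

/-- Two lifts of the same map differ by a continuous function to the structure group. -/
theorem exists_eq_act {X : Type*} [TopologicalSpace X] (a b : C(X, InfiniteJoin G))
    (h : ∀ x, proj (a x) = proj (b x)) : ∃ d : C(X, G), ∀ x, b x = (a x).act (d x) := by
  choose d hd using fun x => proj_eq_iff.1 (h x)
  refine ⟨⟨d, continuous_iff_continuousAt.2 fun x => ?_⟩, hd⟩
  obtain ⟨i, hi⟩ := (a x).exists_pos
  have ht : ∀ y, (b y).t = (a y).t := fun y => by rw [hd y]; rfl
  have ha : ∀ᶠ y in nhds x, 0 < (a y).t i :=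
    ((InfiniteJoin.isOpen_pos i).preimage a.continuous).mem_nhds hi
  -- An entry that is present at `x` is present nearby, and there it computes the difference of the
  -- lifts explicitly.
  have h1 : ContinuousAt (fun y => ((a y).g i)⁻¹ * (b y).g i) x := by
    refine ContinuousAt.mul (ContinuousAt.inv ?_) ?_
    · exact ContinuousAt.comp (f := a)
        ((InfiniteJoin.continuousOn_g i).continuousAt ((InfiniteJoin.isOpen_pos i).mem_nhds hi))
        a.continuous.continuousAt
    · exact ContinuousAt.comp (f := b)
        ((InfiniteJoin.continuousOn_g i).continuousAt ((InfiniteJoin.isOpen_pos i).mem_nhds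
          (show 0 < (b x).t i by rw [ht]; exact hi))) b.continuous.continuousAt
  refine h1.congr ?_
  filter_upwards [ha] with y hy
  rw [hd y, InfiniteJoin.act_g _ _ hy.ne', inv_mul_cancel_left]

end Topology
end ClassifyingSpace

/-! ### Contractibility of the universal bundle -/

/-- The sum of the coefficients. -/
def totalMass : (ℕ →₀ ℝ) →ₗ[ℝ] ℝ := Finsupp.lsum ℝ fun _ => LinearMap.id

theorem totalMass_apply (t : ℕ →₀ ℝ) : totalMass t = t.sum fun _ r => r := rfl

theorem totalMass_single (i : ℕ) (r : ℝ) : totalMass (Finsupp.single i r) = r := by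
  simp [totalMass]

/-- The unit mass at a nonnegative real number, shared linearly by the two neighbouring natural
numbers. -/
def tent (x : ℝ) : ℕ →₀ ℝ :=
  Finsupp.single ⌊x⌋₊ (1 - (x - ⌊x⌋₊)) + Finsupp.single (⌊x⌋₊ + 1) (x - ⌊x⌋₊)

theorem totalMass_tent (x : ℝ) : totalMass (tent x) = 1 := by
  rw [tent, map_add, totalMass_single, totalMass_single]; ring

/-- The closed form makes continuity in `x` and positivity evident, which the definition through the
floor hides. -/
theorem tent_apply {x : ℝ} (hx : 0 ≤ x) (i : ℕ) : tent x i = max 0 (1 - |i - x|) := by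
  have h1 := Nat.floor_le hx
  have h2 := Nat.lt_floor_add_one x
  generalize hm : ⌊x⌋₊ = m at h1 h2
  simp only [tent, hm, Finsupp.add_apply, Finsupp.single_apply]
  rcases lt_trichotomy i m with h | rfl | h
  · have h3 : (i : ℝ) + 1 ≤ m := by exact_mod_cast h
    rw [if_neg (by omega), if_neg (by omega), abs_of_nonpos (by linarith),
      max_eq_left (by linarith)]
    ring
  · rw [if_pos rfl, if_neg (by omega), abs_of_nonpos (by linarith), max_eq_right (by linarith)]
    ring
  · rw [if_neg (by omega)]
    rcases (show i = m + 1 ∨ m + 2 ≤ i by omega) with rfl | h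
    · push_cast
      rw [if_pos rfl, abs_of_nonneg (by linarith), max_eq_right (by linarith)]
      ring
    · have h3 : (m : ℝ) + 2 ≤ i := by exact_mod_cast h
      rw [if_neg (by omega), abs_of_nonneg (by linarith), max_eq_left (by linarith)]
      ring

/-- The position at time `v` of the `j`-th mass in a family of masses which starts at the natural
numbers. For `v > 0` all but finitely many masses have started to move. -/
def position (j : ℕ) (v : ℝ) : ℝ := j + max 0 ((j + 1) * (2 * (j + 1) * v - 1))

theorem le_position (j : ℕ) (v : ℝ) : (j : ℝ) ≤ position j v :=
  le_add_of_nonneg_right (le_max_left _ _)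

theorem position_nonneg (j : ℕ) (v : ℝ) : 0 ≤ position j v := j.cast_nonneg.trans (le_position j v)

theorem position_zero (j : ℕ) : position j 0 = j := by
  rw [position, max_eq_left]
  · simp
  · have : (0 : ℝ) ≤ j := j.cast_nonneg
    linarith

theorem one_le_position_one (j : ℕ) : 1 ≤ position j 1 := by
  have h : (0 : ℝ) ≤ j := j.cast_nonneg
  have := le_max_right 0 (((j : ℝ) + 1) * (2 * (j + 1) * 1 - 1))
  rw [position]
  nlinarith

theorem continuous_position (j : ℕ) : Continuous (position j) := by
  unfold position; fun_prop

/-- Mass `j` rests until `v = 1 / (2 * (j + 1))`. Later masses start earlier and move faster, and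
once `2 * (j + 1) * v > 1` the gap is at least `(k - j) * (2 * v * (j + 1 + (k + 1)))`, where the
second factor exceeds `2`. -/
theorem position_separated {j k : ℕ} (h : j < k) (v : ℝ) :
    position j v = j ∨ position j v + 2 ≤ position k v := by
  have hjk : (j : ℝ) + 1 ≤ k := by exact_mod_cast h
  have hj : (0 : ℝ) ≤ j := j.cast_nonneg
  by_cases hv : ((j : ℝ) + 1) * (2 * (j + 1) * v - 1) ≤ 0
  · left; rw [position, max_eq_left hv, add_zero]
  · right
    push Not at hv
    have hv1 : 0 < 2 * ((j : ℝ) + 1) * v - 1 := pos_of_mul_pos_right hv (by positivity)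
    have hv0 : 0 < v := by
      by_contra hc
      push Not at hc
      nlinarith
    have hk := le_max_right 0 (((k : ℝ) + 1) * (2 * (k + 1) * v - 1))
    rw [position, position, max_eq_right hv.le]
    have h2 : 1 ≤ 2 * v * (j + 1 + (k + 1)) - 1 := by nlinarith
    have h3 : ((k : ℝ) + 1) * (2 * (k + 1) * v - 1) - (j + 1) * (2 * (j + 1) * v - 1) =
      (k - j) * (2 * v * (j + 1 + (k + 1)) - 1) := by ring
    nlinarith

/-- Masses never collide: a tent reaches only naturals at distance less than `1`, a resting mass
occupies only its own place, and a moving one is at least `2` behind every later mass. So each place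
receives mass from one source and can inherit its group element; no interpolation in `G` is
required. -/
theorem eq_of_tent_ne_zero {i j k : ℕ} {v : ℝ} (hj : tent (position j v) i ≠ 0)
    (hk : tent (position k v) i ≠ 0) : j = k := by
  have aux : ∀ {j : ℕ}, tent (position j v) i ≠ 0 → |(i : ℝ) - position j v| < 1 := by
    intro j hj
    rw [tent_apply (position_nonneg j v)] at hj
    by_contra hc
    exact hj (max_eq_left (by linarith))
  have main : ∀ {j k : ℕ}, j < k → tent (position j v) i ≠ 0 → tent (position k v) i ≠ 0 →
      False := by
    intro j k hlt hj hk
    have h1 := abs_lt.1 (aux hj)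
    have h2 := abs_lt.1 (aux hk)
    rcases position_separated hlt v with h | h
    · rw [h] at h1
      have h3 : i < j + 1 := by
        have : (i : ℝ) < j + 1 := by linarith
        exact_mod_cast this
      have h4 : (i : ℝ) + 1 ≤ k := by exact_mod_cast (by omega : i + 1 ≤ k)
      have := le_position k v
      linarith
    · linarith
  rcases lt_trichotomy j k with h | h | h
  · exact (main h hj hk).elim
  · exact h
  · exact (main h hk hj).elim

/-- The barycentric coordinates after all masses have moved. -/
def spreadCoord (v : ℝ) (t : ℕ →₀ ℝ) : ℕ →₀ ℝ := t.sum fun j r => r • tent (position j v)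

/-- Masses never move below their starting place, so place `i` is fed only by `j ≤ i`. Summing over
this fixed finite range instead of the varying support of `t` makes continuity visible. -/
theorem spreadCoord_apply (v : ℝ) (t : ℕ →₀ ℝ) (i : ℕ) :
    spreadCoord v t i = ∑ j ∈ Finset.range (i + 1), t j * tent (position j v) i := by
  have h0 : ∀ j, j ∉ Finset.range (i + 1) → tent (position j v) i = 0 := by
    intro j hj
    rw [Finset.mem_range, not_lt] at hj
    have h1 : (i : ℝ) + 1 ≤ j := by exact_mod_cast hj
    have h2 := le_position j v
    rw [tent_apply (position_nonneg j v), abs_of_nonpos (by linarith), max_eq_left (by linarith)]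
  rw [spreadCoord, Finsupp.sum_of_support_subset t
    (Finset.subset_union_left (s₂ := Finset.range (i + 1))) _ (by simp), Finsupp.finsetSum_apply]
  refine (Finset.sum_subset Finset.subset_union_right fun j _ hj => ?_).symm.trans ?_
  · simp [h0 j hj]
  · simp

theorem totalMass_spreadCoord (v : ℝ) (t : ℕ →₀ ℝ) :
    totalMass (spreadCoord v t) = totalMass t := by
  rw [spreadCoord, map_finsuppSum, totalMass_apply]
  simp [totalMass_tent]

theorem tent_nonneg (j : ℕ) (v : ℝ) (i : ℕ) : 0 ≤ tent (position j v) i := by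
  rw [tent_apply (position_nonneg j v)]; exact le_max_left _ _

theorem continuous_tent (j i : ℕ) : Continuous fun v => tent (position j v) i := by
  have := continuous_position j
  simp only [tent_apply (position_nonneg j _)]
  fun_prop

theorem spreadCoord_zero (t : ℕ →₀ ℝ) : spreadCoord 0 t = t := by
  have h : ∀ j : ℕ, tent (position j 0) = Finsupp.single j 1 := fun j => by
    simp [position_zero, tent]
  simp [spreadCoord, h]

theorem spreadCoord_one (t : ℕ →₀ ℝ) : spreadCoord 1 t 0 = 0 := by
  rw [spreadCoord_apply]
  refine Finset.sum_eq_zero fun j _ => ?_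
  have := one_le_position_one j
  rw [tent_apply (position_nonneg j 1), Nat.cast_zero, zero_sub, abs_neg,
    abs_of_nonneg (by linarith), max_eq_left (by linarith), mul_zero]

theorem spreadCoord_nonneg (v : ℝ) {t : ℕ →₀ ℝ} (h : ∀ i, 0 ≤ t i) (i : ℕ) :
    0 ≤ spreadCoord v t i := by
  rw [spreadCoord_apply]
  exact Finset.sum_nonneg fun j _ => mul_nonneg (h j) (tent_nonneg j v i)

attribute [irreducible] spreadCoord

namespace InfiniteJoin
variable {G : Type*} [Group G]

open Classical in
/-- The entries after all masses have moved. -/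
def spreadEntry (v : ℝ) (e : InfiniteJoin G) (i : ℕ) : G :=
  if h : ∃ j, tent (position j v) i ≠ 0 then e.g h.choose else 1

theorem spreadEntry_eq {v : ℝ} {e : InfiniteJoin G} {i j : ℕ} (h : tent (position j v) i ≠ 0) :
    spreadEntry v e i = e.g j := by
  have hex : ∃ j, tent (position j v) i ≠ 0 := ⟨j, h⟩
  rw [spreadEntry, dif_pos hex, eq_of_tent_ne_zero hex.choose_spec h]

attribute [irreducible] spreadEntry

/-- The homotopy of the infinite join which spreads the masses. -/
def spread (v : ℝ) (e : InfiniteJoin G) : InfiniteJoin G :=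
  ofCoord (spreadCoord v e.t) (spreadEntry v e) (spreadCoord_nonneg v e.nonneg)
    (by rw [← totalMass_apply, totalMass_spreadCoord, totalMass_apply, e.sum_eq_one])

theorem spread_t (v : ℝ) (e : InfiniteJoin G) : (spread v e).t = spreadCoord v e.t := rfl

theorem spread_g {v : ℝ} {e : InfiniteJoin G} {i : ℕ} (hi : (spread v e).t i ≠ 0) :
    (spread v e).g i = spreadEntry v e i := ofCoord_g hi

theorem spread_zero (e : InfiniteJoin G) : spread 0 e = e := by
  refine ext_of_ne_zero (spreadCoord_zero e.t) fun i hi => ?_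
  have h : tent (position i 0) i ≠ 0 := by simp [position_zero, tent]
  rw [spread_g hi, spreadEntry_eq h]

section Topology
variable [TopologicalSpace G]

theorem continuous_spreadCoord (i : ℕ) :
    Continuous fun q : ℝ × InfiniteJoin G => spreadCoord q.1 q.2.t i := by
  simp only [spreadCoord_apply]
  refine continuous_finsetSum _ fun j _ => Continuous.mul ?_ ?_
  · exact (continuous_t j).comp continuous_snd
  · exact (continuous_tent j i).comp continuous_fst

/-- Where place `i` carries mass, some source `j` feeds it. The same source feeds it at nearby
points, and it is the only one, so the entry is locally `e.g j`. -/
theorem continuousOn_spreadEntry (i : ℕ) :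
    ContinuousOn (fun q : ℝ × InfiniteJoin G => spreadEntry q.1 q.2 i)
      {q | 0 < spreadCoord q.1 q.2.t i} := by
  rintro ⟨v, e⟩ hq
  obtain ⟨j, -, hj⟩ : ∃ j ∈ Finset.range (i + 1), e.t j * tent (position j v) i ≠ 0 := by
    refine Finset.exists_ne_zero_of_sum_ne_zero ?_
    rw [← spreadCoord_apply]
    exact ne_of_gt hq
  have hjt : 0 < e.t j := t_pos.2 (left_ne_zero_of_mul hj)
  have hjw : 0 < tent (position j v) i :=
    (tent_nonneg j v i).lt_of_ne' (right_ne_zero_of_mul hj)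
  refine ContinuousAt.continuousWithinAt ?_
  have h0 : ContinuousAt (fun e : InfiniteJoin G => e.g j) e :=
    (continuousOn_g j).continuousAt ((isOpen_pos j).mem_nhds hjt)
  have h1 : ContinuousAt (fun q : ℝ × InfiniteJoin G => q.2.g j) (v, e) :=
    ContinuousAt.comp (g := fun e : InfiniteJoin G => e.g j) (f := Prod.snd) (x := (v, e)) h0
      continuousAt_snd
  refine h1.congr ?_
  have hopen : IsOpen {q : ℝ × InfiniteJoin G | 0 < tent (position j q.1) i} :=
    isOpen_lt continuous_const ((continuous_tent j i).comp continuous_fst)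
  filter_upwards [hopen.mem_nhds hjw] with q hq
  exact (spreadEntry_eq (ne_of_gt hq)).symm

theorem continuous_spread : Continuous fun q : ℝ × InfiniteJoin G => spread q.1 q.2 :=
  continuous_of_coord continuous_spreadCoord fun i =>
    (continuousOn_spreadEntry i).congr fun _ hq => ofCoord_g (ne_of_gt hq)

theorem continuous_spreadCoord_right (v : ℝ) (i : ℕ) :
    Continuous fun e : InfiniteJoin G => spreadCoord v e.t i :=
  (continuous_spreadCoord i).comp (continuous_const.prodMk continuous_id)

theorem continuousOn_spreadEntry_right (v : ℝ) (i : ℕ) :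
    ContinuousOn (fun e : InfiniteJoin G => spreadEntry v e i) {e | 0 < spreadCoord v e.t i} :=
  (continuousOn_spreadEntry i).comp (continuous_const.prodMk continuous_id).continuousOn
    fun _ h => h

theorem continuous_spread_right (v : ℝ) : Continuous (spread (G := G) v) :=
  continuous_spread.comp (continuous_const.prodMk continuous_id)

end Topology

/-- The linear homotopy which moves all mass to the zeroth entry, after this has been emptied. -/
def cone (a : I) (e : InfiniteJoin G) : InfiniteJoin G :=
  ofCoord (Finsupp.single 0 (a : ℝ) + (1 - (a : ℝ)) • spreadCoord 1 e.t)
    (fun i => if i = 0 then 1 else spreadEntry 1 e i)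
    (fun i => add_nonneg (by rw [Finsupp.single_apply]; split_ifs; exacts [a.2.1, le_rfl])
      (mul_nonneg (sub_nonneg.2 a.2.2) (spreadCoord_nonneg 1 e.nonneg i)))
    (by rw [← totalMass_apply, map_add, map_smul, totalMass_spreadCoord, totalMass_single,
          totalMass_apply, e.sum_eq_one]; simp)

theorem cone_t (a : I) (e : InfiniteJoin G) (i : ℕ) :
    (cone a e).t i = Finsupp.single 0 (a : ℝ) i + (1 - (a : ℝ)) * spreadCoord 1 e.t i := rfl

theorem cone_g {a : I} {e : InfiniteJoin G} {i : ℕ} (hi : (cone a e).t i ≠ 0) :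
    (cone a e).g i = if i = 0 then 1 else spreadEntry 1 e i := ofCoord_g hi

theorem cone_zero (e : InfiniteJoin G) : cone 0 e = spread 1 e := by
  have ht : (cone 0 e).t = (spread 1 e).t := by
    ext i; simp [cone_t, spread_t]
  refine ext_of_ne_zero ht fun i hi => ?_
  have hi' : (spread 1 e).t i ≠ 0 := ht ▸ hi
  rw [cone_g hi, spread_g hi', if_neg]
  rintro rfl
  -- The entry `1` which `cone` puts in place zero does no harm at the start, since spreading has
  -- emptied that place.
  exact hi' (spreadCoord_one e.t)

theorem cone_one (e : InfiniteJoin G) : cone 1 e = base G := by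
  have ht : (cone 1 e).t = (base G).t := by
    ext i; simp [cone_t, base]
  refine ext_of_ne_zero ht fun i hi => ?_
  have hi' : (base G).t i ≠ 0 := ht ▸ hi
  have hi0 : i = 0 := by
    by_contra h
    exact hi' (Finsupp.single_eq_of_ne h)
  rw [cone_g hi, if_pos hi0]
  rfl

variable [TopologicalSpace G]

theorem continuous_cone : Continuous fun q : I × InfiniteJoin G => cone q.1 q.2 := by
  have ht : ∀ i, Continuous fun q : I × InfiniteJoin G => spreadCoord 1 q.2.t i :=
    fun i => (continuous_spreadCoord_right 1 i).comp continuous_snd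
  refine continuous_of_coord (fun i => ?_) fun i => ?_
  · simp only [cone_t]
    refine Continuous.add ?_ (Continuous.mul (by fun_prop) (ht i))
    simp only [Finsupp.single_apply]
    split_ifs <;> fun_prop
  · by_cases hi : i = 0
    · refine (continuousOn_const (c := (1 : G))).congr fun q hq => ?_
      exact (cone_g (ne_of_gt hq)).trans (if_pos hi)
    · have : ContinuousOn (fun q : I × InfiniteJoin G => spreadEntry 1 q.2 i)
          {q | 0 < (cone q.1 q.2).t i} := by
        refine (continuousOn_spreadEntry_right 1 i).comp continuous_snd.continuousOn fun q hq => ?_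
        have h0 : (cone q.1 q.2).t i = (1 - (q.1 : ℝ)) * spreadCoord 1 q.2.t i := by
          simp [cone_t, Ne.symm hi]
        rw [Set.mem_ofPred_eq, h0] at hq
        exact pos_of_mul_pos_right hq (sub_nonneg.2 q.1.2.2)
      exact this.congr fun q hq => (cone_g (ne_of_gt hq)).trans (if_neg hi)

/-- Spreading first empties place zero. The freed place, with entry `1`, then receives all the mass
linearly. -/
instance : ContractibleSpace (InfiniteJoin G) := by
  rw [contractible_iff_id_nullhomotopic]
  refine ⟨base G, ContinuousMap.Homotopic.trans
    (g := ⟨spread 1, continuous_spread_right 1⟩)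
    ⟨⟨⟨fun q => spread q.1 q.2, continuous_spread.comp
      ((continuous_subtype_val.comp continuous_fst).prodMk continuous_snd)⟩, fun e => ?_, fun e => ?_⟩⟩
    ⟨⟨⟨fun q => cone q.1 q.2, continuous_cone⟩, fun e => ?_, fun e => ?_⟩⟩⟩
  · simp [spread_zero]
  · simp
  · simp [cone_zero]
  · simp [cone_one]

end InfiniteJoin

instance {S E : Type*} [TopologicalSpace S] [LocallyCompactSpace S] [TopologicalSpace E]
    [ContractibleSpace E] : ContractibleSpace C(S, E) := by
  rw [contractible_iff_id_nullhomotopic]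
  obtain ⟨e, ⟨H⟩⟩ := id_nullhomotopic E
  refine ⟨ContinuousMap.const S e, ⟨⟨ContinuousMap.curry
    ⟨fun q : (I × C(S, E)) × S => H (q.1.1, q.1.2 q.2), by fun_prop⟩, fun f => ?_, fun f => ?_⟩⟩⟩
  · ext s; simp
  · ext s; simp

/-! ### Loops of maps to the classifying space -/

namespace ClassifyingSpace
variable {S G : Type*} [TopologicalSpace S]
  [Group G] [TopologicalSpace G] [IsTopologicalGroup G]

/-- Loops based at the constant map. -/
abbrev MapLoop (S G : Type*) [TopologicalSpace S] [Group G] [TopologicalSpace G] :=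
  Path (ContinuousMap.const S (base G)) (ContinuousMap.const S (base G))

/-- The map to the fibre over the base point given by a function to the structure group. -/
def orbitMap (g : C(S, G)) : C(S, InfiniteJoin G) :=
  ⟨fun s => (InfiniteJoin.base G).act (g s),
    InfiniteJoin.continuous_act.comp (continuous_const.prodMk g.continuous)⟩

/-- A loop of maps lifts to a path in the universal bundle with endpoint `g`. -/
def HasHolonomy (F : MapLoop S G) (g : C(S, G)) : Prop :=
  ∃ P : Path (ContinuousMap.const S (InfiniteJoin.base G)) (orbitMap g),
    ∀ t s, proj (P t s) = F t s

theorem HasHolonomy.of_lift {F : MapLoop S G} {g : C(S, G)} (P : C(I × S, InfiniteJoin G))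
    (hP : ∀ t s, proj (P (t, s)) = F t s) (h0 : ∀ s, P (0, s) = InfiniteJoin.base G)
    (h1 : ∀ s, P (1, s) = (InfiniteJoin.base G).act (g s)) : HasHolonomy F g :=
  ⟨{ toContinuousMap := P.curry
     source' := by ext1 s; exact h0 s
     target' := by ext1 s; exact h1 s }, hP⟩

variable [CompactSpace S] [T2Space S]

theorem continuous_uncurry_path {Y : Type*} [TopologicalSpace Y] {a b : C(S, Y)} (P : Path a b) :
    Continuous fun q : I × S => P q.1 q.2 := by fun_prop

/-- The lift starting at the constant base point ends over the base point because `F` is a loop, so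
its end is a translate of the base point by a continuous function. -/
theorem exists_hasHolonomy (F : MapLoop S G) : ∃ g, HasHolonomy F g := by
  obtain ⟨P, hP, hP0⟩ := (localTransport G).exists_lift
    ⟨fun q : I × S => F q.1 q.2, continuous_uncurry_path F⟩
    (ContinuousMap.const S (InfiniteJoin.base G)) (fun s => by simp; rfl)
  obtain ⟨g, hg⟩ := exists_eq_act (ContinuousMap.const S (InfiniteJoin.base G))
    (P.comp ⟨fun s => (1, s), by fun_prop⟩) (fun s => by
      refine Eq.trans ?_ (hP (1, s)).symm
      simp; rfl)
  exact ⟨g, .of_lift P (fun t s => hP (t, s)) hP0 hg⟩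

/-- `C(S, EG)` is contractible, so some path leads from the constant map to `orbitMap g`; its
projection closes up to a loop. -/
theorem exists_loop_hasHolonomy (g : C(S, G)) : ∃ F : MapLoop S G, HasHolonomy F g := by
  obtain ⟨P⟩ := PathConnectedSpace.joined (ContinuousMap.const S (InfiniteJoin.base G)) (orbitMap g)
  refine ⟨(P.map (ContinuousMap.continuous_postcomp ⟨proj, continuous_proj⟩)).cast
    (by ext1; rfl) (by ext1; exact (proj_act _ _).symm), P, fun t s => rfl⟩

/-- Two lifts of `F` differ by a function `d` on `[0,1] × S` with `d = 1` at time `0`, and `t ↦ g *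
d t` is the required path. -/
theorem HasHolonomy.joined_of_same {F : MapLoop S G} {g h : C(S, G)} (hg : HasHolonomy F g)
    (hh : HasHolonomy F h) : Joined g h := by
  obtain ⟨P, hP⟩ := hg
  obtain ⟨Q, hQ⟩ := hh
  obtain ⟨d, hd⟩ := exists_eq_act ⟨fun q : I × S => P q.1 q.2, continuous_uncurry_path P⟩
    ⟨fun q : I × S => Q q.1 q.2, continuous_uncurry_path Q⟩
    (fun q => (hP q.1 q.2).trans (hQ q.1 q.2).symm)
  have h0 : ∀ s, d (0, s) = 1 := fun s => by
    have := hd (0, s)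
    simp only [ContinuousMap.coe_mk, Path.source, ContinuousMap.const_apply] at this
    exact ((InfiniteJoin.base G).act_injective
      ((InfiniteJoin.act_one _).trans this)).symm
  have h1 : ∀ s, h s = g s * d (1, s) := fun s => by
    have := hd (1, s)
    simp only [ContinuousMap.coe_mk, Path.target] at this
    exact (InfiniteJoin.base G).act_injective (this.trans (InfiniteJoin.act_act _ _ _))
  exact ⟨{ toContinuousMap := ContinuousMap.curry ⟨fun q : I × S => g q.2 * d q, by fun_prop⟩
           source' := by ext1 s; simp [h0]
           target' := by ext1 s; simp [h1] }⟩

/-- The deformation parameter `r` is treated as a further coordinate of the parameter space `I × S`.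
Lifting in the loop direction then yields a continuous family of holonomies in `r`. -/
theorem HasHolonomy.joined {F F' : MapLoop S G} {g g' : C(S, G)} (h : HasHolonomy F g)
    (h' : HasHolonomy F' g') (hF : Joined F F') : Joined g g' := by
  obtain ⟨γ⟩ := hF
  have hγ : Continuous fun q : I × I => γ q.1 q.2 := Path.continuous_uncurry_iff.2 γ.continuous
  have hγ' : Continuous fun q : I × (I × S) => γ q.2.1 q.1 q.2.2 :=
    continuous_eval.comp ((hγ.comp (by fun_prop :
      Continuous fun q : I × (I × S) => (q.2.1, q.1))).prodMk (by fun_prop :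
      Continuous fun q : I × (I × S) => q.2.2))
  obtain ⟨P, hP, hP0⟩ := (localTransport G).exists_lift
    ⟨fun q : I × (I × S) => γ q.2.1 q.1 q.2.2, hγ'⟩
    (ContinuousMap.const _ (InfiniteJoin.base G)) (fun s => by simp; rfl)
  obtain ⟨k, hk⟩ := exists_eq_act (ContinuousMap.const (I × S) (InfiniteJoin.base G))
    (P.comp ⟨fun s => (1, s), by fun_prop⟩) (fun s => by
      refine Eq.trans ?_ (hP (1, s)).symm
      simp; rfl)
  have hr : ∀ r, HasHolonomy (γ r) (k.curry r) := fun r =>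
    .of_lift (P.comp ⟨fun q => (q.1, (r, q.2)), by fun_prop⟩) (fun t s => hP (t, (r, s)))
      (fun s => hP0 _) (fun s => hk (r, s))
  have h0 := hr 0
  have h1 := hr 1
  rw [γ.source] at h0
  rw [γ.target] at h1
  exact ((h.joined_of_same h0).trans
    ⟨{ toContinuousMap := k.curry, source' := rfl, target' := rfl }⟩).trans (h1.joined_of_same h')

/-- Translating a lift by the path `g⁻¹ * γ t`, which starts at `1`, leaves the projection unchanged
and moves the endpoint from `g` to `g'`. -/
theorem HasHolonomy.of_joined {F : MapLoop S G} {g g' : C(S, G)} (h : HasHolonomy F g)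
    (hg : Joined g g') : HasHolonomy F g' := by
  obtain ⟨P, hP⟩ := h
  obtain ⟨γ⟩ := hg
  refine .of_lift ⟨fun q => (P q.1 q.2).act ((g q.2)⁻¹ * γ q.1 q.2),
    InfiniteJoin.continuous_act.comp ((continuous_uncurry_path P).prodMk
      ((g.continuous.comp continuous_snd).inv.mul (continuous_uncurry_path γ)))⟩
    (fun t s => ?_) (fun s => ?_) (fun s => ?_)
  · exact (proj_act _ _).trans (hP t s)
  · simp [InfiniteJoin.act_one]
  · have h1 : P 1 s = (InfiniteJoin.base G).act (g s) := by rw [P.target]; rfl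
    simp only [ContinuousMap.coe_mk, h1, γ.target, InfiniteJoin.act_act, mul_inv_cancel_left]

/-- The lifts have common endpoints in the contractible space `C(S, EG)`. They are therefore
homotopic as paths, and so are their projections. -/
theorem HasHolonomy.homotopic {F F' : MapLoop S G} {g : C(S, G)} (h : HasHolonomy F g)
    (h' : HasHolonomy F' g) : F.Homotopic F' := by
  obtain ⟨P, hP⟩ := h
  obtain ⟨P', hP'⟩ := h'
  have := (SimplyConnectedSpace.paths_homotopic P P').map
    ⟨_, ContinuousMap.continuous_postcomp (X := S) ⟨proj (G := G), continuous_proj⟩⟩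
  obtain ⟨H⟩ := this
  have hF : F = (P.map (ContinuousMap.continuous_postcomp ⟨proj, continuous_proj⟩)).cast
      (by ext1; rfl) (by ext1; exact (proj_act _ _).symm) := by
    ext t s; exact (hP t s).symm
  have hF' : F' = (P'.map (ContinuousMap.continuous_postcomp ⟨proj, continuous_proj⟩)).cast
      (by ext1; rfl) (by ext1; exact (proj_act _ _).symm) := by
    ext t s; exact (hP' t s).symm
  rw [hF, hF']
  exact ⟨H.cast rfl rfl⟩

/-- The second lift must be translated by `g` on the right to start where the first one ends. It
then ends at `base · g' · g`, which explains the reversed order. -/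
theorem HasHolonomy.trans {F F' : MapLoop S G} {g g' : C(S, G)} (h : HasHolonomy F g)
    (h' : HasHolonomy F' g') : HasHolonomy (F.trans F') (g' * g) := by
  obtain ⟨P, hP⟩ := h
  obtain ⟨P', hP'⟩ := h'
  let Q : Path (orbitMap g) (orbitMap (g' * g)) :=
    { toContinuousMap := ContinuousMap.curry ⟨fun q : I × S => (P' q.1 q.2).act (g q.2),
        InfiniteJoin.continuous_act.comp ((continuous_uncurry_path P').prodMk
          (g.continuous.comp continuous_snd))⟩
      source' := by
        ext1 s
        have h0 : P' 0 s = InfiniteJoin.base G := by rw [P'.source]; rfl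
        exact congrArg (fun e => e.act (g s)) h0
      target' := by
        ext1 s
        have h1 : P' 1 s = (InfiniteJoin.base G).act (g' s) := by rw [P'.target]; rfl
        exact (congrArg (fun e => e.act (g s)) h1).trans (InfiniteJoin.act_act _ _ _) }
  refine ⟨P.trans Q, fun t s => ?_⟩
  rw [Path.trans_apply, Path.trans_apply]
  split_ifs
  · exact hP _ _
  · exact (proj_act _ _).trans (hP' _ _)

theorem joined_path_of_homotopic {X : Type*} [TopologicalSpace X] {x y : X} {γ δ : Path x y}
    (h : γ.Homotopic δ) : Joined γ δ :=
  ⟨{ toFun := h.some.eval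
     continuous_toFun := Path.continuous_uncurry_iff.1 h.some.continuous
     source' := h.some.eval_zero
     target' := h.some.eval_one }⟩

/-- The class of a function in degree-zero cohomology. -/
def _root_.FluxModuli.CohomologyZero.mk {S G : Type*} [TopologicalSpace S] [TopologicalSpace G]
    (f : C(S, G)) : CohomologyZero S G := ZerothHomotopy.mk f

/-- Path components of loops of maps to the classifying space are classes of maps to the group. -/
theorem exists_loop_equiv (S G : Type*) [TopologicalSpace S] [CompactSpace S] [T2Space S]
    [Group G] [TopologicalSpace G] [IsTopologicalGroup G] :
    ∃ e : ZerothHomotopy (MapLoop S G) ≃ CohomologyZero S G, ∀ F F' : MapLoop S G,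
      e (.mk (F.trans F')) = e (.mk F) * e (.mk F') := by
  choose hol hhol using exists_hasHolonomy (S := S) (G := G)
  -- The inverse turns the order-reversing holonomy into a homomorphism.
  let m : ZerothHomotopy (MapLoop S G) → CohomologyZero S G :=
    ZerothHomotopy.lift (fun F => (CohomologyZero.mk (hol F))⁻¹)
      fun F F' γ => congrArg (·⁻¹) (ZerothHomotopy.sound
        ((hhol F).joined (hhol F') ⟨γ⟩).somePath)
  have hm : ∀ F, m (.mk F) = (CohomologyZero.mk (hol F))⁻¹ := fun F => rfl
  have hmk : ∀ {F g}, HasHolonomy F g → m (.mk F) = (CohomologyZero.mk g)⁻¹ :=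
    fun {F g} h => congrArg (·⁻¹) (ZerothHomotopy.sound ((hhol F).joined_of_same h).somePath)
  refine ⟨Equiv.ofBijective m ⟨?_, ?_⟩, fun F F' => ?_⟩
  · intro a b hab
    obtain ⟨F, rfl⟩ := ZerothHomotopy.mk_surjective a
    obtain ⟨F', rfl⟩ := ZerothHomotopy.mk_surjective b
    rw [hm, hm, inv_inj] at hab
    have hj : Joined (hol F) (hol F') := Quotient.exact hab
    exact ZerothHomotopy.sound
      (joined_path_of_homotopic (((hhol F).of_joined hj).homotopic (hhol F'))).somePath
  · intro a
    have hsurj : ∀ b : CohomologyZero S G, ∃ g : C(S, G), CohomologyZero.mk g = b :=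
      ZerothHomotopy.mk_surjective
    obtain ⟨g, hg⟩ := hsurj a⁻¹
    obtain ⟨F, hF⟩ := exists_loop_hasHolonomy g
    refine ⟨.mk F, ?_⟩
    rw [hmk hF, hg]
    exact inv_inv (G := CohomologyZero S G) a
  · exact (hmk ((hhol F).trans (hhol F'))).trans (mul_inv_rev (G := CohomologyZero S G)
      (CohomologyZero.mk (hol F')) (CohomologyZero.mk (hol F)))

end ClassifyingSpace

/-! ### Topological fields and loops -/

theorem cylinderFun_of_end {S : Type*} {p : I × S} (h : p.1 = 0 ∨ p.1 = 1) :
    cylinderFun S p = OnePoint.infty := if_pos h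

theorem cylinderFun_of_not_end {S : Type*} {p : I × S} (h : ¬ (p.1 = 0 ∨ p.1 = 1)) :
    cylinderFun S p = (((1 - (p.1 : ℝ))⁻¹ - (p.1 : ℝ)⁻¹, p.2) : ℝ × S) := if_neg h

theorem cylinderFun_eq_infty {S : Type*} {p : I × S} :
    cylinderFun S p = OnePoint.infty ↔ p.1 = 0 ∨ p.1 = 1 := by
  refine ⟨fun h => ?_, cylinderFun_of_end⟩
  by_contra hp
  rw [cylinderFun_of_not_end hp] at h
  exact OnePoint.coe_ne_infty _ h

theorem pos_of_not_end {u : I} (h : ¬ (u = 0 ∨ u = 1)) : 0 < (u : ℝ) ∧ 0 < 1 - (u : ℝ) := by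
  rw [not_or] at h
  exact ⟨unitInterval.pos_iff_ne_zero.2 h.1, sub_pos.2 (unitInterval.lt_one_iff_ne_one.2 h.2)⟩

theorem eq_of_cylinderFun_eq {S : Type*} {p q : I × S} (hp : ¬ (p.1 = 0 ∨ p.1 = 1))
    (h : cylinderFun S p = cylinderFun S q) : p = q := by
  have hq : ¬ (q.1 = 0 ∨ q.1 = 1) := fun hq => hp (cylinderFun_eq_infty.1
    (h.trans (cylinderFun_of_end hq)))
  rw [cylinderFun_of_not_end hp, cylinderFun_of_not_end hq, OnePoint.coe_eq_coe] at h
  obtain ⟨h1, h2⟩ := Prod.mk.inj h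
  have hmono : ∀ {u v : I}, ¬ (u = 0 ∨ u = 1) → ¬ (v = 0 ∨ v = 1) → (u : ℝ) < v →
      (1 - (u : ℝ))⁻¹ - (u : ℝ)⁻¹ < (1 - (v : ℝ))⁻¹ - (v : ℝ)⁻¹ := by
    intro u v hu hv huv
    obtain ⟨hu0, hu1⟩ := pos_of_not_end hu
    obtain ⟨hv0, hv1⟩ := pos_of_not_end hv
    have := inv_strictAnti₀ hu0 huv
    have := inv_strictAnti₀ hv1 (sub_lt_sub_left huv 1)
    linarith
  refine Prod.ext (Subtype.ext ?_) h2
  rcases lt_trichotomy (p.1 : ℝ) q.1 with hlt | heq | hlt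
  · exact absurd h1 (hmono hp hq hlt).ne
  · exact heq
  · exact absurd h1.symm (hmono hq hp hlt).ne

theorem exists_cylinderFun_eq {S : Type*} (x : ℝ) (s : S) :
    ∃ u : I, cylinderFun S (u, s) = ((x, s) : ℝ × S) := by
  -- The equation `(1 - u)⁻¹ - u⁻¹ = x` amounts to `x u² + (2 - x) u - 1 = 0`. Its root in `(0,1)`,
  -- written without dividing by `x`, is `2 / (2 + (r - x))`.
  set r := √(x ^ 2 + 4) with hr
  have hr2 : r ^ 2 = x ^ 2 + 4 := Real.sq_sqrt (by positivity)
  have hrx : 0 < r - x := by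
    have h0 : 0 ≤ r := Real.sqrt_nonneg _
    by_contra hc
    nlinarith
  have hu0 : 0 < 2 / (2 + (r - x)) := by positivity
  have hu1 : 2 / (2 + (r - x)) < 1 := by rw [div_lt_one (by positivity)]; linarith
  refine ⟨⟨2 / (2 + (r - x)), hu0.le, hu1.le⟩, ?_⟩
  rw [cylinderFun_of_not_end]
  · rw [OnePoint.coe_eq_coe]
    refine Prod.ext ?_ rfl
    have h1 : 1 - 2 / (2 + (r - x)) = (r - x) / (2 + (r - x)) := by field_simp; ring
    simp only [h1]
    field_simp
    nlinarith
  · rintro (h | h)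
    · exact hu0.ne' (congrArg Subtype.val h)
    · exact hu1.ne (congrArg Subtype.val h)

/-- Maps from the cylinder with ends collapsed, with parameters, are maps from the one-point
compactification. -/
theorem exists_descend {S B X : Type*} [TopologicalSpace S] [CompactSpace S] [T2Space S]
    [TopologicalSpace B] [TopologicalSpace X] [CompactSpace X] [T2Space X] {b : B}
    (k : C((I × S) × X, B)) (h0 : ∀ s x, k ((0, s), x) = b) (h1 : ∀ s x, k ((1, s), x) = b) :
    ∃ h : C(OnePoint (ℝ × S) × X, B), (∀ p x, h (cylinderFun S p, x) = k (p, x)) ∧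
      ∀ x, h (OnePoint.infty, x) = b := by
  -- The additional point keeps the map onto the compactification surjective when `S` is empty.
  let q₀ : (I × S) ⊕ Unit → OnePoint (ℝ × S) := Sum.elim (cylinderFun S) fun _ => OnePoint.infty
  have hq₀ : Continuous q₀ := (continuous_cylinderFun S).sumElim continuous_const
  have hq₀s : Function.Surjective q₀ := by
    intro y
    induction y using OnePoint.rec with
    | infty => exact ⟨.inr (), rfl⟩
    | coe y =>
      obtain ⟨u, hu⟩ := exists_cylinderFun_eq y.1 y.2
      exact ⟨.inl (u, y.2), hu⟩
  -- With the parameters curried, only `q₀` itself has to be a quotient map. It is one because it is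
  -- a continuous surjection from a compact space to a Hausdorff space.
  let k₀ : C((I × S) ⊕ Unit, C(X, B)) :=
    ⟨Sum.elim k.curry fun _ => ContinuousMap.const X b,
      k.curry.continuous.sumElim continuous_const⟩
  have hend : ∀ p : I × S, p.1 = 0 ∨ p.1 = 1 → k.curry p = ContinuousMap.const X b := by
    rintro ⟨u, s⟩ (rfl | rfl)
    · ext x; exact h0 s x
    · ext x; exact h1 s x
  have hk₀ : ∀ a a', q₀ a = q₀ a' → k₀ a = k₀ a' := by
    have aux : ∀ p p' : I × S, cylinderFun S p = cylinderFun S p' → k.curry p = k.curry p' := by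
      intro p p' h
      by_cases hp : p.1 = 0 ∨ p.1 = 1
      · have hp' := cylinderFun_eq_infty.1 (h.symm.trans (cylinderFun_of_end hp))
        rw [hend p hp, hend p' hp']
      · rw [eq_of_cylinderFun_eq hp h]
    rintro (p | a) (p' | a') h
    · exact aux p p' h
    · exact hend p (cylinderFun_eq_infty.1 h)
    · exact (hend p' (cylinderFun_eq_infty.1 h.symm)).symm
    · rfl
  have hq : Topology.IsQuotientMap q₀ :=
    hq₀.isClosedMap.isQuotientMap hq₀ hq₀s
  let k₁ : C(OnePoint (ℝ × S), C(X, B)) := hq.lift (f := ⟨q₀, hq₀⟩) k₀ fun a a' => hk₀ a a'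
  have hk₁ : ∀ a, k₁ (q₀ a) = k₀ a := fun a =>
    DFunLike.congr_fun (hq.lift_comp (f := ⟨q₀, hq₀⟩) k₀ fun a a' => hk₀ a a') a
  exact ⟨k₁.uncurry, fun p x => DFunLike.congr_fun (hk₁ (.inl p)) x,
    fun x => DFunLike.congr_fun (hk₁ (.inr ())) x⟩

section
variable (S : Type u) [TopologicalSpace S]

/-- Spacetime projects to space. -/
def spaceProj : C(Spacetime S, OnePoint (ℝ × S)) where
  toFun := Quotient.lift (fun p : (ℝ ⊕ Unit) × OnePoint (ℝ × S) =>
      Sum.elim (fun _ => p.2) (fun _ => OnePoint.infty) p.1) (by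
    rintro ⟨t, y⟩ ⟨t', y'⟩ (h | ⟨h, h'⟩)
    · rw [h]
    · rcases t with t | t <;> rcases t' with t' | t' <;> simp_all)
  continuous_toFun := by
    refine Continuous.quotient_lift ?_ _
    rw [continuous_iff_continuousAt]
    rintro ⟨t | t, y⟩
    · have hopen : IsOpen {p : (ℝ ⊕ Unit) × OnePoint (ℝ × S) | p.1 ∈ Set.range Sum.inl} :=
        isOpen_range_inl.preimage continuous_fst
      refine continuousAt_snd.congr ?_
      filter_upwards [hopen.mem_nhds ⟨t, rfl⟩]
      rintro ⟨t' | t', y'⟩ h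
      · rfl
      · obtain ⟨x, hx⟩ := h; cases hx
    · have hopen : IsOpen {p : (ℝ ⊕ Unit) × OnePoint (ℝ × S) | p.1 ∈ Set.range Sum.inr} :=
        isOpen_range_inr.preimage continuous_fst
      refine (continuousAt_const (y := (OnePoint.infty : OnePoint (ℝ × S)))).congr ?_
      filter_upwards [hopen.mem_nhds ⟨t, rfl⟩]
      rintro ⟨t' | t', y'⟩ h
      · obtain ⟨x, hx⟩ := h; cases hx
      · rfl

/-- The time-zero slice. -/
def timeZero : C(OnePoint (ℝ × S), Spacetime S) :=
  (Smash.mk _ _).comp ⟨fun y => (Sum.inl 0, y), by fun_prop⟩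

theorem timeZero_infty : timeZero S OnePoint.infty = Smash.base _ _ := Smash.mk_right _ _ _

/-- Spacetime retracts to the time-zero slice by rescaling the time axis. -/
theorem exists_timeRescaling : ∃ H : C(I × Spacetime S, Spacetime S),
    (∀ x, H (0, x) = timeZero S (spaceProj S x)) ∧ (∀ x, H (1, x) = x) ∧
      ∀ r, H (r, Smash.base _ _) = Smash.base _ _ := by
  let m : I → (ℝ ⊕ Unit) × OnePoint (ℝ × S) → (ℝ ⊕ Unit) × OnePoint (ℝ × S) :=
    fun r p => (Sum.map (fun t => (r : ℝ) * t) id p.1, p.2)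
  have hm : Continuous fun q : I × ((ℝ ⊕ Unit) × OnePoint (ℝ × S)) => m q.1 q.2 := by
    have h1 : Continuous fun q : I × (ℝ ⊕ Unit) =>
        (Sum.map (fun t => (q.1 : ℝ) * t) id q.2 : ℝ ⊕ Unit) := by
      have : Continuous fun q : (ℝ ⊕ Unit) × I =>
          (Sum.map (fun t => (q.2 : ℝ) * t) id q.1 : ℝ ⊕ Unit) := by
        let c : C(ℝ ⊕ Unit, C(I, ℝ ⊕ Unit)) :=
          ⟨Sum.elim (ContinuousMap.curry ⟨fun q : ℝ × I => Sum.inl ((q.2 : ℝ) * q.1), by fun_prop⟩)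
            fun u => ContinuousMap.const I (Sum.inr u),
            (ContinuousMap.continuous _).sumElim continuous_of_discreteTopology⟩
        refine c.uncurry.continuous.congr ?_
        rintro ⟨t | t, r⟩ <;> rfl
      exact this.comp continuous_swap
    exact (h1.comp (continuous_fst.prodMk (continuous_fst.comp continuous_snd))).prodMk
      (continuous_snd.comp continuous_snd)
  let H : I × Spacetime S → Spacetime S := fun q =>
    Quotient.lift (fun p => Smash.mk (Sum.inr ()) OnePoint.infty (m q.1 p)) (by
      rintro ⟨t, y⟩ ⟨t', y'⟩ (h | ⟨h, h'⟩)
      · rw [h]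
      · refine Quotient.sound (s := smashSetoid _ _) (Or.inr ⟨?_, ?_⟩)
        · rcases h with h | h
          · left; dsimp only at h; subst h; rfl
          · right; exact h
        · rcases h' with h | h
          · left; dsimp only at h; subst h; rfl
          · right; exact h) q.2
  have hmkq : Topology.IsQuotientMap
      (Smash.mk (Sum.inr () : ℝ ⊕ Unit) (OnePoint.infty : OnePoint (ℝ × S))) :=
    isQuotientMap_quot_mk
  -- The product of the smash quotient map with the locally compact interval is again a quotient
  -- map.
  have hH : Continuous H := hmkq.continuous_lift_prod_right
    ((Smash.mk (Sum.inr () : ℝ ⊕ Unit) (OnePoint.infty : OnePoint (ℝ × S))).continuous.comp hm)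
  refine ⟨⟨H, hH⟩, ?_, ?_, fun r => rfl⟩
  · rintro ⟨t | t, y⟩
    · simp only [ContinuousMap.coe_mk]
      change Smash.mk _ _ (Sum.inl ((0 : ℝ) * t), y) = Smash.mk _ _ (Sum.inl 0, y)
      rw [zero_mul]
    · exact Quotient.sound (s := smashSetoid _ _) (Or.inr ⟨Or.inl rfl, Or.inr rfl⟩)
  · rintro ⟨t | t, y⟩
    · change Smash.mk _ _ (Sum.inl ((1 : ℝ) * t), y) = Smash.mk _ _ (Sum.inl t, y)
      rw [one_mul]
    · rfl

end

section
variable {S : Type u} [TopologicalSpace S] {B : Type v} [TopologicalSpace B] {b : B}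

/-- The stationary field given by a pointed map from space. -/
def stationaryField (h : C(OnePoint (ℝ × S), B)) (hh : h OnePoint.infty = b) : TopFields S b :=
  ⟨h.comp (spaceProj S), hh⟩

/-- Precomposition with the rescaling of time is a path of fields, since the rescaling preserves the
base point throughout. -/
theorem joined_stationaryField (f : TopFields S b) :
    Joined (stationaryField (f.1.comp (timeZero S)) (by
      rw [ContinuousMap.comp_apply, timeZero_infty, f.2])) f := by
  obtain ⟨H, H0, H1, Hb⟩ := exists_timeRescaling S
  exact ⟨{ toFun := fun r => ⟨(f.1.comp H).curry r, by simp [Hb, f.2]⟩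
           continuous_toFun := Continuous.subtype_mk (f.1.comp H).curry.continuous
             fun r => by simp [Hb, f.2]
           source' := Subtype.ext (by ext x; simp [H0, stationaryField])
           target' := Subtype.ext (by ext x; simp [H1]) }⟩

variable [CompactSpace S] [T2Space S]

/-- A loop takes the value `b` at both ends, so it descends to the compactified space and extends to
a field independent of time. -/
theorem toLoops_surjective : Function.Surjective (toLoops S b) := by
  intro γ
  obtain ⟨h, hh, hb⟩ := exists_descend (b := b) (X := Unit)
    ⟨fun q : (I × S) × Unit => γ q.1.1 q.1.2, by fun_prop⟩ (fun s _ => by simp)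
    (fun s _ => by simp)
  refine ⟨stationaryField (h.comp ⟨fun y => (y, ()), by fun_prop⟩) (hb ()), ?_⟩
  ext t s
  exact hh (t, s) ()

/-- A path of loops descends, parameter included, to a path between the stationary fields of the two
time-zero slices. Time rescaling connects each field with its stationary version. -/
theorem joined_of_joined_toLoops {f f' : TopFields S b}
    (h : Joined (toLoops S b f) (toLoops S b f')) : Joined f f' := by
  obtain ⟨γ⟩ := h
  have hγ : Continuous fun q : I × I => γ q.1 q.2 := Path.continuous_uncurry_iff.2 γ.continuous
  obtain ⟨k, hk, hkb⟩ := exists_descend (b := b) (X := I)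
    ⟨fun q : (I × S) × I => γ q.2 q.1.1 q.1.2, continuous_eval.comp ((hγ.comp (by fun_prop :
      Continuous fun q : (I × S) × I => (q.2, q.1.1))).prodMk (by fun_prop :
      Continuous fun q : (I × S) × I => q.1.2))⟩ (fun s _ => by simp)
    (fun s _ => by simp)
  have hend : ∀ (f : TopFields S b) (r : I), γ r = toLoops S b f →
      ∀ y, k (y, r) = f.1 (timeZero S y) := by
    intro f r hr y
    induction y using OnePoint.rec with
    | infty => rw [hkb, timeZero_infty, f.2]
    | coe y =>
      obtain ⟨u, hu⟩ := exists_cylinderFun_eq y.1 y.2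
      rw [← show cylinderFun S (u, y.2) = (y : OnePoint (ℝ × S)) from hu, hk]
      simp only [ContinuousMap.coe_mk, hr]
      rfl
  let k' : C(I, C(OnePoint (ℝ × S), B)) := (k.comp ⟨fun q => (q.2, q.1), by fun_prop⟩).curry
  have hstat : Joined (stationaryField (f.1.comp (timeZero S)) (by
        rw [ContinuousMap.comp_apply, timeZero_infty, f.2]))
      (stationaryField (f'.1.comp (timeZero S)) (by
        rw [ContinuousMap.comp_apply, timeZero_infty, f'.2])) :=
    ⟨{ toFun := fun r => stationaryField (k' r) (hkb r)
       continuous_toFun := Continuous.subtype_mk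
         ((ContinuousMap.continuous_precomp (spaceProj S)).comp k'.continuous) _
       source' := Subtype.ext (by ext x; exact hend f 0 γ.source _)
       target' := Subtype.ext (by ext x; exact hend f' 1 γ.target _) }⟩
  exact ((joined_stationaryField f).symm.trans hstat).trans (joined_stationaryField f')

end

/-! ### Affine simplices -/

section Affine
variable {S V : Type*} [TopologicalSpace S] [AddCommGroup V] [Module ℝ V] [TopologicalSpace V]
  [IsTopologicalAddGroup V] [ContinuousSMul ℝ V]

/-- The singular simplex which is the image of the affine simplex with given vertices. -/
def affineSimplex {n : ℕ} (Q : C(V, S)) (v : Fin (n + 1) → V) : Simplex n S :=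
  Q.comp ⟨fun x => ∑ i, x i • v i, continuous_finsetSum _ fun i _ =>
    ((continuous_apply i).comp continuous_subtype_val).smul continuous_const⟩

theorem affineSimplex_apply {n : ℕ} (Q : C(V, S)) (v : Fin (n + 1) → V)
    (x : stdSimplex ℝ (Fin (n + 1))) : affineSimplex Q v x = Q (∑ i, x i • v i) := rfl

theorem face_affineSimplex {n : ℕ} (Q : C(V, S)) (v : Fin (n + 2) → V) (i : Fin (n + 2)) :
    face i (affineSimplex Q v) = affineSimplex Q (v ∘ i.succAbove) := by
  ext x
  have h : ∑ j, (stdSimplex.map i.succAbove x) j • v j = ∑ j, x j • v (i.succAbove j) := by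
    simp only [stdSimplex.map_coe, FunOnFinite.linearMap_apply_apply, Finset.sum_smul]
    rw [← Finset.sum_fiberwise Finset.univ i.succAbove fun j => x j • v (i.succAbove j)]
    refine Finset.sum_congr rfl fun j _ => Finset.sum_congr rfl fun k hk => ?_
    rw [(Finset.mem_filter.1 hk).2]
  exact congrArg Q h

theorem affineSimplex_vertex {n : ℕ} (Q : C(V, S)) (v : Fin (n + 1) → V) (i : Fin (n + 1)) :
    affineSimplex Q v (stdSimplex.vertex i) = Q (v i) := by
  rw [affineSimplex_apply]
  congr 1
  simp [Pi.single_apply]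

/-- The singular edge which is the image of a line segment. -/
def edge (Q : C(V, S)) (v w : V) : Simplex 1 S := affineSimplex Q ![v, w]

theorem edge_apply (Q : C(V, S)) (v w : V) (x : stdSimplex ℝ (Fin 2)) :
    edge Q v w x = Q (x 0 • v + x 1 • w) := by
  simp [edge, affineSimplex_apply]

theorem edge_zero (Q : C(V, S)) (v w : V) : edge Q v w (stdSimplex.vertex 0) = Q v :=
  affineSimplex_vertex Q _ 0

theorem edge_one (Q : C(V, S)) (v w : V) : edge Q v w (stdSimplex.vertex 1) = Q w :=
  affineSimplex_vertex Q _ 1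

theorem coboundary_one_apply {S : Type*} [TopologicalSpace S] (c : Cochain 1 S)
    (τ : Simplex 2 S) : coboundary 1 S c τ = c (face 0 τ) - c (face 1 τ) + c (face 2 τ) := by
  have h : coboundary 1 S c τ = ∑ i : Fin 3, (-1) ^ (i : ℕ) * c (face i τ) := rfl
  rw [h, Fin.sum_univ_three]
  simp
  ring

theorem cocycle_face {c : Cochain 1 S} (hc : c ∈ cocycles 1 S) (τ : Simplex 2 S) :
    c (face 0 τ) - c (face 1 τ) + c (face 2 τ) = 0 :=
  (coboundary_one_apply c τ).symm.trans (congrFun (AddMonoidHom.mem_ker.1 hc) τ)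

/-- The cocycle condition is evaluated on the affine triangle with vertices `u`, `v`, `w`. -/
theorem edge_add {c : Cochain 1 S} (hc : c ∈ cocycles 1 S) (Q : C(V, S)) (u v w : V) :
    c (edge Q u v) + c (edge Q v w) = c (edge Q u w) := by
  have h := cocycle_face hc (affineSimplex Q ![u, v, w])
  rw [face_affineSimplex, face_affineSimplex, face_affineSimplex] at h
  have h0 : ![u, v, w] ∘ (0 : Fin 3).succAbove = ![v, w] := by
    ext i; fin_cases i <;> rfl
  have h1 : ![u, v, w] ∘ (1 : Fin 3).succAbove = ![u, w] := by
    ext i; fin_cases i <;> rfl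
  have h2 : ![u, v, w] ∘ (2 : Fin 3).succAbove = ![u, v] := by
    ext i; fin_cases i <;> rfl
  rw [h0, h1, h2] at h
  simp only [edge]
  linarith

theorem edge_self {c : Cochain 1 S} (hc : c ∈ cocycles 1 S) (Q : C(V, S)) (v : V) :
    c (edge Q v v) = 0 := by
  have := edge_add hc Q v v v
  linarith

end Affine

/-! ### Edges along the real line and coboundaries of zero-cochains -/

section
variable {S : Type*} [TopologicalSpace S]

/-- The extension of a singular edge to the real line, constant outside the unit interval. -/
def Simplex.extend (ω : Simplex 1 S) : C(ℝ, S) :=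
  ω.comp ⟨fun t => stdSimplexHomeomorphUnitInterval.symm (Set.projIcc 0 1 zero_le_one t),
    stdSimplexHomeomorphUnitInterval.symm.continuous.comp continuous_projIcc⟩

theorem Simplex.extend_mem_range (ω : Simplex 1 S) (t : ℝ) : ω.extend t ∈ Set.range ω :=
  ⟨_, rfl⟩

theorem edge_extend (ω : Simplex 1 S) : edge ω.extend 0 1 = ω := by
  ext x
  rw [edge_apply]
  have h : x 0 • (0 : ℝ) + x 1 • (1 : ℝ) = (stdSimplexHomeomorphUnitInterval x : ℝ) := by
    simp [stdSimplexHomeomorphUnitInterval, stdSimplexEquivIcc]; rfl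
  rw [h]
  simp only [Simplex.extend, ContinuousMap.comp_apply, ContinuousMap.coe_mk, Set.projIcc_val,
    Homeomorph.symm_apply_apply]

theorem range_edge_subset {Q : C(ℝ, S)} {v w : ℝ} {A : Set ℝ} (hA : Convex ℝ A) (hv : v ∈ A)
    (hw : w ∈ A) : Set.range (edge Q v w) ⊆ Q '' A := by
  rintro _ ⟨x, rfl⟩
  rw [edge_apply]
  exact ⟨_, hA hv hw (stdSimplex.zero_le x 0) (stdSimplex.zero_le x 1) (stdSimplex.add_eq_one x),
    rfl⟩

/-- A cocycle which vanishes on small edges vanishes. -/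
theorem cocycle_eq_zero_of_small {d : Cochain 1 S} (hd : d ∈ cocycles 1 S) (U : S → Set S)
    (hU : ∀ s, IsOpen (U s)) (hmem : ∀ s, s ∈ U s)
    (h : ∀ s, ∀ ω : Simplex 1 S, Set.range ω ⊆ U s → d ω = 0) : d = 0 := by
  funext ω
  -- This replaces subdivision: the value on the part of the edge from `0` to `t` changes by the
  -- value on a small edge, hence not at all locally. It is thus constant in `t`, and zero at `t =
  -- 0`.
  have hloc : IsLocallyConstant fun t : ℝ => d (edge ω.extend 0 t) := by
    rw [IsLocallyConstant.iff_eventually_eq]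
    intro t₀
    obtain ⟨ε, hε, hball⟩ := Metric.isOpen_iff.1 ((hU (ω.extend t₀)).preimage ω.extend.continuous)
      t₀ (hmem _)
    filter_upwards [Metric.ball_mem_nhds t₀ hε] with t ht
    rw [← edge_add hd ω.extend 0 t₀ t, h (ω.extend t₀) (edge ω.extend t₀ t), add_zero]
    refine (range_edge_subset (convex_ball t₀ ε) (Metric.mem_ball_self hε) ht).trans ?_
    rintro _ ⟨t', ht', rfl⟩
    exact hball ht'
  have h1 := hloc.apply_eq_of_preconnectedSpace 1 0
  rw [edge_self hd, edge_extend] at h1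
  exact h1

theorem face_vertex {n : ℕ} (i : Fin (n + 2)) (τ : Simplex (n + 1) S) (j : Fin (n + 1)) :
    face i τ (stdSimplex.vertex j) = τ (stdSimplex.vertex (i.succAbove j)) := by
  simp [face]

/-- The constant singular `0`-simplex at a point. -/
def pointSimplex (s : S) : Simplex 0 S := ContinuousMap.const _ s

theorem coboundary_zero_apply (b : Cochain 0 S) (ω : Simplex 1 S) :
    coboundary 0 S b ω =
      b (pointSimplex (ω (stdSimplex.vertex 1))) - b (pointSimplex (ω (stdSimplex.vertex 0))) := by
  have hf : ∀ τ : Simplex 0 S, τ = pointSimplex (τ (stdSimplex.vertex 0)) := by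
    intro τ
    ext x
    exact congrArg τ (Subsingleton.elim _ _)
  have h0 : face 0 ω = pointSimplex (ω (stdSimplex.vertex 1)) := by
    rw [hf (face 0 ω), face_vertex]; rfl
  have h1 : face 1 ω = pointSimplex (ω (stdSimplex.vertex 0)) := by
    rw [hf (face 1 ω), face_vertex]; rfl
  have h : coboundary 0 S b ω = ∑ i : Fin 2, (-1) ^ (i : ℕ) * b (face i ω) := rfl
  rw [h, Fin.sum_univ_two, h0, h1]
  simp
  ring

end

/-! ### Winding cochains of circle-valued functions -/

/-- The universal covering `ℝ → U(1)`, `x ↦ exp(2πix)`. -/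
def circleExp (x : ℝ) : Circle := Circle.exp (2 * Real.pi * x)

theorem continuous_circleExp : Continuous circleExp := by
  unfold circleExp; fun_prop

theorem circleExp_add (x y : ℝ) : circleExp (x + y) = circleExp x * circleExp y := by
  rw [circleExp, mul_add, Circle.exp_add]; rfl

theorem circleExp_neg (x : ℝ) : circleExp (-x) = (circleExp x)⁻¹ := by
  rw [circleExp, mul_neg, Circle.exp_neg]; rfl

theorem circleExp_zero : circleExp 0 = 1 := by simp [circleExp]

theorem circleExp_eq_iff {x y : ℝ} : circleExp x = circleExp y ↔ ∃ m : ℤ, x = y + m := by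
  rw [circleExp, circleExp, Circle.exp_eq_exp]
  have hpi := Real.pi_pos.ne'
  refine exists_congr fun m => ⟨fun h => ?_, fun h => by rw [h]; ring⟩
  have : 2 * Real.pi * x = 2 * Real.pi * (y + m) := by rw [h]; ring
  exact mul_left_cancel₀ (by positivity) this

theorem circleExp_add_int (x : ℝ) (m : ℤ) : circleExp (x + m) = circleExp x :=
  circleExp_eq_iff.2 ⟨m, rfl⟩

/-- The principal value of the logarithm. -/
def circleLog (z : Circle) : ℝ := Complex.arg z / (2 * Real.pi)

theorem circleExp_log (z : Circle) : circleExp (circleLog z) = z := by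
  rw [circleExp, circleLog, mul_div_cancel₀ _ (by positivity), Circle.exp_arg]

theorem circleLog_one : circleLog 1 = 0 := by simp [circleLog]

theorem continuousAt_circleLog {z : Circle} (hz : (z : ℂ) ∈ Complex.slitPlane) :
    ContinuousAt circleLog z :=
  ((Complex.continuousAt_arg hz).comp (f := fun z : Circle => (z : ℂ))
    continuous_subtype_val.continuousAt).div_const _

/-- Null-homotopic circle-valued functions have logarithms. -/
theorem exists_log_of_homotopy {A : Type*} [TopologicalSpace A] (H : C(I × A, Circle))
    (f₀ : C(A, ℝ)) (h0 : ∀ a, H (0, a) = circleExp (f₀ a)) :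
    ∃ θ : C(A, ℝ), ∀ a, circleExp (θ a) = H (1, a) := by
  have hp : 0 < 2 * Real.pi := by positivity
  let f₁ : C(A, ℝ) := ⟨fun a => 2 * Real.pi * f₀ a, by fun_prop⟩
  have hf₁ : ∀ a, H (0, a) = Circle.exp (f₁ a) := h0
  let L := Circle.isCoveringMap_exp.liftHomotopy H f₁ hf₁
  refine ⟨⟨fun a => L (1, a) / (2 * Real.pi), by fun_prop⟩, fun a => ?_⟩
  have hmul : 2 * Real.pi * (L (1, a) / (2 * Real.pi)) = L (1, a) := mul_div_cancel₀ _ hp.ne'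
  refine (congrArg Circle.exp hmul).trans ?_
  exact congrFun (Circle.isCoveringMap_exp.liftHomotopy_lifts H f₁ hf₁) (1, a)

theorem exists_log {A : Type*} [TopologicalSpace A] [ContractibleSpace A] (f : C(A, Circle)) :
    ∃ θ : C(A, ℝ), ∀ a, circleExp (θ a) = f a := by
  obtain ⟨a₀, ⟨H⟩⟩ := id_nullhomotopic A
  obtain ⟨θ, hθ⟩ := exists_log_of_homotopy
    (f.comp ((H.symm : C(I × A, A)))) (ContinuousMap.const A (circleLog (f a₀)))
    (fun a => by simp [circleExp_log])
  exact ⟨θ, fun a => by simpa using hθ a⟩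

/-- The difference of two continuous logarithms of one function is continuous with integral values,
hence constant on a preconnected space. -/
theorem sub_eq_sub_of_circleExp_eq {A : Type*} [TopologicalSpace A] [PreconnectedSpace A]
    (θ θ' : C(A, ℝ)) (h : ∀ a, circleExp (θ a) = circleExp (θ' a)) (a b : A) :
    θ a - θ b = θ' a - θ' b := by
  have hconst : IsLocallyConstant fun a => θ a - θ' a := by
    rw [IsLocallyConstant.iff_eventually_eq]
    intro a
    have hc : Continuous fun a => θ a - θ' a := by fun_prop
    filter_upwards [hc.continuousAt.preimage_mem_nhds (Metric.ball_mem_nhds _ one_pos)] with y hy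
    obtain ⟨m, hm⟩ := circleExp_eq_iff.1 (h a)
    obtain ⟨k, hk⟩ := circleExp_eq_iff.1 (h y)
    rw [Set.mem_preimage, Metric.mem_ball, Real.dist_eq, hm, hk] at hy
    have h1 : |((k - m : ℤ) : ℝ)| < 1 := by
      push_cast
      convert hy using 2
      ring
    have h2 : k - m = 0 := Int.abs_lt_one_iff.1 (by exact_mod_cast h1)
    have h3 : (k : ℝ) = m := by exact_mod_cast sub_eq_zero.1 h2
    rw [hm, hk, h3]
    ring
  have := hconst.apply_eq_of_preconnectedSpace a b
  linarith

instance (n : ℕ) : ContractibleSpace (stdSimplex ℝ (Fin (n + 1))) :=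
  (convex_stdSimplex ℝ (Fin (n + 1))).contractibleSpace ⟨_, single_mem_stdSimplex ℝ 0⟩

section Winding
variable {S : Type*} [TopologicalSpace S]

/-- The integral cochain which compares the variation along edges of continuous logarithms of `f`
with that of the function `φ`. -/
def IsWinding (f : C(S, Circle)) (φ : S → ℝ) (c : Cochain 1 S) : Prop :=
  (∀ s, circleExp (φ s) = f s) ∧ ∀ (ω : Simplex 1 S) (θ : C(stdSimplex ℝ (Fin 2), ℝ)),
    (∀ x, circleExp (θ x) = f (ω x)) → (c ω : ℝ) =
      θ (stdSimplex.vertex 1) - θ (stdSimplex.vertex 0) -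
        (φ (ω (stdSimplex.vertex 1)) - φ (ω (stdSimplex.vertex 0)))

/-- The logarithm `φ` may be discontinuous. Along an edge, a continuous logarithm equals `φ` plus
integers, and the change of these integers is the winding. -/
theorem exists_isWinding {f : C(S, Circle)} {φ : S → ℝ} (hφ : ∀ s, circleExp (φ s) = f s) :
    ∃ c, IsWinding f φ c := by
  choose θ hθ using fun ω : Simplex 1 S => exists_log (f.comp ω)
  have hint : ∀ ω x, ∃ m : ℤ, θ ω x = φ (ω x) + m := fun ω x =>
    circleExp_eq_iff.1 ((hθ ω x).trans (hφ (ω x)).symm)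
  choose m hm using hint
  refine ⟨fun ω => m ω (stdSimplex.vertex 1) - m ω (stdSimplex.vertex 0), hφ, fun ω θ' hθ' => ?_⟩
  rw [sub_eq_sub_of_circleExp_eq θ' (θ ω) fun x => (hθ' x).trans (hθ ω x).symm, hm, hm]
  push_cast
  ring

/-- A logarithm on the whole triangle restricts to its three faces, so the alternating sum
telescopes. -/
theorem IsWinding.mem_cocycles {f : C(S, Circle)} {φ : S → ℝ} {c : Cochain 1 S}
    (h : IsWinding f φ c) : c ∈ cocycles 1 S := by
  rw [cocycles, AddMonoidHom.mem_ker]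
  funext τ
  obtain ⟨θ, hθ⟩ := exists_log (f.comp τ)
  have hface : ∀ i, (c (face i τ) : ℝ) =
      θ (stdSimplex.vertex (i.succAbove 1)) - θ (stdSimplex.vertex (i.succAbove 0)) -
        (φ (τ (stdSimplex.vertex (i.succAbove 1))) -
          φ (τ (stdSimplex.vertex (i.succAbove 0)))) := by
    intro i
    rw [h.2 (face i τ) (θ.comp ⟨stdSimplex.map i.succAbove, stdSimplex.continuous_map _⟩)
      (fun x => hθ _), face_vertex, face_vertex]
    simp
  have h0 := hface 0
  have h1 := hface 1
  have h2 := hface 2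
  have e01 : (0 : Fin 3).succAbove 1 = 2 := rfl
  have e00 : (0 : Fin 3).succAbove 0 = 1 := rfl
  have e11 : (1 : Fin 3).succAbove 1 = 2 := rfl
  have e10 : (1 : Fin 3).succAbove 0 = 0 := rfl
  have e21 : (2 : Fin 3).succAbove 1 = 1 := rfl
  have e20 : (2 : Fin 3).succAbove 0 = 0 := rfl
  rw [e01, e00] at h0
  rw [e11, e10] at h1
  rw [e21, e20] at h2
  have key : ((c (face 0 τ) - c (face 1 τ) + c (face 2 τ) : ℤ) : ℝ) = 0 := by
    push_cast
    rw [h0, h1, h2]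
    ring
  have key' : c (face 0 τ) - c (face 1 τ) + c (face 2 τ) = 0 := by exact_mod_cast key
  exact (coboundary_one_apply c τ).trans key'

theorem IsWinding.mul {f g : C(S, Circle)} {φ ψ : S → ℝ} {c d : Cochain 1 S}
    (hf : IsWinding f φ c) (hg : IsWinding g ψ d) : IsWinding (f * g) (φ + ψ) (c + d) := by
  refine ⟨fun s => by simp [circleExp_add, hf.1, hg.1], fun ω θ hθ => ?_⟩
  obtain ⟨θ₁, h₁⟩ := exists_log (f.comp ω)
  have h₂ : ∀ x, circleExp ((θ - θ₁) x) = g (ω x) := fun x => by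
    rw [ContinuousMap.sub_apply, sub_eq_add_neg, circleExp_add, circleExp_neg, hθ, h₁]
    simp
  simp only [Pi.add_apply, Int.cast_add, hf.2 ω θ₁ h₁, hg.2 ω (θ - θ₁) h₂,
    ContinuousMap.sub_apply]
  ring

theorem isWinding_zero {f : C(S, Circle)} {φ : C(S, ℝ)} (hφ : ∀ s, circleExp (φ s) = f s) :
    IsWinding f φ 0 := by
  refine ⟨hφ, fun ω θ hθ => ?_⟩
  have := sub_eq_sub_of_circleExp_eq θ (φ.comp ω) (fun x => (hθ x).trans (hφ _).symm)
    (stdSimplex.vertex 1) (stdSimplex.vertex 0)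
  rw [this]
  simp

/-- Pointwise powers with locally constant exponents `±1`. -/
theorem IsWinding.twist {f g : C(S, Circle)} {φ : S → ℝ} {c : Cochain 1 S} (h : IsWinding f φ c)
    (e : LocallyConstant S ℤˣ) (hg : ∀ s, g s = f s ^ (e s : ℤ)) :
    IsWinding g (fun s => (e s : ℤ) * φ s) (FluxModuli.twist 1 e c) := by
  have hpow : ∀ (u : ℤˣ) (x : ℝ), circleExp ((u : ℤ) * x) = circleExp x ^ (u : ℤ) := by
    intro u x
    rcases Int.units_eq_one_or u with rfl | rfl <;> simp [circleExp_neg]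
  refine ⟨fun s => by rw [hpow, h.1, hg], fun ω θ hθ => ?_⟩
  set u := e (ω (stdSimplex.vertex 0)) with hu
  have he : ∀ x, e (ω x) = u := fun x => apply_simplex e ω x _
  have huu : ((u : ℤ) : ℝ) * (u : ℤ) = 1 := by
    rcases Int.units_eq_one_or u with h | h <;> simp [h]
  -- Signs square to `1`, so multiplying a logarithm of `g = f ^ u` by `u` gives a logarithm of `f`.
  have h₁ : ∀ x, circleExp ((((u : ℤ) : ℝ) • θ) x) = f (ω x) := fun x => by
    rw [ContinuousMap.smul_apply, smul_eq_mul, hpow, hθ, hg, he, ← zpow_mul]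
    have : (u : ℤ) * (u : ℤ) = 1 := by exact_mod_cast huu
    rw [this, zpow_one]
  have h₂ : FluxModuli.twist 1 e c ω = (u : ℤ) * c ω := rfl
  rw [h₂, Int.cast_mul, h.2 ω _ h₁]
  simp only [ContinuousMap.smul_apply, smul_eq_mul, he]
  linear_combination (θ (stdSimplex.vertex 1) - θ (stdSimplex.vertex 0)) * huu

/-- Two pointwise logarithms of `f` differ by an integral zero-cochain, and its coboundary is the
difference of the windings. -/
theorem IsWinding.sub_mem_coboundaries {f : C(S, Circle)} {φ φ' : S → ℝ} {c c' : Cochain 1 S}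
    (h : IsWinding f φ c) (h' : IsWinding f φ' c') : c - c' ∈ coboundaries 1 S := by
  have hint : ∀ s, ∃ m : ℤ, φ' s = φ s + m := fun s =>
    circleExp_eq_iff.1 ((h'.1 s).trans (h.1 s).symm)
  choose m hm using hint
  refine ⟨fun τ => m (τ (stdSimplex.vertex 0)), ?_⟩
  funext ω
  rw [coboundary_zero_apply]
  obtain ⟨θ, hθ⟩ := exists_log (f.comp ω)
  have h1 := h.2 ω θ hθ
  have h2 := h'.2 ω θ hθ
  rw [hm, hm] at h2
  have : ((m (ω (stdSimplex.vertex 1)) - m (ω (stdSimplex.vertex 0)) : ℤ) : ℝ) =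
      ((c - c') ω : ℤ) := by
    simp only [Pi.sub_apply]
    push_cast
    rw [h1, h2]
    ring
  exact_mod_cast this

/-- Adding to `φ` the zero-cochain that bounds the winding cancels the winding. -/
theorem IsWinding.of_coboundary {f : C(S, Circle)} {φ : S → ℝ} {c : Cochain 1 S}
    (h : IsWinding f φ c) (hc : c ∈ coboundaries 1 S) : ∃ φ', IsWinding f φ' 0 := by
  obtain ⟨b, rfl⟩ := hc
  refine ⟨fun s => φ s + b (pointSimplex s), fun s => by rw [circleExp_add_int, h.1],
    fun ω θ hθ => ?_⟩
  have := h.2 ω θ hθ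
  rw [coboundary_zero_apply] at this
  push_cast at this
  simp only [Pi.zero_apply, Int.cast_zero]
  linarith

/-- The singular edge given by a path. -/
def pathEdge {s s' : S} (γ : Path s s') : Simplex 1 S :=
  γ.toContinuousMap.comp ⟨_, stdSimplexHomeomorphUnitInterval.continuous⟩

theorem pathEdge_zero {s s' : S} (γ : Path s s') : pathEdge γ (stdSimplex.vertex 0) = s :=
  γ.source

theorem pathEdge_one {s s' : S} (γ : Path s s') : pathEdge γ (stdSimplex.vertex 1) = s' :=
  γ.target

theorem exists_pathEdge [LocallyPathConnectedSpace S] {s : S} {U : Set S} (hU : U ∈ nhds s) :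
    ∀ᶠ s' in nhds s, ∃ ω : Simplex 1 S, Set.range ω ⊆ U ∧ ω (stdSimplex.vertex 0) = s ∧
      ω (stdSimplex.vertex 1) = s' := by
  obtain ⟨P, ⟨hP, hPc⟩, hPU⟩ := (path_connected_basis s).mem_iff.1 hU
  filter_upwards [hP] with s' hs'
  obtain ⟨γ, hγ⟩ := hPc.joinedIn s (mem_of_mem_nhds hP) s' hs'
  refine ⟨pathEdge γ, ?_, pathEdge_zero γ, pathEdge_one γ⟩
  rintro _ ⟨x, rfl⟩
  exact hPU (hγ _)

/-- Near `s` there is a continuous branch `ψ` of the logarithm with `ψ s = φ s`. Zero winding along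
short paths from `s` forces `φ` to vary as `ψ` does, so the two coincide near `s`. -/
theorem IsWinding.continuous [LocallyPathConnectedSpace S] {f : C(S, Circle)} {φ : S → ℝ}
    (h : IsWinding f φ 0) : Continuous φ := by
  rw [continuous_iff_continuousAt]
  intro s
  let ψ : S → ℝ := fun y => φ s + circleLog ((f s)⁻¹ * f y)
  let U : Set S := {y | (((f s)⁻¹ * f y : Circle) : ℂ) ∈ Complex.slitPlane}
  have hcont : Continuous fun y => (f s)⁻¹ * f y := by fun_prop
  have hU : IsOpen U := Complex.isOpen_slitPlane.preimage (continuous_subtype_val.comp hcont)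
  have hsU : s ∈ U := by simp [U]
  have hψ : ∀ y ∈ U, ContinuousAt ψ y := fun y hy =>
    continuousAt_const.add (ContinuousAt.comp (f := fun y => (f s)⁻¹ * f y)
      (continuousAt_circleLog hy) hcont.continuousAt)
  have hψe : ∀ y, circleExp (ψ y) = f y := fun y => by
    simp only [ψ]; rw [circleExp_add, h.1, circleExp_log, mul_inv_cancel_left]
  refine (hψ s hsU).congr ?_
  filter_upwards [exists_pathEdge (hU.mem_nhds hsU)]
  rintro y ⟨ω, hω, hω0, hω1⟩
  have hc : Continuous fun x => ψ (ω x) := continuous_iff_continuousAt.2 fun x =>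
    ContinuousAt.comp (f := ω) (hψ _ (hω ⟨x, rfl⟩)) ω.continuous.continuousAt
  have := h.2 ω ⟨_, hc⟩ fun x => hψe _
  simp only [ContinuousMap.coe_mk, hω0, hω1, Pi.zero_apply, Int.cast_zero] at this
  have hs : ψ s = φ s := by simp [ψ, circleLog_one]
  linarith

/-- A null-homotopy lifts through the covering `ℝ → U(1)`. Conversely, a logarithm is scaled to zero
linearly. -/
theorem joined_one_iff_exists_log {S : Type*} [TopologicalSpace S] [LocallyCompactSpace S]
    {f : C(S, Circle)} : Joined 1 f ↔ ∃ θ : C(S, ℝ), ∀ s, circleExp (θ s) = f s := by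
  constructor
  · rintro ⟨γ⟩
    obtain ⟨θ, hθ⟩ := exists_log_of_homotopy ⟨fun q : I × S => γ q.1 q.2, by fun_prop⟩ 0
      (fun s => by simp [circleExp_zero])
    exact ⟨θ, fun s => by simpa using hθ s⟩
  · rintro ⟨θ, hθ⟩
    exact ⟨{ toContinuousMap := ContinuousMap.curry ⟨fun q : I × S => circleExp ((q.1 : ℝ) * θ q.2),
               continuous_circleExp.comp (by fun_prop)⟩
             source' := by ext1 s; simp [circleExp_zero]
             target' := by ext1 s; simp [hθ] }⟩

end Winding

/-! ### Every integral one-cocycle on a locally contractible space winds -/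

/-- A neighbourhood of `s₀` which contracts to `s₀` inside the space. -/
structure LocalContraction {S : Type*} [TopologicalSpace S] (s₀ : S) where
  /-- the neighbourhood -/
  nhd : Set S
  isOpen_nhd : IsOpen nhd
  mem_nhd : s₀ ∈ nhd
  /-- the contraction -/
  contract : ℝ × S → S
  continuousOn_contract : ContinuousOn contract {q | q.2 ∈ nhd}
  contract_zero : ∀ s ∈ nhd, contract (0, s) = s₀
  contract_one : ∀ s ∈ nhd, contract (1, s) = s

/-- A ball in a chart contracts along straight lines to its centre. Clamping the time keeps the
formula inside the chart for every real time. -/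
theorem nonempty_localContraction {E S : Type*} [NormedAddCommGroup E] [NormedSpace ℝ E]
    [TopologicalSpace S] [ChartedSpace E S] (s₀ : S) : Nonempty (LocalContraction s₀) := by
  let e := chartAt E s₀
  have hs₀ : s₀ ∈ e.source := mem_chart_source E s₀
  obtain ⟨r, hr, hball⟩ := Metric.isOpen_iff.1 e.open_target (e s₀) (e.map_source hs₀)
  let U : Set S := e.source ∩ e ⁻¹' Metric.ball (e s₀) r
  let clamp : ℝ → ℝ := fun t => (Set.projIcc (0 : ℝ) 1 zero_le_one t : ℝ)
  have hclamp : Continuous clamp := continuous_subtype_val.comp continuous_projIcc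
  have hmem : ∀ t, ∀ s ∈ U, e s₀ + clamp t • (e s - e s₀) ∈ e.target := fun t s hs =>
    hball ((convex_ball (e s₀) r).add_smul_sub_mem (Metric.mem_ball_self hr) hs.2
      (Set.projIcc (0 : ℝ) 1 zero_le_one t).2)
  exact ⟨{
    nhd := U
    isOpen_nhd := e.isOpen_inter_preimage Metric.isOpen_ball
    mem_nhd := ⟨hs₀, Metric.mem_ball_self hr⟩
    contract := fun q => e.symm (e s₀ + clamp q.1 • (e q.2 - e s₀))
    continuousOn_contract := by
      refine e.continuousOn_symm.comp (t := e.target) ?_ fun q hq => hmem q.1 q.2 hq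
      refine continuousOn_const.add ((hclamp.comp continuous_fst).continuousOn.smul
        (ContinuousOn.sub ?_ continuousOn_const))
      exact e.continuousOn.comp continuousOn_snd fun q hq => hq.1
    contract_zero := fun s hs => by
      have : clamp 0 = 0 := by simp [clamp]
      rw [this, zero_smul, add_zero, e.left_inv hs₀]
    contract_one := fun s hs => by
      have : clamp 1 = 1 := by simp [clamp]
      rw [this, one_smul, add_sub_cancel, e.left_inv hs.1] }⟩

section
variable {S : Type*} [TopologicalSpace S]

open Classical in
/-- The value of a cochain on the edge of the local contraction which ends at `s`. -/
def LocalContraction.primitive {s₀ : S} (L : LocalContraction s₀) (c : Cochain 1 S) (s : S) : ℤ :=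
  if h : Continuous fun t : ℝ => L.contract (t, s) then c (edge ⟨_, h⟩ 0 1) else 0

/-- In the square `(t, u) ↦ contract (t, ω u)` the side `t = 0` collapses to `s₀`, the side `t = 1`
is `ω`, and the other two sides give the primitives at the endpoints. Both routes from `(0, 0)` to
`(1, 1)` have the value of the diagonal. -/
theorem LocalContraction.primitive_eq {s₀ : S} (L : LocalContraction s₀) {c : Cochain 1 S}
    (hc : c ∈ cocycles 1 S) (ω : Simplex 1 S) (hω : Set.range ω ⊆ L.nhd) :
    c ω = L.primitive c (ω (stdSimplex.vertex 1)) - L.primitive c (ω (stdSimplex.vertex 0)) := by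
  have hmem : ∀ t, ω.extend t ∈ L.nhd := fun t => hω (Simplex.extend_mem_range ω t)
  let R : C(ℝ × ℝ, S) := ⟨fun q => L.contract (q.1, ω.extend q.2), by
    rw [← continuousOn_univ]
    exact L.continuousOn_contract.comp (by fun_prop : Continuous fun q : ℝ × ℝ =>
      (q.1, ω.extend q.2)).continuousOn fun q _ => hmem q.2⟩
  have hv0 : ω.extend 0 = ω (stdSimplex.vertex 0) := by
    conv_rhs => rw [← edge_extend ω]
    exact (edge_zero _ _ _).symm
  have hv1 : ω.extend 1 = ω (stdSimplex.vertex 1) := by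
    conv_rhs => rw [← edge_extend ω]
    exact (edge_one _ _ _).symm
  have hprim : ∀ u : ℝ, L.primitive c (ω.extend u) = c (edge R (0, u) (1, u)) := by
    intro u
    have hu : Continuous fun t : ℝ => L.contract (t, ω.extend u) :=
      R.continuous.comp (by fun_prop : Continuous fun t : ℝ => (t, u))
    rw [LocalContraction.primitive, dif_pos hu]
    congr 1
    ext x
    rw [edge_apply, edge_apply]
    have : x 0 • u + x 1 • u = u := by
      rw [← add_smul, stdSimplex.add_eq_one, one_smul]
    have h2 : x 0 • ((0 : ℝ), u) + x 1 • ((1 : ℝ), u) = (x 0 • (0 : ℝ) + x 1 • (1 : ℝ), u) :=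
      Prod.ext rfl this
    rw [h2]
    rfl
  have hside : c (edge R (0, 0) (0, 1)) = 0 := by
    have : edge R (0, 0) (0, 1) = edge R (0, 0) (0, 0) := by
      ext x
      rw [edge_apply, edge_apply]
      have h1 : x 0 • ((0 : ℝ), (0 : ℝ)) + x 1 • ((0 : ℝ), (1 : ℝ)) = (0, x 1) := by simp
      have h2 : x 0 • ((0 : ℝ), (0 : ℝ)) + x 1 • ((0 : ℝ), (0 : ℝ)) = (0, 0) := by simp
      rw [h1, h2]
      exact (L.contract_zero _ (hmem _)).trans (L.contract_zero _ (hmem _)).symm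
    rw [this, edge_self hc]
  have htop : edge R (1, 0) (1, 1) = ω := by
    conv_rhs => rw [← edge_extend ω]
    ext x
    rw [edge_apply, edge_apply]
    have h1 : x 0 • ((1 : ℝ), (0 : ℝ)) + x 1 • ((1 : ℝ), (1 : ℝ)) =
        (1, x 0 • (0 : ℝ) + x 1 • (1 : ℝ)) := by
      have := stdSimplex.add_eq_one x
      ext
      · simp; exact this
      · simp
    rw [h1]
    exact L.contract_one _ (hmem _)
  have h1 := edge_add hc R (0, 0) (1, 0) (1, 1)
  have h2 := edge_add hc R (0, 0) (0, 1) (1, 1)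
  rw [htop] at h1
  rw [← hv0, ← hv1, hprim, hprim]
  linarith

/-- The local primitives are patched by a partition of unity. The resulting real function is
discontinuous, but adding the integral function `β a'` makes it continuous on `U a'`. Its
exponential is therefore continuous and winds like `β a'` there. -/
theorem exists_isWinding_of_locallyExact [CompactSpace S] [T2Space S] [LocallyPathConnectedSpace S]
    {c : Cochain 1 S} (hc : c ∈ cocycles 1 S) (U : S → Set S) (hU : ∀ s, IsOpen (U s))
    (hmem : ∀ s, s ∈ U s) (β : S → S → ℤ) (hβ : ∀ s, ∀ ω : Simplex 1 S, Set.range ω ⊆ U s →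
      c ω = β s (ω (stdSimplex.vertex 1)) - β s (ω (stdSimplex.vertex 0))) :
    ∃ f φ, IsWinding f φ c := by
  obtain ⟨T, hT⟩ := isCompact_univ.elim_finite_subcover U hU
    fun x _ => Set.mem_iUnion.2 ⟨x, hmem x⟩
  obtain ⟨ρ, hρ⟩ := PartitionOfUnity.exists_isSubordinate_of_locallyFinite isClosed_univ
    (fun a : T => U a) (fun a => hU a) (locallyFinite_of_finite _)
    (fun x hx => by simpa using hT hx)
  have hsum : ∀ x, ∑ a, ρ a x = 1 := fun x => by
    rw [← finsum_eq_sum_of_fintype]; exact ρ.sum_eq_one (Set.mem_univ x)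
  -- With this sign, `φ + β a' = ∑ a, ρ a * (β a' - β a)` is a continuous logarithm on `U a'`.
  let φ : S → ℝ := fun s => -∑ a, ρ a s * β a s
  -- Two primitives of the same cocycle differ by a locally constant function on the overlap, as
  -- nearby points are joined by short edges.
  have hloc : ∀ a a' : T, ∀ s ∈ U a ∩ U a',
      ∀ᶠ y in nhds s, (β a' y - β a y : ℝ) = β a' s - β a s := by
    rintro a a' s hs
    filter_upwards [exists_pathEdge (((hU a).inter (hU a')).mem_nhds hs)]
    rintro y ⟨ω, hω, h0, h1⟩
    have e := hβ a ω (hω.trans Set.inter_subset_left)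
    have e' := hβ a' ω (hω.trans Set.inter_subset_right)
    rw [h0, h1] at e e'
    have : β a' y - β a y = β a' s - β a s := by linarith
    exact_mod_cast this
  have hterm : ∀ a a' : T, ∀ s ∈ U a', ContinuousAt (fun y => ρ a y * (β a' y - β a y : ℝ)) s := by
    intro a a' s hs
    by_cases hsa : s ∈ tsupport (ρ a)
    · have h1 : ContinuousAt (fun y => ρ a y * (β a' s - β a s : ℝ)) s := by fun_prop
      refine h1.congr ?_
      filter_upwards [hloc a a' s ⟨hρ a hsa, hs⟩] with y hy
      rw [hy]
    · refine (continuousAt_const (y := (0 : ℝ))).congr ?_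
      filter_upwards [(isClosed_tsupport (ρ a)).isOpen_compl.mem_nhds hsa] with y hy
      rw [image_eq_zero_of_notMem_tsupport hy, zero_mul]
  have hφβ : ∀ a' : T, ∀ s ∈ U a', ContinuousAt (fun y => φ y + β a' y) s := by
    intro a' s hs
    have h1 : ContinuousAt (fun y => ∑ a, ρ a y * (β a' y - β a y : ℝ)) s :=
      tendsto_finsetSum _ fun a _ => hterm a a' s hs
    refine h1.congr (Filter.Eventually.of_forall fun y => ?_)
    simp only [φ, mul_sub, Finset.sum_sub_distrib, ← Finset.sum_mul, hsum]
    ring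
  have hcover : ∀ s, ∃ a : T, s ∈ U a := fun s => by simpa using hT (Set.mem_univ s)
  have hf : Continuous fun s => circleExp (φ s) := by
    rw [continuous_iff_continuousAt]
    intro s
    obtain ⟨a, ha⟩ := hcover s
    have := ContinuousAt.comp (f := fun y => φ y + β a y) continuous_circleExp.continuousAt
      (hφβ a s ha)
    refine this.congr (Filter.Eventually.of_forall fun y => circleExp_add_int _ _)
  obtain ⟨c', hc'⟩ := exists_isWinding (f := ⟨_, hf⟩) (φ := φ) fun s => rfl
  choose a ha using hcover
  have hzero : c' - c = 0 := by
    refine cocycle_eq_zero_of_small (sub_mem hc'.mem_cocycles hc) (fun s => U (a s))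
      (fun s => hU _) ha fun s ω hω => ?_
    have hcont : Continuous fun x => φ (ω x) + β (a s) (ω x) :=
      continuous_iff_continuousAt.2 fun x =>
        ContinuousAt.comp (f := ω) (hφβ (a s) _ (hω ⟨x, rfl⟩)) ω.continuous.continuousAt
    have h1 := hc'.2 ω ⟨_, hcont⟩ fun x => circleExp_add_int _ _
    have h2 := hβ (a s) ω hω
    simp only [ContinuousMap.coe_mk] at h1
    have h3 : (c' ω : ℝ) = ((β (a s) (ω (stdSimplex.vertex 1)) -
        β (a s) (ω (stdSimplex.vertex 0)) : ℤ) : ℝ) := by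
      rw [h1]; push_cast; ring
    rw [Pi.sub_apply, h2, sub_eq_zero]
    exact_mod_cast h3
  rw [sub_eq_zero] at hzero
  exact ⟨_, φ, hzero ▸ hc'⟩

theorem exists_isWinding_of_mem_cocycles [CompactSpace S] [T2Space S] (E : Type*)
    [NormedAddCommGroup E] [NormedSpace ℝ E] [ChartedSpace E S]
    {c : Cochain 1 S} (hc : c ∈ cocycles 1 S) : ∃ f φ, IsWinding f φ c := by
  have : LocallyPathConnectedSpace S := ChartedSpace.locallyPathConnectedSpace E S
  let L : ∀ s : S, LocalContraction s := fun s =>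
    Classical.choice (nonempty_localContraction (E := E) s)
  exact exists_isWinding_of_locallyExact hc (fun s => (L s).nhd) (fun s => (L s).isOpen_nhd)
    (fun s => (L s).mem_nhd) (fun s => (L s).primitive c)
    fun s ω hω => (L s).primitive_eq hc ω hω

/-! ### The first cohomology group as homotopy classes of circle-valued functions -/

/-- The class of a cocycle. -/
def Cohomology.mk (c : cocycles 1 S) : Cohomology 1 S := QuotientAddGroup.mk c

theorem Cohomology.mk_eq_iff {c d : cocycles 1 S} :
    Cohomology.mk c = Cohomology.mk d ↔ (d - c : Cochain 1 S) ∈ coboundaries 1 S := by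
  refine QuotientAddGroup.eq.trans ?_
  rw [AddSubgroup.mem_addSubgroupOf]
  simp [neg_add_eq_sub]

/-- The winding class of a circle-valued function. -/
def windingClass (f : C(S, Circle)) : Cohomology 1 S :=
  Cohomology.mk ⟨_, (exists_isWinding (f := f) fun s => circleExp_log (f s)).choose_spec.mem_cocycles⟩

theorem IsWinding.windingClass_eq {f : C(S, Circle)} {φ : S → ℝ} {c : Cochain 1 S}
    (h : IsWinding f φ c) : windingClass f = Cohomology.mk ⟨c, h.mem_cocycles⟩ :=
  Cohomology.mk_eq_iff.2 (h.sub_mem_coboundaries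
    (exists_isWinding (f := f) fun s => circleExp_log (f s)).choose_spec)

theorem exists_isWinding_log (f : C(S, Circle)) : ∃ φ c, IsWinding f φ c :=
  ⟨_, exists_isWinding fun s => circleExp_log (f s)⟩

theorem windingClass_mul (f g : C(S, Circle)) :
    windingClass (f * g) = windingClass f + windingClass g := by
  obtain ⟨φ, c, h⟩ := exists_isWinding_log f
  obtain ⟨ψ, d, h'⟩ := exists_isWinding_log g
  rw [h.windingClass_eq, h'.windingClass_eq, (h.mul h').windingClass_eq]
  rfl

theorem windingClass_twist {f g : C(S, Circle)} (e : LocallyConstant S ℤˣ)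
    (hg : ∀ s, g s = f s ^ (e s : ℤ)) : windingClass g = twistCohomology 1 e (windingClass f) := by
  obtain ⟨φ, c, h⟩ := exists_isWinding_log f
  rw [h.windingClass_eq, (h.twist e hg).windingClass_eq]
  rfl

/-- The winding class is additive and joining is compatible with multiplication, so it suffices to
compare `f⁻¹ * g` with `1`. A vanishing class lets `φ` be corrected to a logarithm with zero
winding, which is continuous. -/
theorem windingClass_eq_iff [LocallyCompactSpace S] [LocallyPathConnectedSpace S]
    {f g : C(S, Circle)} : windingClass f = windingClass g ↔ Joined f g := by
  have h0 : ∀ h : C(S, Circle), windingClass h = 0 ↔ Joined 1 h := by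
    intro h
    rw [joined_one_iff_exists_log]
    constructor
    · intro hz
      obtain ⟨φ, c, hw⟩ := exists_isWinding_log h
      have hz' : Cohomology.mk (0 : cocycles 1 S) = Cohomology.mk ⟨c, hw.mem_cocycles⟩ :=
        Eq.trans (by rfl) (hz.symm.trans hw.windingClass_eq)
      have hc := Cohomology.mk_eq_iff.1 hz'
      simp only [AddSubgroup.coe_zero, sub_zero] at hc
      obtain ⟨φ', hφ'⟩ := hw.of_coboundary hc
      exact ⟨⟨φ', hφ'.continuous⟩, hφ'.1⟩
    · rintro ⟨θ, hθ⟩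
      rw [(isWinding_zero hθ).windingClass_eq]
      rfl
  have hmul : windingClass g = windingClass f + windingClass (f⁻¹ * g) := by
    rw [← windingClass_mul, mul_inv_cancel_left]
  have hj : Joined 1 (f⁻¹ * g) ↔ Joined f g := by
    constructor
    · intro h
      have := (Joined.refl f).mul h
      rwa [mul_one, mul_inv_cancel_left] at this
    · intro h
      have := (Joined.refl f⁻¹).mul h
      rwa [inv_mul_cancel] at this
  rw [← hj, ← h0, hmul]
  exact left_eq_add

theorem windingClass_surjective [CompactSpace S] [T2Space S] (E : Type*)
    [NormedAddCommGroup E] [NormedSpace ℝ E] [ChartedSpace E S] :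
    Function.Surjective (windingClass (S := S)) := by
  intro a
  obtain ⟨⟨c, hc⟩, rfl⟩ := QuotientAddGroup.mk_surjective a
  obtain ⟨f, φ, h⟩ := exists_isWinding_of_mem_cocycles E hc
  exact ⟨f, h.windingClass_eq⟩

end

/-! ### Homotopy classes of maps to the flux group -/

namespace FluxGroup
variable {S K : Type*} [TopologicalSpace S] [Group K] [TopologicalSpace K] {ε₁ ε₂ : K →* ℤˣ}

theorem continuous_pair : Continuous fun x : FluxGroup ε₁ ε₂ => (x.left, x.right) :=
  continuous_induced_dom

/-- The first component. -/
def fstMap (ε₁ ε₂ : K →* ℤˣ) : C(FluxGroup ε₁ ε₂, Circle) :=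
  ⟨fun x => x.left.1, continuous_fst.comp (continuous_fst.comp continuous_pair)⟩

/-- The second component. -/
def sndMap (ε₁ ε₂ : K →* ℤˣ) : C(FluxGroup ε₁ ε₂, Circle) :=
  ⟨fun x => x.left.2, continuous_snd.comp (continuous_fst.comp continuous_pair)⟩

/-- The discrete component. -/
def rightMap (ε₁ ε₂ : K →* ℤˣ) : C(FluxGroup ε₁ ε₂, K) :=
  ⟨fun x => x.right, continuous_snd.comp continuous_pair⟩

/-- The map to the flux group with given components. -/
def ofComponents (ε₁ ε₂ : K →* ℤˣ) (z w : C(S, Circle)) (k : C(S, K)) :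
    C(S, FluxGroup ε₁ ε₂) :=
  ⟨fun s => ⟨(z s, w s), k s⟩, continuous_induced_rng.2
    ((z.continuous.prodMk w.continuous).prodMk k.continuous)⟩

theorem joined_ofComponents [LocallyCompactSpace S] {z z' w w' : C(S, Circle)} (k : C(S, K))
    (hz : Joined z z') (hw : Joined w w') :
    Joined (ofComponents ε₁ ε₂ z w k) (ofComponents ε₁ ε₂ z' w' k) := by
  obtain ⟨γ⟩ := hz
  obtain ⟨δ⟩ := hw
  exact ⟨{
    toContinuousMap := ContinuousMap.curry (ofComponents ε₁ ε₂
      ⟨fun q : I × S => γ q.1 q.2, by fun_prop⟩ ⟨fun q : I × S => δ q.1 q.2, by fun_prop⟩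
      ⟨fun q : I × S => k q.2, by fun_prop⟩)
    source' := by ext1 s; simp [ofComponents]
    target' := by ext1 s; simp [ofComponents] }⟩

variable [DiscreteTopology K]

/-- The sector of a map to the flux group. -/
def sector [LocallyCompactSpace S] (f : C(S, FluxGroup ε₁ ε₂)) : FluxSectors S ε₁ ε₂ :=
  ⟨Multiplicative.ofAdd (windingClass ((fstMap ε₁ ε₂).comp f), windingClass ((sndMap ε₁ ε₂).comp f)),
    CohomologyZero.mk ((rightMap ε₁ ε₂).comp f)⟩

/-- As `K` is discrete, homotopic `K`-components are equal. The remaining data are the two circle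
components, deformed independently over the same `K`-component. -/
theorem sector_eq_iff [LocallyCompactSpace S] [LocallyPathConnectedSpace S]
    {f g : C(S, FluxGroup ε₁ ε₂)} : sector f = sector g ↔ Joined f g := by
  constructor
  · intro h
    have hl := congrArg (fun x => Multiplicative.toAdd x.left) h
    have hk : Joined ((rightMap ε₁ ε₂).comp f) ((rightMap ε₁ ε₂).comp g) :=
      Quotient.exact (congrArg SemidirectProduct.right h)
    have hz := windingClass_eq_iff.1 (congrArg Prod.fst hl)
    have hw := windingClass_eq_iff.1 (congrArg Prod.snd hl)
    have h1 := joined_ofComponents (ε₁ := ε₁) (ε₂ := ε₂) ((rightMap ε₁ ε₂).comp f) hz hw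
    have hk' := eq_of_path hk.somePath
    have hf : ofComponents ε₁ ε₂ ((fstMap ε₁ ε₂).comp f) ((sndMap ε₁ ε₂).comp f)
        ((rightMap ε₁ ε₂).comp f) = f := rfl
    have hg : ofComponents ε₁ ε₂ ((fstMap ε₁ ε₂).comp g) ((sndMap ε₁ ε₂).comp g)
        ((rightMap ε₁ ε₂).comp g) = g := rfl
    rw [hf, hk', hg] at h1
    exact h1
  · rintro ⟨γ⟩
    have hpost : ∀ {Y : Type _} [TopologicalSpace Y] (p : C(FluxGroup ε₁ ε₂, Y)),
        Joined (p.comp f) (p.comp g) := fun p => ⟨γ.map (ContinuousMap.continuous_postcomp p)⟩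
    have hz := windingClass_eq_iff.2 (hpost (fstMap ε₁ ε₂))
    have hw := windingClass_eq_iff.2 (⟨γ.map (ContinuousMap.continuous_postcomp (sndMap ε₁ ε₂))⟩ :
      Joined ((sndMap ε₁ ε₂).comp f) ((sndMap ε₁ ε₂).comp g))
    have hk := eq_of_path (γ.map (ContinuousMap.continuous_postcomp (rightMap ε₁ ε₂)))
    simp only [sector, hz, hw]
    congr 1
    exact congrArg CohomologyZero.mk hk

theorem sector_surjective [CompactSpace S] [T2Space S] (E : Type*)
    [NormedAddCommGroup E] [NormedSpace ℝ E] [ChartedSpace E S] :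
    Function.Surjective (sector (S := S) (ε₁ := ε₁) (ε₂ := ε₂)) := by
  rintro ⟨a, ⟨k⟩⟩
  obtain ⟨z, hz⟩ := windingClass_surjective E a.toAdd.1
  obtain ⟨w, hw⟩ := windingClass_surjective E a.toAdd.2
  refine ⟨ofComponents ε₁ ε₂ z w k, ?_⟩
  have h1 : (fstMap ε₁ ε₂).comp (ofComponents ε₁ ε₂ z w k) = z := rfl
  have h2 : (sndMap ε₁ ε₂).comp (ofComponents ε₁ ε₂ z w k) = w := rfl
  simp only [sector, h1, h2, hz, hw]
  rfl

/-- Each circle component of `f * g` is that of `f` times that of `g` raised to the locally constant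
sign of the `K`-component of `f`. This power twists the winding class. -/
theorem sector_mul [LocallyCompactSpace S] (f g : C(S, FluxGroup ε₁ ε₂)) :
    sector (f * g) = sector f * sector g := by
  let k : CohomologyZero S K := CohomologyZero.mk ((rightMap ε₁ ε₂).comp f)
  let pow : (K →* ℤˣ) → C(S, Circle) → S → Circle := fun ε z s => z s ^ ((signOf ε k s : ℤˣ) : ℤ)
  have hpow : ∀ ε z, Continuous (pow ε z) := by
    intro ε z
    rw [continuous_iff_continuousAt]
    intro s
    have h1 : ContinuousAt (fun y => z y ^ ((signOf ε k s : ℤˣ) : ℤ)) s :=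
      (z.continuous.zpow _).continuousAt
    refine h1.congr ?_
    filter_upwards [(signOf ε k).isLocallyConstant.eventually_eq s] with y hy
    have hy' : signOf ε k y = signOf ε k s := hy
    simp only [pow, hy']
  have h1 : (fstMap ε₁ ε₂).comp (f * g) = (fstMap ε₁ ε₂).comp f *
      ⟨pow ε₁ ((fstMap ε₁ ε₂).comp g), hpow _ _⟩ := rfl
  have h2 : (sndMap ε₁ ε₂).comp (f * g) = (sndMap ε₁ ε₂).comp f *
      ⟨pow ε₂ ((sndMap ε₁ ε₂).comp g), hpow _ _⟩ := rfl
  simp only [sector, h1, h2, windingClass_mul]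
  rw [windingClass_twist (f := (fstMap ε₁ ε₂).comp g)
      (g := ⟨pow ε₁ ((fstMap ε₁ ε₂).comp g), hpow _ _⟩) (signOf ε₁ k) fun s => rfl,
    windingClass_twist (f := (sndMap ε₁ ε₂).comp g)
      (g := ⟨pow ε₂ ((sndMap ε₁ ε₂).comp g), hpow _ _⟩) (signOf ε₂ k) fun s => rfl]
  rfl

/-- The group of homotopy classes of maps to the flux group is the group of flux sectors. -/
theorem exists_cohomologyZero_equiv (S : Type*) [TopologicalSpace S] [CompactSpace S] [T2Space S]
    (E : Type*) [NormedAddCommGroup E] [NormedSpace ℝ E] [ChartedSpace E S] (ε₁ ε₂ : K →* ℤˣ) :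
    Nonempty (CohomologyZero S (FluxGroup ε₁ ε₂) ≃* FluxSectors S ε₁ ε₂) := by
  have : LocallyPathConnectedSpace S := ChartedSpace.locallyPathConnectedSpace E S
  let m : CohomologyZero S (FluxGroup ε₁ ε₂) → FluxSectors S ε₁ ε₂ :=
    ZerothHomotopy.lift sector fun f g γ => sector_eq_iff.2 ⟨γ⟩
  have hm : Function.Bijective m := by
    constructor
    · rintro ⟨f⟩ ⟨g⟩ h
      exact ZerothHomotopy.sound (sector_eq_iff.1 h).somePath
    · intro a
      obtain ⟨f, hf⟩ := sector_surjective E a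
      exact ⟨.mk f, hf⟩
  exact ⟨{ Equiv.ofBijective m hm with
    map_mul' := by rintro ⟨f⟩ ⟨g⟩; exact sector_mul f g }⟩

end FluxGroup

/-! ### The Pontrjagin algebra -/

section Algebra
open scoped TensorProduct

theorem groupAlgebraDagger_single {Γ : Type w} [Group Γ] (g : Γ) (z : ℂ) :
    groupAlgebraDagger (MonoidAlgebra.single g z) = MonoidAlgebra.single g⁻¹ (starRingEnd ℂ z) :=
  Finsupp.sum_single_index (by simp)

theorem groupAlgebraDagger_add {Γ : Type w} [Group Γ] (a b : MonoidAlgebra ℂ Γ) :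
    groupAlgebraDagger (a + b) = groupAlgebraDagger a + groupAlgebraDagger b :=
  Finsupp.sum_add_index' (by simp) (by simp)

theorem groupAlgebraDagger_smul {Γ : Type w} [Group Γ] (z : ℂ) (a : MonoidAlgebra ℂ Γ) :
    groupAlgebraDagger (z • a) = starRingEnd ℂ z • groupAlgebraDagger a := by
  rw [groupAlgebraDagger, groupAlgebraDagger, MonoidAlgebra.coeff_smul,
    Finsupp.sum_smul_index (by simp), Finsupp.smul_sum]
  simp [MonoidAlgebra.smul_single]

/-- Degree-zero homology as the free module on a set which enumerates the path components. -/
def H0.equivOfComponents {X Γ : Type*} [TopologicalSpace X] (e : ZerothHomotopy X ≃ Γ) :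
    H0 X ≃ₗ[ℂ] MonoidAlgebra ℂ Γ :=
  ((H0.equiv X).trans (Finsupp.domLCongr e)).trans (MonoidAlgebra.coeffLinearEquiv ℂ).symm

theorem H0.equivOfComponents_pt {X Γ : Type*} [TopologicalSpace X] (e : ZerothHomotopy X ≃ Γ)
    (p : X) : H0.equivOfComponents e (H0.pt p) = MonoidAlgebra.single (e (.mk p)) 1 := by
  simp only [H0.equivOfComponents, LinearEquiv.trans_apply, H0.equiv_pt, Finsupp.domLCongr_single]
  rfl

namespace Pontrjagin
variable {X : Type u} {Γ : Type w} [TopologicalSpace X] {x : X} [Group Γ]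

theorem mk_eq_of_homotopic {γ δ : Path x x} (h : γ.Homotopic δ) :
    (ZerothHomotopy.mk γ : ZerothHomotopy (Path x x)) = .mk δ :=
  ZerothHomotopy.sound (ClassifyingSpace.joined_path_of_homotopic h).somePath

/-- The Pontrjagin algebra is the group algebra of the group of path components of loops. -/
theorem exists_bialgEquiv (e : ZerothHomotopy (Path x x) ≃ Γ)
    (he : ∀ γ δ : Path x x, e (.mk (γ.trans δ)) = e (.mk γ) * e (.mk δ)) :
    ∃ Ψ : Pontrjagin x ≃ₐc[ℂ] MonoidAlgebra ℂ Γ,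
      ∀ γ, Ψ (loop γ) = MonoidAlgebra.single (e (.mk γ)) 1 := by
  let L : Pontrjagin x ≃ₗ[ℂ] MonoidAlgebra ℂ Γ := H0.equivOfComponents e
  have hL : ∀ γ, L (loop γ) = MonoidAlgebra.single (e (.mk γ)) 1 := H0.equivOfComponents_pt e
  -- The constant loop is idempotent up to homotopy, and the only idempotent of a group is `1`.
  have he1 : e (.mk (Path.refl x)) = 1 := by
    have h := he (Path.refl x) (Path.refl x)
    rw [mk_eq_of_homotopic ⟨Path.Homotopy.reflTrans (Path.refl x)⟩] at h
    exact left_eq_mul.1 h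
  let A : Pontrjagin x ≃ₐ[ℂ] MonoidAlgebra ℂ Γ := AlgEquiv.ofLinearEquiv L
    (by rw [one_def, hL, he1]; rfl) (fun a b => by
      induction a using Pontrjagin.induction with
      | h_add a a' h h' => simp only [_root_.add_mul, map_add, h, h']
      | h_smul z a h => simp only [map_smul, h, _root_.smul_mul_assoc]
      | h_loop γ =>
      induction b using Pontrjagin.induction with
      | h_add a a' h h' => simp only [_root_.mul_add, map_add, h, h']
      | h_smul z a h => simp only [map_smul, h, _root_.mul_smul_comm]
      | h_loop δ => rw [loop_mul, hL, hL, hL, he, MonoidAlgebra.single_mul_single, one_mul])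
  have hA : ∀ γ, A (loop γ) = MonoidAlgebra.single (e (.mk γ)) 1 := hL
  refine ⟨BialgEquiv.ofAlgEquiv A ?_ ?_, hA⟩
  · refine AlgHom.toLinearMap_injective (hom_ext fun γ => ?_)
    have h1 : CoalgebraStruct.counit (R := ℂ) (A (loop γ)) = 1 := by
      rw [hA, MonoidAlgebra.counit_single]; simp
    exact h1.trans (counit_loop γ).symm
  · refine AlgHom.toLinearMap_injective (hom_ext fun γ => ?_)
    have h1 : Algebra.TensorProduct.map (A : Pontrjagin x →ₐ[ℂ] MonoidAlgebra ℂ Γ)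
        (A : Pontrjagin x →ₐ[ℂ] MonoidAlgebra ℂ Γ)
        (CoalgebraStruct.comul (R := ℂ) (loop γ)) = A (loop γ) ⊗ₜ[ℂ] A (loop γ) := by
      rw [comul_loop]; rfl
    have h2 : CoalgebraStruct.comul (R := ℂ) (A (loop γ)) = A (loop γ) ⊗ₜ[ℂ] A (loop γ) := by
      rw [hA, MonoidAlgebra.comul_single]; simp
    exact h1.trans h2.symm

/-- The loop `γ.symm.trans γ` is idempotent up to homotopy, so its image in the group is `1`. -/
theorem component_symm {e : ZerothHomotopy (Path x x) ≃ Γ}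
    (he : ∀ γ δ : Path x x, e (.mk (γ.trans δ)) = e (.mk γ) * e (.mk δ)) (γ : Path x x) :
    e (.mk γ.symm) = (e (.mk γ))⁻¹ := by
  refine eq_inv_of_mul_eq_one_left ?_
  have h := he (γ.symm.trans γ) (γ.symm.trans γ)
  have h1 : (ZerothHomotopy.mk ((γ.symm.trans γ).trans (γ.symm.trans γ)) :
      ZerothHomotopy (Path x x)) = .mk (γ.symm.trans γ) := by
    have hr : (γ.symm.trans γ).Homotopic (Path.refl x) :=
      ⟨(Path.Homotopy.reflSymmTrans γ).symm⟩
    exact mk_eq_of_homotopic ((Path.Homotopic.hcomp hr (.refl _)).trans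
      ⟨Path.Homotopy.reflTrans _⟩)
  rw [h1] at h
  rw [← he]
  exact left_eq_mul.1 h

variable {Ψ : Pontrjagin x ≃ₐc[ℂ] MonoidAlgebra ℂ Γ} {e : ZerothHomotopy (Path x x) ≃ Γ}

theorem map_antipode (he : ∀ γ δ : Path x x, e (.mk (γ.trans δ)) = e (.mk γ) * e (.mk δ))
    (hΨ : ∀ γ, Ψ (loop γ) = MonoidAlgebra.single (e (.mk γ)) 1) (b : Pontrjagin x) :
    Ψ (HopfAlgebraStruct.antipode ℂ b) = HopfAlgebraStruct.antipode ℂ (Ψ b) := by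
  induction b using Pontrjagin.induction with
  | h_add a a' h h' => simp only [map_add, h, h']
  | h_smul z a h => simp only [map_smul, h]
  | h_loop γ =>
    rw [antipode_loop, hΨ, hΨ, component_symm he, MonoidAlgebra.antipode_single]
    simp

theorem dagger_loop (γ : Path x x) : dagger x (loop γ) = loop γ.symm := by
  have h : dagger x (loop γ) = H0.conj _ (H0.map (rev x) (H0.pt γ)) := rfl
  rw [h, H0.map_pt, H0.conj_pt]
  rfl

theorem map_dagger (he : ∀ γ δ : Path x x, e (.mk (γ.trans δ)) = e (.mk γ) * e (.mk δ))
    (hΨ : ∀ γ, Ψ (loop γ) = MonoidAlgebra.single (e (.mk γ)) 1) (b : Pontrjagin x) :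
    Ψ (dagger x b) = groupAlgebraDagger (Ψ b) := by
  induction b using Pontrjagin.induction with
  | h_add a a' h h' => simp only [map_add, h, h', groupAlgebraDagger_add]
  | h_smul z a h =>
    rw [map_smulₛₗ, map_smul, h, map_smul, groupAlgebraDagger_smul]
  | h_loop γ =>
    rw [dagger_loop, hΨ, hΨ, component_symm he, groupAlgebraDagger_single, map_one]

end Pontrjagin

end Algebra

end FluxModuli

end

/-- Since `Φ` and `Ψ` are bijective, the identity `Φ = Ψ ∘ r_*` contains the claim that `r_*` is an
isomorphism. It also says that `Φ` respects the Hopf structure carried over through `r`. -/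
theorem theorem3 {n : ℕ} (S : Type*) [TopologicalSpace S] [T2Space S] [CompactSpace S]
    [ChartedSpace (EuclideanSpace ℝ (Fin n)) S]
    (K : Type*) [Group K] [TopologicalSpace K] [DiscreteTopology K] (ε₁ ε₂ : K →* ℤˣ) :
    ∃ (Φ : FluxModuli.H0
            (FluxModuli.TopFields S
              (FluxModuli.ClassifyingSpace.base (FluxModuli.FluxGroup ε₁ ε₂))) ≃ₗ[ℂ]
          MonoidAlgebra ℂ (FluxModuli.FluxSectors S ε₁ ε₂))
      (Ψ : FluxModuli.Pontrjagin
            (ContinuousMap.const S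
              (FluxModuli.ClassifyingSpace.base (FluxModuli.FluxGroup ε₁ ε₂))) ≃ₐc[ℂ]
          MonoidAlgebra ℂ (FluxModuli.FluxSectors S ε₁ ε₂)),
      (∀ a, Φ a = Ψ (FluxModuli.H0.map (FluxModuli.toLoops S
        (FluxModuli.ClassifyingSpace.base (FluxModuli.FluxGroup ε₁ ε₂))) a)) ∧
      (∀ b, Ψ (HopfAlgebraStruct.antipode ℂ b) = HopfAlgebraStruct.antipode ℂ (Ψ b)) ∧
      (∀ b, Ψ (FluxModuli.Pontrjagin.dagger _ b) = FluxModuli.groupAlgebraDagger (Ψ b)) := by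
  obtain ⟨e₁, he₁⟩ := FluxModuli.ClassifyingSpace.exists_loop_equiv S (FluxModuli.FluxGroup ε₁ ε₂)
  obtain ⟨e₂⟩ := FluxModuli.FluxGroup.exists_cohomologyZero_equiv S
    (EuclideanSpace ℝ (Fin n)) ε₁ ε₂
  let b := FluxModuli.ClassifyingSpace.base (FluxModuli.FluxGroup ε₁ ε₂)
  let e := e₁.trans e₂.toEquiv
  have he : ∀ γ δ, e (.mk (γ.trans δ)) = e (.mk γ) * e (.mk δ) := fun γ δ =>
    (congrArg e₂ (he₁ γ δ)).trans (map_mul e₂ _ _)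
  obtain ⟨Ψ, hΨ⟩ := FluxModuli.Pontrjagin.exists_bialgEquiv e he
  -- Degree-zero homology only sees path components, so bijectivity of `toLoops` on `π₀` is all that
  -- is required.
  have hbij : Function.Bijective (ZerothHomotopy.lift (fun f => ZerothHomotopy.mk
      (FluxModuli.toLoops S b f)) fun f f' γ => ZerothHomotopy.sound
        (γ.map (FluxModuli.toLoops S b).continuous)) := by
    constructor
    · rintro ⟨f⟩ ⟨f'⟩ h
      exact ZerothHomotopy.sound (FluxModuli.joined_of_joined_toLoops
        (Quotient.exact h)).somePath
    · rintro ⟨γ⟩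
      obtain ⟨f, rfl⟩ := FluxModuli.toLoops_surjective γ
      exact ⟨.mk f, rfl⟩
  -- The components of the field space are enumerated through `toLoops`, which makes the
  -- compatibility with `Ψ` immediate on classes of points.
  let Φ := FluxModuli.H0.equivOfComponents ((Equiv.ofBijective _ hbij).trans e)
  refine ⟨Φ, Ψ, fun a => ?_, FluxModuli.Pontrjagin.map_antipode he hΨ,
    FluxModuli.Pontrjagin.map_dagger he hΨ⟩
  let ΨL : FluxModuli.Pontrjagin (ContinuousMap.const S b) →ₗ[ℂ]
      MonoidAlgebra ℂ (FluxModuli.FluxSectors S ε₁ ε₂) :=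
    { toFun := Ψ, map_add' := map_add Ψ, map_smul' := map_smul Ψ }
  have h : Φ.toLinearMap = ΨL ∘ₗ FluxModuli.H0.map (FluxModuli.toLoops S b) := by
    refine FluxModuli.H0.hom_ext fun f => ?_
    refine (FluxModuli.H0.equivOfComponents_pt _ f).trans ?_
    have h1 : FluxModuli.H0.map (FluxModuli.toLoops S b) (FluxModuli.H0.pt f) =
      FluxModuli.Pontrjagin.loop (FluxModuli.toLoops S b f) := FluxModuli.H0.map_pt _ f
    exact ((congrArg Ψ h1).trans (hΨ _)).symm
  exact LinearMap.congr_fun h a
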